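/- **Notation.** Write $\mathbb R^2_+=\{(x,y):x\in\mathbb R,\ y>0\}$, $\langle r\rangle=(1+|r|^2)^{1/2}$, and let $\Lambda^s$ be the Fourier multiplier in the variable $x\in\mathbb R$ with symbol $\langle\xi\rangle^s$. For $T>0$ write $\|\cdot\|$ for the norm of $L^2([0,T]\times\mathbb R^2_+)$ (with value $+\infty$ for functions not in that space). **Hypotheses on $(u,v)$.** Let $\sigma>1/2$, $C_*>1$, $c>0$, $C_0>0$ be real, let $N_0\ge 7$ be an integer and $T>0$. Let $(u,v)$ be a classical solution of the Prandtl equation $$\partial_tu+u\,\partial_xu+v\,\partial_yu-\partial_y^2u=0,\qquad \partial_xu+\partial_yv=0\qquad\text{in } ]0,T[\times\mathbb R^2_+,$$ $$u|_{y=0}=v|_{y=0}=0,\qquad \lim_{y\to+\infty}u=1,$$ such that in $]0,T[\times\mathbb R^2_+$ $$C_*^{-1}\langle y\rangle^{-\sigma}\le\partial_yu\le C_*\langle y\rangle^{-\sigma},\qquad |\partial_y^2u|+|\partial_y^3u|\le C_*\langle y\rangle^{-\sigma-1},$$ and $$\|e^{2cy}\partial_xu\|_{L^\infty([0,T];H^{N_0}(\mathbb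 R^2_+))}+\|e^{2cy}\partial_x\partial_yu\|_{L^2([0,T];H^{N_0}(\mathbb R^2_+))}\le C_0 .$$ **Hypotheses on $f$, $h$, $g$.** Let $h,g,\partial_yh,\partial_yg\in L^2([0,T]\times\mathbb R^2_+)$, let $f\in L^2([0,T];H^2(\mathbb R^2_+))$ with $\partial_y^3f\in L^2([0,T]\times\mathbb R^2_+)$ (all functions complex-valued), and let $f$ solve $$\partial_tf+u\,\partial_xf+v\,\partial_yf-\partial_y^2f=h\qquad\text{in } ]0,T[\times\mathbb R^2_+,$$ with $$f|_{t=0}=f|_{t=T}=0,\qquad \partial_yf|_{y=0}=0,\qquad \partial_tf|_{y=0}=\partial_y^2f|_{y=0}+g|_{y=0}.$$ Here derivatives of $f,g,h$ are weak derivatives, the equation holds almost everywhere, and the initial, final and boundary conditions hold in the sense of traces (in particular all this holds for a classical solution). **Conclusion.** For every $\varepsilon>0$ there is a constant $C_\varepsilon>0$ depending only on $\varepsilon,\sigma,c,C_*,C_0$ such that, for all such $N_0,T,u,v,f,h,g$, $$\begin{aligned}\|\langle y\rangle^{-\sigma/2}\Lambda^{1/3}f\|+\|\partial_y^2\Lambda^{-1/3}f\|\le{}&\varepsilon\,\|\Lambda^{-2/3}\partial_yh\|+C_\varepsilon\big(\|\Lambda^{-1/3}h\|+\|\partial_yf\|+\|f\|\big)\\&+C_\varepsilon\big(\|\langle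 y\rangle^{-\sigma/2}\partial_y\Lambda^{1/6}f\|+\|\langle y\rangle^{\sigma}\Lambda^{-1/3}\partial_yg\|\big).\end{aligned}$$ Moreover, there is a constant $\tilde C>0$ depending only on $\sigma,c,C_*,C_0$ such that, for all such $N_0,T,u,v,f,h,g$, $$\|\partial_y^3\Lambda^{-2/3}f\|\le\tilde C\big(\|\langle y\rangle^{-\sigma/2}\Lambda^{1/3}f\|+\|\Lambda^{-2/3}\partial_yh\|+\|\partial_yf\|+\|f\|\big).$$ -/

import Mathlib

open MeasureTheory Set Filter Topology
open scoped ENNReal ContDiff FourierTransform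

noncomputable section

namespace Prandtl

/-! ### Weak derivatives, traces and Sobolev norms -/

/-- `w'` is the weak derivative of `w` in the direction `e` on the open set `Ω`. -/
def HasWeakDeriv {E F : Type*} [NormedAddCommGroup E] [NormedSpace ℝ E] [MeasureSpace E]
    [NormedAddCommGroup F] [NormedSpace ℝ F] (Ω : Set E) (e : E) (w w' : E → F) : Prop :=
  LocallyIntegrableOn w Ω volume ∧ LocallyIntegrableOn w' Ω volume ∧
    ∀ φ : E → ℝ, ContDiff ℝ ∞ φ → HasCompactSupport φ → tsupport φ ⊆ Ω →
      ∫ p in Ω, (fderiv ℝ φ p e) • w p = -∫ p in Ω, φ p • w' p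

/-- For `w ∈ L²(Ω)` whose weak derivative `w'` in the direction `e` is in `L²(Ω)`: the trace of `w`
on the part `∂Ω ∩ U` of the boundary (`U` open, `e` normal to `∂Ω ∩ U`) is zero. This is expressed
by Green's formula: the boundary term vanishes for all test functions supported in `U`, which need
not vanish on `∂Ω ∩ U`. -/
def HasZeroTrace {E F : Type*} [NormedAddCommGroup E] [NormedSpace ℝ E] [MeasureSpace E]
    [NormedAddCommGroup F] [NormedSpace ℝ F] (Ω U : Set E) (e : E) (w : E → F) : Prop :=
  MemLp w 2 (volume.restrict Ω) ∧
    ∃ w' : E → F, MemLp w' 2 (volume.restrict Ω) ∧ HasWeakDeriv Ω e w w' ∧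
      ∀ φ : E → ℝ, ContDiff ℝ ∞ φ → HasCompactSupport φ → tsupport φ ⊆ U →
        ∫ p in Ω, (fderiv ℝ φ p e) • w p = -∫ p in Ω, φ p • w' p

/-- The half plane `{(x, y) : y > 0}`. -/
def halfPlane : Set (ℝ × ℝ) := univ ×ˢ Ioi 0

/-- `D i j` is the weak derivative `∂_x^i ∂_y^j w` on the half plane, for all `i + j ≤ k`. -/
def IsWeakJet (k : ℕ) (w : ℝ × ℝ → ℝ) (D : ℕ → ℕ → ℝ × ℝ → ℝ) : Prop :=
  D 0 0 = w ∧ ∀ i j : ℕ, i + j < k →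
    HasWeakDeriv halfPlane (1, 0) (D i j) (D (i + 1) j) ∧
    HasWeakDeriv halfPlane (0, 1) (D i j) (D i (j + 1))

/-- The norm of `w` in `H^k` of the half plane; it is `⊤` if `w` is not in `H^k`.
(Weak derivatives are unique up to null sets, so the infimum is over equal numbers.) -/
def sobolevNorm (k : ℕ) (w : ℝ × ℝ → ℝ) : ℝ≥0∞ :=
  ⨅ (D : ℕ → ℕ → ℝ × ℝ → ℝ) (_ : IsWeakJet k w D),
    (∑ i ∈ Finset.range (k + 1), ∑ j ∈ Finset.range (k + 1 - i),
      eLpNorm (D i j) 2 (volume.restrict halfPlane) ^ 2) ^ (1 / 2 : ℝ)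

/-! ### Points `(t, x, y)`, domains and classical partial derivatives -/

/-- The bracket `⟨r⟩ = (1 + r²)^{1/2}`. -/
def bracket (r : ℝ) : ℝ := Real.sqrt (1 + r ^ 2)

/-- The open domain `]0,T[ × ℝ²_+` of points `(t, x, y)`. -/
def slab (T : ℝ) : Set (ℝ × ℝ × ℝ) := Ioo 0 T ×ˢ (univ ×ˢ Ioi 0)

/-- `∂_t`. -/
def dt (w : ℝ × ℝ × ℝ → ℝ) (p : ℝ × ℝ × ℝ) : ℝ := deriv (fun s => w (s, p.2.1, p.2.2)) p.1

/-- `∂_x`. -/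
def dx (w : ℝ × ℝ × ℝ → ℝ) (p : ℝ × ℝ × ℝ) : ℝ := deriv (fun s => w (p.1, s, p.2.2)) p.2.1

/-- `∂_y`. -/
def dy (w : ℝ × ℝ × ℝ → ℝ) (p : ℝ × ℝ × ℝ) : ℝ := deriv (fun s => w (p.1, p.2.1, s)) p.2.2

/-- `∂_t w` exists at `p`. -/
def DiffT (w : ℝ × ℝ × ℝ → ℝ) (p : ℝ × ℝ × ℝ) : Prop :=
  DifferentiableAt ℝ (fun s => w (s, p.2.1, p.2.2)) p.1

/-- `∂_x w` exists at `p`. -/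
def DiffX (w : ℝ × ℝ × ℝ → ℝ) (p : ℝ × ℝ × ℝ) : Prop :=
  DifferentiableAt ℝ (fun s => w (p.1, s, p.2.2)) p.2.1

/-- `∂_y w` exists at `p`. -/
def DiffY (w : ℝ × ℝ × ℝ → ℝ) (p : ℝ × ℝ × ℝ) : Prop :=
  DifferentiableAt ℝ (fun s => w (p.1, p.2.1, s)) p.2.2

/-! ### The Prandtl equation -/

/-- `(u, v)` is a classical solution on `[0,T]` of the Prandtl equation with outflow `U = 1`
(the initial datum is `u (0, ·, ·)`). -/
structure IsPrandtlSolution (T : ℝ) (u v : ℝ × ℝ × ℝ → ℝ) : Prop where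
  continuousOn_u : ContinuousOn u (Icc 0 T ×ˢ (univ ×ˢ Ici 0))
  continuousOn_v : ContinuousOn v (Ioo 0 T ×ˢ (univ ×ˢ Ici 0))
  diff : ∀ p ∈ slab T, DiffT u p ∧ DiffX u p ∧ DiffY u p ∧ DiffY (dy u) p ∧ DiffY v p
  continuousOn_dt : ContinuousOn (dt u) (slab T)
  continuousOn_dx : ContinuousOn (dx u) (slab T)
  continuousOn_dy : ContinuousOn (dy u) (slab T)
  continuousOn_dyy : ContinuousOn (dy (dy u)) (slab T)
  momentum : ∀ p ∈ slab T, dt u p + u p * dx u p + v p * dy u p - dy (dy u) p = 0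
  divergence : ∀ p ∈ slab T, dx u p + dy v p = 0
  boundary : ∀ t ∈ Ioo 0 T, ∀ x : ℝ, u (t, x, 0) = 0 ∧ v (t, x, 0) = 0
  outflow : ∀ t ∈ Ioo 0 T, ∀ x : ℝ, Tendsto (fun y => u (t, x, y)) atTop (𝓝 1)

/-- The monotonicity condition
`C⁻¹ ⟨y⟩^{-σ} ≤ ∂_y u ≤ C ⟨y⟩^{-σ}`, `|∂_y² u| + |∂_y³ u| ≤ C ⟨y⟩^{-σ-1}`. -/
def IsMonotoneFlow (T σ Cs : ℝ) (u : ℝ × ℝ × ℝ → ℝ) : Prop :=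
  ∀ p ∈ slab T, DiffY (dy (dy u)) p ∧
    Cs⁻¹ * bracket p.2.2 ^ (-σ) ≤ dy u p ∧ dy u p ≤ Cs * bracket p.2.2 ^ (-σ) ∧
    |dy (dy u) p| + |dy (dy (dy u)) p| ≤ Cs * bracket p.2.2 ^ (-σ - 1)

/-- The slice `(x, y) ↦ e^{2cy} w(t, x, y)`. -/
def expWeight (c : ℝ) (w : ℝ × ℝ × ℝ → ℝ) (t : ℝ) (q : ℝ × ℝ) : ℝ :=
  Real.exp (2 * c * q.2) * w (t, q.1, q.2)

/-- `‖e^{2cy} ∂_x u‖_{L^∞([0,T]; H^N)} + ‖e^{2cy} ∂_x ∂_y u‖_{L²([0,T]; H^N)} ≤ C₀`. -/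
def HasDecay (T c C₀ : ℝ) (N : ℕ) (u : ℝ × ℝ × ℝ → ℝ) : Prop :=
  essSup (fun t => sobolevNorm N (expWeight c (dx u) t)) (volume.restrict (Ioo 0 T)) +
    (∫⁻ t in Ioo 0 T, sobolevNorm N (expWeight c (dx (dy u)) t) ^ 2) ^ (1 / 2 : ℝ)
      ≤ ENNReal.ofReal C₀

/-! ### The tangential multiplier `Λ^s` -/

/-- `ψ = Λ^s φ` on `L²(ℝ)`: the Fourier multiplier with symbol `⟨ξ⟩^s`. Mathlib's Fourier transform
is `∫ e^{-2πixξ} φ(x) dx`, so in its frequency variable the symbol is `⟨2πξ⟩^s`. -/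
def IsLam (s : ℝ) (φ : ℝ → ℂ) (ψ : Lp ℂ 2 (volume : Measure ℝ)) : Prop :=
  ∃ h : MemLp φ 2 (volume : Measure ℝ),
    ⇑(𝓕 ψ : Lp ℂ 2 (volume : Measure ℝ)) =ᵐ[volume]
      fun ξ => ((bracket (2 * Real.pi * ξ) ^ s : ℝ) : ℂ) * (𝓕 (h.toLp φ) : Lp ℂ 2 (volume : Measure ℝ)) ξ

/-- `‖Λ^s φ‖_{L²(ℝ)}`; it is `⊤` if `Λ^s φ` is not in `L²(ℝ)` (there is at most one `ψ`). -/
def lamNorm (s : ℝ) (φ : ℝ → ℂ) : ℝ≥0∞ :=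
  ⨅ (ψ : Lp ℂ 2 (volume : Measure ℝ)) (_ : IsLam s φ ψ), ‖ψ‖ₑ

/-- `‖⟨y⟩^a Λ^s w‖_{L²([0,T] × ℝ²_+)}`, with `Λ^s` acting on `x ↦ w(t, x, y)`. -/
def normLam (T a s : ℝ) (w : ℝ × ℝ × ℝ → ℂ) : ℝ≥0∞ :=
  (∫⁻ t in Ioo 0 T, ∫⁻ y in Ioi 0,
    (ENNReal.ofReal (bracket y ^ a) * lamNorm s (fun x => w (t, x, y))) ^ 2) ^ (1 / 2 : ℝ)

/-- `‖w‖_{L²([0,T] × ℝ²_+)}`. -/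
def normL2 (T : ℝ) (w : ℝ × ℝ × ℝ → ℂ) : ℝ≥0∞ := eLpNorm w 2 (volume.restrict (slab T))

/-! ### The linearized equation -/

/-- `f` solves `∂_t f + u ∂_x f + v ∂_y f - ∂_y² f = h` on `]0,T[ × ℝ²_+`, with
`f|_{t=0} = f|_{t=T} = 0`, `∂_y f|_{y=0} = 0` and `∂_t f = ∂_y² f + g` at `y = 0`, where
`f ∈ L²([0,T]; H²(ℝ²_+))` and `∂_y³ f, h, ∂_y h, g, ∂_y g ∈ L²`. The letters after a function name
are its (weak) derivatives; the equation holds almost everywhere and the initial and boundary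
conditions hold in the sense of traces. -/
structure IsLinearizedSolution (T : ℝ) (u v : ℝ × ℝ × ℝ → ℝ)
    (f ft fx fy fxx fxy fyy fyyy h hy g gy : ℝ × ℝ × ℝ → ℂ) : Prop where
  memLp_f : MemLp f 2 (volume.restrict (slab T))
  memLp_fx : MemLp fx 2 (volume.restrict (slab T))
  memLp_fy : MemLp fy 2 (volume.restrict (slab T))
  memLp_fxx : MemLp fxx 2 (volume.restrict (slab T))
  memLp_fxy : MemLp fxy 2 (volume.restrict (slab T))
  memLp_fyy : MemLp fyy 2 (volume.restrict (slab T))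
  memLp_fyyy : MemLp fyyy 2 (volume.restrict (slab T))
  memLp_h : MemLp h 2 (volume.restrict (slab T))
  memLp_hy : MemLp hy 2 (volume.restrict (slab T))
  memLp_g : MemLp g 2 (volume.restrict (slab T))
  memLp_gy : MemLp gy 2 (volume.restrict (slab T))
  deriv_t : HasWeakDeriv (slab T) (1, 0, 0) f ft
  deriv_x : HasWeakDeriv (slab T) (0, 1, 0) f fx
  deriv_y : HasWeakDeriv (slab T) (0, 0, 1) f fy
  deriv_xx : HasWeakDeriv (slab T) (0, 1, 0) fx fxx
  deriv_xy : HasWeakDeriv (slab T) (0, 0, 1) fx fxy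
  deriv_yy : HasWeakDeriv (slab T) (0, 0, 1) fy fyy
  deriv_yyy : HasWeakDeriv (slab T) (0, 0, 1) fyy fyyy
  deriv_h : HasWeakDeriv (slab T) (0, 0, 1) h hy
  deriv_g : HasWeakDeriv (slab T) (0, 0, 1) g gy
  equation : ∀ᵐ p ∂(volume.restrict (slab T)),
    ft p + (u p : ℂ) * fx p + (v p : ℂ) * fy p - fyy p = h p
  initial_final : HasZeroTrace (slab T) (univ ×ˢ (univ ×ˢ Ioi 0)) (1, 0, 0) f
  neumann : HasZeroTrace (slab T) (Ioo 0 T ×ˢ (univ ×ˢ univ)) (0, 0, 1) fy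
  boundary : HasZeroTrace (slab T) (Ioo 0 T ×ˢ (univ ×ˢ univ)) (0, 0, 1)
    (fun p => ft p - fyy p - g p)

end Prandtl

end

noncomputable section

namespace Prandtl

/-! ### Bounded multiplication operators and translations on `L²(ℝ³)` -/

/-! Write w = ∂_y f. Differentiating the equation in y gives w_t + u_y f_x + u w_x + v_y w + v w_y −
w_yy = h_y (`LinSol.eq_dy`), and both estimates come from testing this identity. Put a =
‖⟨y⟩^{-σ/2}Λ^{-2/3}f_x‖ (equal to ‖⟨y⟩^{-σ/2}Λ^{1/3}f‖ up to ‖f‖), b = ‖Λ^{-2/3}h_y‖, D =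
‖Λ^{-1/3}w_y‖, E = ‖Λ^{-2/3}w_yy‖, H = ‖Λ^{-1/3}h‖, N = ‖w‖ + ‖f‖, and let R be the weighted norm of
Λ^{-1/3}g_y.

Test with Λ^{-4/3}w_yy (`LinSol.norm_J_wyy_sq`). Since w has zero trace at y = 0 and at both times,
the time derivative contributes with a favourable sign and transport costs only commutators: E² ≲ (a
+ b + N + D)E + ND + D². Together with the interpolation D² ≤ NE this gives E ≲ a + b + N, which is
the second estimate.

Test with ∂_xΛ^{-4/3}f (`LinSol.inner_le`). This captures the hypoelliptic gain of [∂_y, u∂_x] =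
u_y∂_x: as u_y is bounded below by a multiple of ⟨y⟩^{-σ}, the real part of ⟨u_y f_x, ∂_xΛ^{-4/3}f⟩
controls a² up to a commutator (`LinSol.norm_wtY_sq_le_inner`). The term u w_x takes away only half
of that quantity, because u vanishes at y = 0. The boundary relation f_t = f_yy + g turns the w_t
term into boundary forms of f_yy and g; the term h_y leaves a boundary form of g, because h − g
vanishes at y = 0. The form of f_yy is at most ED + const·Na by two trace inequalities, and that of
g is at most 4RN by a Hardy inequality whose weight (1 + y)^{-2σ} is integrable exactly because σ >
1/2. Altogether a² ≲ Na + RN + ED + HN + DN + N². As ED ≤ N^{1/2}E^{3/2} and E ≲ a + b + N, Young's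
inequality yields a + D ≤ εb + C_ε(H + N + R). The Λ^{1/6} term of the statement is not needed.

Limited regularity is handled as follows. All functions are extended by zero and live in L²(ℝ³);
derivatives are right derivatives of translation families (`HasD`). Full translations encode
vanishing traces, while the truncated translation `shY` encodes a y-derivative without boundary
condition. Green's formula, the Cauchy–Schwarz inequality for traces and the two energy inequalities
are then statements about difference quotients (`HasD.ibpY`, `HasD.boundary_le`,
`re_inner_dt_dyy_nonpos`, `re_inner_dx_dyy_le`). Commutators of Λ^{-s} with coefficients that are
merely Lipschitz in x come from writing Λ^{-s} as an integral of resolvents of ∂_x² (`commutator_J`,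
`anticommutator_DJ`). The pointwise bounds for u and v come from a Sobolev inequality on the half
plane (`exists_flowBound`). -/

/-- Points `(t, x, y)`. -/
abbrev R3 := ℝ × ℝ × ℝ

/-- The Hilbert space `L²(ℝ³)`. -/
abbrev HH := Lp ℂ 2 (volume : Measure R3)

/-- Bounded measurable coefficients. -/
def IsCoef (a : R3 → ℂ) : Prop := Measurable a ∧ ∃ K : ℝ, ∀ p, ‖a p‖ ≤ K

lemma IsCoef.memLp {a : R3 → ℂ} (h : IsCoef a) : MemLp a ∞ (volume : Measure R3) := by
  obtain ⟨hm, K, hK⟩ := h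
  exact memLp_top_of_bound hm.aestronglyMeasurable K (Eventually.of_forall hK)

lemma IsCoef.mul {a b : R3 → ℂ} (ha : IsCoef a) (hb : IsCoef b) : IsCoef (fun p => a p * b p) := by
  obtain ⟨ha, K, hK⟩ := ha
  obtain ⟨hb, L, hL⟩ := hb
  refine ⟨ha.mul hb, K * L, fun p => ?_⟩
  rw [norm_mul]
  exact mul_le_mul (hK p) (hL p) (norm_nonneg _) ((norm_nonneg _).trans (hK p))

lemma IsCoef.sub {a b : R3 → ℂ} (ha : IsCoef a) (hb : IsCoef b) : IsCoef (fun p => a p - b p) := by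
  obtain ⟨ha, K, hK⟩ := ha
  obtain ⟨hb, L, hL⟩ := hb
  exact ⟨ha.sub hb, K + L, fun p => (norm_sub_le _ _).trans (add_le_add (hK p) (hL p))⟩

lemma IsCoef.conj {a : R3 → ℂ} (ha : IsCoef a) :
    IsCoef (fun p => (starRingEnd ℂ) (a p)) := by
  obtain ⟨ha, K, hK⟩ := ha
  exact ⟨Complex.continuous_conj.measurable.comp ha, K, fun p => by simpa using hK p⟩

lemma IsCoef.comp_add {a : R3 → ℂ} (ha : IsCoef a) (e : R3) : IsCoef (fun p => a (p + e)) := by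
  obtain ⟨ha, K, hK⟩ := ha
  exact ⟨ha.comp (measurable_id.add_const e), K, fun p => hK _⟩

lemma isCoef_const (c : ℂ) : IsCoef (fun _ => c) := ⟨measurable_const, ‖c‖, fun _ => le_rfl⟩

lemma IsCoef.of_real {a : R3 → ℝ} (hm : Measurable a) {K : ℝ} (h : ∀ p, |a p| ≤ K) :
    IsCoef (fun p => (a p : ℂ)) :=
  ⟨Complex.measurable_ofReal.comp hm, K, fun p => by simpa using h p⟩

/-- Multiplication by a bounded measurable function (and `0` for other functions). -/
def mulOp (a : R3 → ℂ) : HH →L[ℂ] HH := by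
  classical
  exact if h : MemLp a ∞ (volume : Measure R3) then
    (ContinuousLinearMap.mul ℂ ℂ).holderL (volume : Measure R3) ∞ 2 2 (h.toLp a) else 0

lemma mulOp_ae {a : R3 → ℂ} (ha : IsCoef a) (w : HH) :
    mulOp a w =ᵐ[volume] fun p => a p * w p := by
  have h := ha.memLp
  simp only [mulOp, h, dite_true]
  filter_upwards [(ContinuousLinearMap.mul ℂ ℂ).coeFn_holder (r := 2) (h.toLp a) w,
    h.coeFn_toLp] with p h1 h2
  rw [ContinuousLinearMap.holderL_apply_apply, h1, h2]
  rfl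

lemma mulOp_congr {a b : R3 → ℂ} (ha : IsCoef a) (hb : IsCoef b) {w : HH}
    (h : ∀ᵐ p : R3, a p * w p = b p * w p) : mulOp a w = mulOp b w := by
  apply Lp.ext
  filter_upwards [mulOp_ae ha w, mulOp_ae hb w, h] with p h1 h2 h3
  rw [h1, h2, h3]

lemma mulOp_mulOp {a b : R3 → ℂ} (ha : IsCoef a) (hb : IsCoef b) (w : HH) :
    mulOp a (mulOp b w) = mulOp (fun p => a p * b p) w := by
  apply Lp.ext
  filter_upwards [mulOp_ae ha (mulOp b w), mulOp_ae hb w, mulOp_ae (ha.mul hb) w] with p h1 h2 h3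
  rw [h1, h2, h3, mul_assoc]

lemma mulOp_comm {a b : R3 → ℂ} (ha : IsCoef a) (hb : IsCoef b) (w : HH) :
    mulOp a (mulOp b w) = mulOp b (mulOp a w) := by
  rw [mulOp_mulOp ha hb, mulOp_mulOp hb ha]
  simp_rw [mul_comm]

lemma mulOp_one (w : HH) : mulOp (fun _ => 1) w = w := by
  apply Lp.ext
  filter_upwards [mulOp_ae (isCoef_const 1) w] with p h1
  rw [h1, one_mul]

lemma mulOp_zero (w : HH) : mulOp (fun _ => 0) w = 0 := by
  apply Lp.ext
  filter_upwards [mulOp_ae (isCoef_const 0) w, Lp.coeFn_zero ℂ 2 (volume : Measure R3)] with p h1 h2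
  rw [h1, h2]; simp

lemma mulOp_sub {a b : R3 → ℂ} (ha : IsCoef a) (hb : IsCoef b) (w : HH) :
    mulOp (fun p => a p - b p) w = mulOp a w - mulOp b w := by
  apply Lp.ext
  filter_upwards [mulOp_ae ha w, mulOp_ae hb w, mulOp_ae (ha.sub hb) w,
    Lp.coeFn_sub (mulOp a w) (mulOp b w)] with p h1 h2 h3 h4
  rw [h3, h4, Pi.sub_apply, h1, h2]; ring

lemma mulOp_const_mul {a : R3 → ℂ} (ha : IsCoef a) (c : ℂ) (w : HH) :
    mulOp (fun p => c * a p) w = c • mulOp a w := by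
  apply Lp.ext
  filter_upwards [mulOp_ae ha w, mulOp_ae ((isCoef_const c).mul ha) w,
    Lp.coeFn_smul c (mulOp a w)] with p h1 h3 h4
  rw [h3, h4, Pi.smul_apply, h1, smul_eq_mul]; ring

lemma inner_HH (w q : HH) : inner ℂ w q = ∫ p, (starRingEnd ℂ) (w p) * q p := by
  rw [L2.inner_def]
  refine integral_congr_ae (Eventually.of_forall fun p => ?_)
  simp [mul_comm]

lemma inner_mulOp_left {a : R3 → ℂ} (ha : IsCoef a) (w q : HH) :
    inner ℂ (mulOp a w) q = inner ℂ w (mulOp (fun p => (starRingEnd ℂ) (a p)) q) := by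
  rw [inner_HH, inner_HH]
  apply integral_congr_ae
  filter_upwards [mulOp_ae ha w, mulOp_ae ha.conj q] with p h1 h2
  rw [h1, h2, map_mul]; ring

lemma inner_mulOp_real {a : R3 → ℝ} (ha : IsCoef (fun p => (a p : ℂ))) (w q : HH) :
    inner ℂ (mulOp (fun p => (a p : ℂ)) w) q = inner ℂ w (mulOp (fun p => (a p : ℂ)) q) := by
  rw [inner_mulOp_left ha]
  simp

lemma norm_mulOp_le_norm {a b : R3 → ℂ} (ha : IsCoef a) (hb : IsCoef b) (w : HH)
    {K : ℝ} (h : ∀ p, ‖a p‖ ≤ K * ‖b p‖) : ‖mulOp a w‖ ≤ K * ‖mulOp b w‖ := by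
  apply Lp.norm_le_mul_norm_of_ae_le_mul
  filter_upwards [mulOp_ae ha w, mulOp_ae hb w] with p h1 h2
  rw [h1, h2, norm_mul, norm_mul, ← mul_assoc]
  exact mul_le_mul_of_nonneg_right (h p) (norm_nonneg _)

lemma norm_mulOp_le {a : R3 → ℂ} (ha : IsCoef a) (w : HH)
    {K : ℝ} (h : ∀ p, ‖a p‖ ≤ K) : ‖mulOp a w‖ ≤ K * ‖w‖ := by
  have := norm_mulOp_le_norm ha (isCoef_const 1) w (K := K) (fun p => by simpa using h p)
  rwa [mulOp_one] at this

lemma integrable_norm_sq (w : HH) : Integrable (fun p => ‖w p‖ ^ 2) (volume : Measure R3) :=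
  (memLp_two_iff_integrable_sq_norm (Lp.memLp w).1).1 (Lp.memLp w)

lemma norm_sq_HH (w : HH) : ‖w‖ ^ 2 = ∫ p, ‖w p‖ ^ 2 := by
  have h := inner_HH w w
  have h2 : ∀ p, (starRingEnd ℂ) (w p) * w p = ((‖w p‖ ^ 2 : ℝ) : ℂ) := fun p => by
    rw [mul_comm, Complex.mul_conj, Complex.normSq_eq_norm_sq]
  simp_rw [h2] at h
  rw [integral_complex_ofReal, inner_self_eq_norm_sq_to_K] at h
  exact Complex.ofReal_injective (by simpa using h)

lemma mulOp_pos_re {a : R3 → ℝ} (ha : IsCoef (fun p => (a p : ℂ))) (w : HH) :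
    (inner ℂ (mulOp (fun p => (a p : ℂ)) w) w).re = ∫ p, a p * ‖w p‖ ^ 2 := by
  rw [inner_HH]
  have : (fun p => (starRingEnd ℂ) (mulOp (fun p => (a p : ℂ)) w p) * w p) =ᵐ[volume]
      fun p => ((a p * ‖w p‖ ^ 2 : ℝ) : ℂ) := by
    filter_upwards [mulOp_ae ha w] with p h1
    rw [h1, map_mul, mul_assoc, mul_comm _ (w p), Complex.mul_conj, Complex.normSq_eq_norm_sq]
    simp
  rw [integral_congr_ae this, integral_complex_ofReal, Complex.ofReal_re]

lemma integrable_coef_mul_norm_sq {a : R3 → ℝ} (ha : IsCoef (fun p => (a p : ℂ))) (w : HH) :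
    Integrable (fun p => a p * ‖w p‖ ^ 2) (volume : Measure R3) := by
  obtain ⟨hm, K, hK⟩ := ha
  have hm' : Measurable a := Complex.measurable_re.comp hm
  exact (integrable_norm_sq w).bdd_mul hm'.aestronglyMeasurable
    (c := K) (Eventually.of_forall fun p => by simpa using hK p)

/-- Uniformly bounded pointwise convergence of coefficients gives strong convergence of the
multiplication operators. -/
lemma tendsto_mulOp {a : ℝ → R3 → ℂ} {b : R3 → ℂ} {l : Filter ℝ} [l.IsCountablyGenerated]
    (ha : ∀ s, IsCoef (a s)) (hb : IsCoef b) {K : ℝ} (hK : ∀ᶠ s in l, ∀ p, ‖a s p‖ ≤ K)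
    (w : HH) (hlim : ∀ᵐ p : R3, w p ≠ 0 → Tendsto (fun s => a s p) l (𝓝 (b p))) :
    Tendsto (fun s => mulOp (a s) w) l (𝓝 (mulOp b w)) := by
  rw [tendsto_iff_norm_sub_tendsto_zero]
  obtain ⟨hbm, L, hL⟩ := id hb
  have key : ∀ s, ‖mulOp (a s) w - mulOp b w‖ = √(∫ p, ‖(a s p - b p) * w p‖ ^ 2) := by
    intro s
    rw [eq_comm, Real.sqrt_eq_iff_mul_self_eq (integral_nonneg fun p => by positivity)
      (norm_nonneg _), ← pow_two,
      ← mulOp_sub (ha s) hb, norm_sq_HH]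
    refine integral_congr_ae ?_
    filter_upwards [mulOp_ae ((ha s).sub hb) w] with p h
    rw [h]
  simp_rw [key]
  rw [← Real.sqrt_zero]
  refine (Real.continuous_sqrt.tendsto 0).comp ?_
  have h0 : (∫ _ : R3, (0 : ℝ)) = 0 := by simp
  rw [← h0]
  refine tendsto_integral_filter_of_dominated_convergence (fun p => (K + L) ^ 2 * ‖w p‖ ^ 2)
    (Eventually.of_forall fun s => ?_) ?_ ((integrable_norm_sq w).const_mul _) ?_
  · exact ((((ha s).1.sub hbm).aestronglyMeasurable.mul (Lp.memLp w).1).norm.pow 2)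
  · filter_upwards [hK] with s hs
    refine Eventually.of_forall fun p => ?_
    rw [Real.norm_of_nonneg (by positivity), norm_mul, mul_pow]
    gcongr
    exact (norm_sub_le _ _).trans (add_le_add (hs p) (hL p))
  · filter_upwards [hlim] with p hp
    by_cases h : w p = 0
    · simpa [h] using tendsto_const_nhds
    · have := (((hp h).sub_const (b p)).mul_const (w p)).norm.pow 2
      simpa using this

lemma tendsto_mulOp_of_tendsto {a : ℝ → R3 → ℂ} {b : R3 → ℂ} {l : Filter ℝ}
    [l.IsCountablyGenerated] (ha : ∀ s, IsCoef (a s)) (hb : IsCoef b) {K : ℝ}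
    (hK : ∀ᶠ s in l, ∀ p, ‖a s p‖ ≤ K) {v : ℝ → HH} {w : HH} (hv : Tendsto v l (𝓝 w))
    (hlim : ∀ᵐ p : R3, w p ≠ 0 → Tendsto (fun s => a s p) l (𝓝 (b p))) :
    Tendsto (fun s => mulOp (a s) (v s)) l (𝓝 (mulOp b w)) := by
  have h1 := tendsto_mulOp ha hb hK w hlim
  have h2 : Tendsto (fun s => mulOp (a s) (v s - w)) l (𝓝 0) := by
    refine squeeze_zero_norm' (a := fun s => K * ‖v s - w‖) ?_ ?_
    · filter_upwards [hK] with s hs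
      exact norm_mulOp_le (ha s) _ hs
    · simpa using (tendsto_iff_norm_sub_tendsto_zero.1 hv).const_mul K
  simpa using h1.add h2

/-! ### Translations on L²(ℝ³). -/

instance : (volume : Measure (ℝ × ℝ)).IsAddHaarMeasure :=
  inferInstanceAs ((volume : Measure ℝ).prod volume).IsAddHaarMeasure

instance : (volume : Measure R3).IsAddHaarMeasure :=
  inferInstanceAs ((volume : Measure ℝ).prod (volume : Measure (ℝ × ℝ))).IsAddHaarMeasure

/-- The translation `w ↦ w(· + e)`. -/
def tr (e : R3) : HH →L[ℂ] HH :=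
  (Lp.compMeasurePreservingₗᵢ ℂ (fun p : R3 => p + e)
    (measurePreserving_add_right volume e)).toContinuousLinearMap

lemma tr_ae (e : R3) (w : HH) : tr e w =ᵐ[volume] fun p => w (p + e) :=
  Lp.coeFn_compMeasurePreserving w (measurePreserving_add_right volume e)

lemma ae_add {Q : R3 → Prop} (e : R3) (h : ∀ᵐ p : R3, Q p) : ∀ᵐ p : R3, Q (p + e) :=
  (measurePreserving_add_right volume e).quasiMeasurePreserving.ae h

lemma norm_tr (e : R3) (w : HH) : ‖tr e w‖ = ‖w‖ :=
  (Lp.compMeasurePreservingₗᵢ ℂ (fun p : R3 => p + e)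
    (measurePreserving_add_right volume e)).norm_map w

lemma inner_tr_tr (e : R3) (w q : HH) : inner ℂ (tr e w) (tr e q) = inner ℂ w q :=
  (Lp.compMeasurePreservingₗᵢ ℂ (fun p : R3 => p + e)
    (measurePreserving_add_right volume e)).inner_map_map w q

lemma tr_tr (e e' : R3) (w : HH) : tr e (tr e' w) = tr (e + e') w := by
  apply Lp.ext
  filter_upwards [tr_ae e (tr e' w), ae_add e (tr_ae e' w), tr_ae (e + e') w] with p h1 h2 h3
  rw [h1, h2, h3, add_assoc]

lemma tr_comm (e e' : R3) (w : HH) : tr e (tr e' w) = tr e' (tr e w) := by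
  rw [tr_tr, tr_tr, add_comm]

lemma tr_zero (w : HH) : tr 0 w = w := by
  apply Lp.ext
  filter_upwards [tr_ae 0 w] with p h1
  rw [h1, add_zero]

lemma tr_mulOp {a : R3 → ℂ} (ha : IsCoef a) (e : R3) (w : HH) :
    tr e (mulOp a w) = mulOp (fun p => a (p + e)) (tr e w) := by
  apply Lp.ext
  filter_upwards [tr_ae e (mulOp a w), ae_add e (mulOp_ae ha w), tr_ae e w,
    mulOp_ae (ha.comp_add e) (tr e w)] with p h1 h2 h3 h4
  rw [h1, h2, h4, h3]

lemma continuous_tr (w : HH) : Continuous fun e => tr e w := by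
  have := Continuous.compMeasurePreservingLp (p := 2) (E := ℂ) (μ := (volume : Measure R3))
    (ν := (volume : Measure R3)) (Z := R3) (f := fun _ => w)
    (g := fun e => ⟨fun p => p + e, by fun_prop⟩) continuous_const
    (ContinuousMap.continuous_of_continuous_uncurry _ (by
      change Continuous fun q : R3 × R3 => q.2 + q.1
      fun_prop))
    (fun e => measurePreserving_add_right volume e) (by simp)
  exact this

/-! ### One-sided derivatives of one-parameter families and integration by parts -/

/-- `w'` is the right derivative at `0` of `s ↦ U s w`. -/
def HasD (U : ℝ → HH → HH) (w w' : HH) : Prop :=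
  Tendsto (fun s : ℝ => ((s⁻¹ : ℝ) : ℂ) • (U s w - w)) (𝓝[>] 0) (𝓝 w')

/-- The indicator of `{y > 0}`. -/
def up (p : R3) : ℂ := if 0 < p.2.2 then 1 else 0

lemma isCoef_up : IsCoef up := by
  refine ⟨Measurable.ite (measurableSet_lt measurable_const (by fun_prop)) measurable_const
    measurable_const, 1, fun p => ?_⟩
  unfold up; split_ifs <;> simp

/-- The translation in the direction `t`. -/
def trT (s : ℝ) (w : HH) : HH := tr (s, 0, 0) w
/-- The translation in the direction `x`. -/
def trX (s : ℝ) (w : HH) : HH := tr (0, s, 0) w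
/-- The translation in the direction `y`. -/
def trY (s : ℝ) (w : HH) : HH := tr (0, 0, s) w
/-- The truncated translation in the direction `y`, on functions supported in `y > 0`. -/
def shY (s : ℝ) (w : HH) : HH := mulOp up (tr (0, 0, s) w)

/-- `w` vanishes for `y ≤ 0`. -/
def IsUp (w : HH) : Prop := mulOp up w = w

lemma IsUp.mulOp {w : HH} (h : IsUp w) {a : R3 → ℂ} (ha : IsCoef a) : IsUp (mulOp a w) := by
  unfold IsUp at *
  rw [mulOp_comm isCoef_up ha, h]

lemma IsUp.add {w q : HH} (h : IsUp w) (h' : IsUp q) : IsUp (w + q) := by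
  unfold IsUp at *; rw [map_add, h, h']

lemma IsUp.sub {w q : HH} (h : IsUp w) (h' : IsUp q) : IsUp (w - q) := by
  unfold IsUp at *; rw [map_sub, h, h']

lemma HasD.unique {U : ℝ → HH → HH} {w w' w'' : HH} (h : HasD U w w') (h' : HasD U w w'') :
    w' = w'' := tendsto_nhds_unique h h'

lemma HasD.add {U : ℝ → HH → HH} {w w' q q' : HH} (h : HasD U w w') (h' : HasD U q q')
    (hU : ∀ s w q, U s (w + q) = U s w + U s q) : HasD U (w + q) (w' + q') := by
  have := Filter.Tendsto.add h h'
  refine this.congr fun s => ?_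
  rw [← smul_add, hU]; congr 1; abel

lemma HasD.sub {U : ℝ → HH → HH} {w w' q q' : HH} (h : HasD U w w') (h' : HasD U q q')
    (hU : ∀ s w q, U s (w - q) = U s w - U s q) : HasD U (w - q) (w' - q') := by
  have := Filter.Tendsto.sub h h'
  refine this.congr fun s => ?_
  rw [← smul_sub, hU]; congr 1; abel

lemma HasD.map {U V : ℝ → HH → HH} {w w' : HH} (A : HH →L[ℂ] HH) (h : HasD U w w')
    (hA : ∀ s, A (U s w) = V s (A w)) : HasD V (A w) (A w') := by
  have := (A.continuous.tendsto w').comp h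
  refine this.congr fun s => ?_
  simp only [Function.comp_apply, map_smul, map_sub, hA]

lemma tendsto_ofReal_zero : Tendsto (fun s : ℝ => (s : ℂ)) (𝓝[>] 0) (𝓝 0) := by
  have := (Complex.continuous_ofReal.tendsto 0).mono_left (nhdsWithin_le_nhds (s := Ioi (0 : ℝ)))
  simpa using this

lemma HasD.tendsto {U : ℝ → HH → HH} {w w' : HH} (h : HasD U w w') :
    Tendsto (fun s => U s w) (𝓝[>] 0) (𝓝 w) := by
  have h1 := (tendsto_ofReal_zero.smul h).add_const w
  rw [zero_smul, zero_add] at h1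
  refine h1.congr' ?_
  filter_upwards [self_mem_nhdsWithin] with s hs
  have : (s : ℂ) ≠ 0 := by exact_mod_cast (ne_of_gt hs)
  rw [smul_smul, Complex.ofReal_inv, mul_inv_cancel₀ this, one_smul, sub_add_cancel]

/-- Product rule for the pairing. For an isometric family the left side is zero, which is
integration by parts without boundary term; for `shY` the limit is the boundary form, minus the
pairing of the traces at y = 0. -/
lemma HasD.tendsto_inner {U V : ℝ → HH → HH} {w w' q q' : HH} (h : HasD U w w') (h' : HasD V q q') :
    Tendsto (fun s : ℝ => ((s⁻¹ : ℝ) : ℂ) * (inner ℂ (U s w) (V s q) - inner ℂ w q)) (𝓝[>] 0)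
      (𝓝 (inner ℂ w' q + inner ℂ w q')) := by
  have h1 := (Filter.Tendsto.inner (𝕜 := ℂ) h h'.tendsto).add
    (Filter.Tendsto.inner (𝕜 := ℂ) (tendsto_const_nhds (x := w)) h')
  refine h1.congr fun s => ?_
  rw [inner_smul_left, inner_smul_right, Complex.conj_ofReal, inner_sub_left, inner_sub_right]
  ring

lemma ibp_of_isometry {U : ℝ → HH → HH} {w w' q q' : HH} (h : HasD U w w') (h' : HasD U q q')
    (hU : ∀ s w q, inner ℂ (U s w) (U s q) = inner ℂ w q) :
    inner ℂ w' q + inner ℂ w q' = 0 := by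
  refine tendsto_nhds_unique (h.tendsto_inner h') ?_
  simp only [hU, sub_self, mul_zero]
  exact tendsto_const_nhds

lemma HasD.ibpT {w w' q q' : HH} (h : HasD trT w w') (h' : HasD trT q q') :
    inner ℂ w' q + inner ℂ w q' = 0 :=
  ibp_of_isometry h h' fun _ _ _ => inner_tr_tr _ _ _

/-- Translating the forward difference quotient back by s turns it into the backward one. The energy
inequalities need the backward quotients. -/
lemma HasD.neg_dir {e : R3} {w w' : HH} (h : HasD (fun s => tr (s • e)) w w') :
    HasD (fun s => tr ((-s) • e)) w (-w') := by
  have h1 : Tendsto (fun s : ℝ => tr ((-s) • e) w') (𝓝[>] 0) (𝓝 w') := by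
    have hc : Continuous fun s : ℝ => tr ((-s) • e) w' := (continuous_tr w').comp (by fun_prop)
    have := (hc.tendsto 0).mono_left (nhdsWithin_le_nhds (s := Ioi (0 : ℝ)))
    simpa [tr_zero] using this
  have h2 : Tendsto (fun s : ℝ => tr ((-s) • e) (((s⁻¹ : ℝ) : ℂ) • (tr (s • e) w - w))) (𝓝[>] 0)
      (𝓝 w') := by
    rw [tendsto_iff_norm_sub_tendsto_zero] at h1 ⊢
    have h3 := tendsto_iff_norm_sub_tendsto_zero.1 h
    refine squeeze_zero (fun _ => norm_nonneg _) (fun s => ?_)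
      (by simpa only [add_zero] using h3.add h1)
    calc _ = ‖tr ((-s) • e) (((s⁻¹ : ℝ) : ℂ) • (tr (s • e) w - w) - w')
            + (tr ((-s) • e) w' - w')‖ := by rw [map_sub]; congr 1; abel
      _ ≤ _ := by
        refine (norm_add_le _ _).trans ?_
        rw [norm_tr]
  refine h2.neg.congr fun s => ?_
  have h3 : tr ((-s) • e) (tr (s • e) w) = w := by
    rw [tr_tr, ← add_smul, neg_add_cancel, zero_smul, tr_zero]
  rw [map_smul, map_sub, h3, ← smul_neg, neg_sub]

lemma HasD.neg_dirT {w w' : HH} (h : HasD trT w w') : HasD (fun s => trT (-s)) w (-w') := by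
  have : HasD (fun s => tr (s • ((1, 0, 0) : R3))) w w' := by simpa [HasD, trT] using h
  simpa [HasD, trT] using this.neg_dir

lemma HasD.neg_dirX {w w' : HH} (h : HasD trX w w') : HasD (fun s => trX (-s)) w (-w') := by
  have : HasD (fun s => tr (s • ((0, 1, 0) : R3))) w w' := by simpa [HasD, trX] using h
  simpa [HasD, trX] using this.neg_dir

lemma inner_up_left {w q : HH} (hq : IsUp q) : inner ℂ (mulOp up w) q = inner ℂ w q := by
  have : (fun p => (starRingEnd ℂ) (up p)) = up := by
    funext p; unfold up; split_ifs <;> simp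
  rw [inner_mulOp_left isCoef_up, this, hq]

lemma inner_up_right {w q : HH} (hw : IsUp w) : inner ℂ w (mulOp up q) = inner ℂ w q := by
  rw [← inner_conj_symm, inner_up_left hw, inner_conj_symm]

lemma up_mul_up (p : R3) : up p * up p = up p := by unfold up; split_ifs <;> simp

lemma isUp_up (w : HH) : IsUp (mulOp up w) := by
  unfold IsUp
  rw [mulOp_mulOp isCoef_up isCoef_up]
  simp_rw [up_mul_up]

lemma HasD.isUp {w w' : HH} (h : HasD shY w w') (hw : IsUp w) : IsUp w' := by
  refine h.map (V := shY) (mulOp up) (fun s => ?_) |>.unique (w'' := w') ?_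
  · rw [hw]; exact isUp_up _
  · rw [hw]; exact h

lemma HasD.toShY {w w' : HH} (h : HasD trY w w') (hw : IsUp w) (hw' : IsUp w') :
    HasD shY w w' := by
  have := h.map (V := shY) (mulOp up) (fun s => by rw [hw]; rfl)
  rwa [hw, hw'] at this

/-- The full translation is isometric and splits orthogonally into its parts in y > 0 and y ≤ 0; the
defect of the truncated one is therefore the pairing of what has been pushed below y = 0. -/
lemma inner_shY (s : ℝ) (w q : HH) :
    inner ℂ (shY s w) (shY s q) - inner ℂ w q
      = - inner ℂ (trY s w - shY s w) (trY s q - shY s q) := by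
  have h1 : inner ℂ (shY s w) (trY s q) = inner ℂ (shY s w) (shY s q) :=
    (inner_up_right (isUp_up _)).symm
  have h2 : inner ℂ (trY s w) (shY s q) = inner ℂ (shY s w) (shY s q) :=
    (inner_up_left (isUp_up _)).symm
  have h3 : inner ℂ (trY s w) (trY s q) = inner ℂ w q := inner_tr_tr _ _ _
  rw [inner_sub_left, inner_sub_right, inner_sub_right, h1, h2, h3]
  ring

/-- Green's formula in `y`: no boundary term if one of the traces vanishes. -/
lemma HasD.ibpY {r r' q q' : HH} (h : HasD trY r r') (h' : HasD shY q q') (hr : IsUp r)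
    (hr' : IsUp r') : inner ℂ r' q + inner ℂ r q' = 0 := by
  have h0 := h.toShY hr hr'
  refine tendsto_nhds_unique (h0.tendsto_inner h') ?_
  simp_rw [inner_shY]
  have h1 : Tendsto (fun s : ℝ => ((s⁻¹ : ℝ) : ℂ) • (trY s r - shY s r)) (𝓝[>] 0) (𝓝 0) := by
    have := Filter.Tendsto.sub h h0
    rw [sub_self] at this
    refine this.congr fun s => ?_
    rw [← smul_sub]; congr 1; abel
  -- The part of r pushed across y = 0 is o(s), which absorbs the factor s⁻¹; for q a mere bound
  -- suffices.
  have h2 : ∀ s : ℝ, ‖((s⁻¹ : ℝ) : ℂ) * -inner ℂ (trY s r - shY s r) (trY s q - shY s q)‖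
      ≤ ‖((s⁻¹ : ℝ) : ℂ) • (trY s r - shY s r)‖ * (‖q‖ + ‖q‖ * 1) := by
    intro s
    rw [norm_mul, norm_neg, norm_smul, mul_assoc]
    refine mul_le_mul_of_nonneg_left ((norm_inner_le_norm _ _).trans ?_) (norm_nonneg _)
    refine mul_le_mul_of_nonneg_left ((norm_sub_le _ _).trans ?_) (norm_nonneg _)
    refine add_le_add (norm_tr _ _).le ?_
    have := norm_mulOp_le isCoef_up (tr (0, 0, s) q) (K := 1)
      (fun p => by unfold up; split_ifs <;> simp)
    rw [norm_tr] at this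
    simpa [shY] using this
  refine squeeze_zero_norm h2 ?_
  simpa using (tendsto_norm_zero.comp h1).mul_const (‖q‖ + ‖q‖ * 1)

/-- The Cauchy–Schwarz inequality for the boundary form. -/
lemma HasD.boundary_le {p p' q q' : HH} (h : HasD shY p p') (h' : HasD shY q q') :
    ‖(inner ℂ p' q + inner ℂ p q' : ℂ)‖ ≤
      √(-2 * (inner ℂ p' p : ℂ).re) * √(-2 * (inner ℂ q' q : ℂ).re) := by
  -- On the diagonal the boundary form is a limit of −s⁻¹‖·‖², so Cauchy–Schwarz can be applied
  -- before the limit and no trace operator is needed.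
  have hself : ∀ {p p' : HH}, HasD shY p p' →
      Tendsto (fun s : ℝ => √(s⁻¹ * ‖trY s p - shY s p‖ ^ 2)) (𝓝[>] 0)
        (𝓝 √(-2 * (inner ℂ p' p : ℂ).re)) := by
    intro p p' h
    refine (Real.continuous_sqrt.tendsto _).comp ?_
    have h1 := ((Complex.continuous_re.tendsto _).comp (h.tendsto_inner h)).neg
    have e : -(inner ℂ p' p + inner ℂ p p' : ℂ).re = -2 * (inner ℂ p' p : ℂ).re := by
      rw [Complex.add_re, ← inner_conj_symm p p', Complex.conj_re]; ring
    rw [e] at h1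
    refine h1.congr fun s => ?_
    rw [Function.comp_apply, inner_shY, Complex.re_ofReal_mul, Complex.neg_re,
      inner_self_eq_norm_sq_to_K]
    have : ((RCLike.ofReal ‖trY s p - shY s p‖ : ℂ) ^ 2).re = ‖trY s p - shY s p‖ ^ 2 := by
      rw [← RCLike.ofReal_pow]; exact Complex.ofReal_re _
    rw [this]; ring
  refine le_of_tendsto_of_tendsto (h.tendsto_inner h').norm ((hself h).mul (hself h')) ?_
  filter_upwards [self_mem_nhdsWithin] with s hs
  have hs : (0 : ℝ) < s := hs
  have hs' : 0 ≤ s⁻¹ := by positivity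
  rw [inner_shY, norm_mul, norm_neg, Real.sqrt_mul hs', Real.sqrt_mul hs',
    Real.sqrt_sq (norm_nonneg _), Real.sqrt_sq (norm_nonneg _)]
  have : ‖((s⁻¹ : ℝ) : ℂ)‖ = √s⁻¹ * √s⁻¹ := by
    rw [Real.mul_self_sqrt hs', Complex.norm_real, Real.norm_of_nonneg hs']
  rw [this]
  have h3 := norm_inner_le_norm (𝕜 := ℂ) (trY s p - shY s p) (trY s q - shY s q)
  have h4 : 0 ≤ √s⁻¹ * √s⁻¹ := by positivity
  nlinarith [mul_le_mul_of_nonneg_left h3 h4]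

/-! ### Multiplication by functions that are Lipschitz in `y` or in `x` -/

/-- `a` is bounded, Lipschitz in `y` on `{y > 0}`, with right derivative `a'` in `y`. -/
structure YDiff (a a' : R3 → ℂ) : Prop where
  coef : IsCoef a
  coef' : IsCoef a'
  lip : ∃ K : ℝ, ∀ p : R3, 0 < p.2.2 → ∀ s > 0, ‖a (p + (0, 0, s)) - a p‖ ≤ K * s
  lim : ∀ p : R3, 0 < p.2.2 →
    Tendsto (fun s : ℝ => ((s⁻¹ : ℝ) : ℂ) * (a (p + (0, 0, s)) - a p)) (𝓝[>] 0) (𝓝 (a' p))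

/-- Leibniz rule: the difference quotient of a acts on the translate of w, that of w is multiplied
by a. The former quotients are bounded and converge pointwise, hence strongly as operators. -/
lemma YDiff.mul_shY {a a' : R3 → ℂ} (ha : YDiff a a') {w w' : HH} (h : HasD shY w w')
    (hw : IsUp w) : HasD shY (mulOp a w) (mulOp a' w + mulOp a w') := by
  obtain ⟨K, hK⟩ := ha.lip
  set b : ℝ → R3 → ℂ := fun s p => up p * (((s⁻¹ : ℝ) : ℂ) * (a (p + (0, 0, s)) - a p)) with hb
  have hbc : ∀ s, IsCoef (b s) := fun s =>
    isCoef_up.mul ((isCoef_const _).mul ((ha.coef.comp_add _).sub ha.coef))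
  have hT : Tendsto (fun s => trY s w) (𝓝[>] 0) (𝓝 w) := by
    have hc : Continuous fun s : ℝ => tr (0, 0, s) w := (continuous_tr w).comp (by fun_prop)
    have := (hc.tendsto 0).mono_left (nhdsWithin_le_nhds (s := Ioi (0 : ℝ)))
    rwa [show ((0, 0, 0) : R3) = 0 from rfl, tr_zero] at this
  have hnz : ∀ᵐ p : R3, w p ≠ 0 → 0 < p.2.2 := by
    have : mulOp up w =ᵐ[volume] w := by rw [hw]
    filter_upwards [mulOp_ae isCoef_up w, this] with p h1 h2 h3
    by_contra h4
    rw [h2] at h1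
    simp [up, h4] at h1
    exact h3 h1
  have h1 := tendsto_mulOp_of_tendsto (l := 𝓝[>] 0) (K := K) hbc ha.coef' (by
    filter_upwards [self_mem_nhdsWithin] with s hs
    have hs : (0 : ℝ) < s := hs
    intro p
    by_cases hp : 0 < p.2.2
    · have := hK p hp s hs
      simp only [hb, up, hp, if_true, one_mul, norm_mul, Complex.norm_real, norm_inv,
        Real.norm_of_nonneg hs.le]
      rw [inv_mul_le_iff₀ hs]; linarith
    · simp only [hb, up, hp, if_false, zero_mul, norm_zero]
      have := (norm_nonneg _).trans (hK (0, 0, 1) (by norm_num) 1 one_pos)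
      linarith) hT (by
    filter_upwards [hnz] with p hp hw
    refine (ha.lim p (hp hw)).congr fun s => ?_
    simp [hb, up, hp hw])
  have h2 := ((mulOp a).continuous.tendsto w').comp h
  refine (h1.add h2).congr fun s => ?_
  simp only [Function.comp_apply, shY, trY]
  rw [tr_mulOp ha.coef, mulOp_mulOp isCoef_up (ha.coef.comp_add _), map_smul, map_sub,
    mulOp_mulOp ha.coef isCoef_up]
  have e : b s = fun p => ((s⁻¹ : ℝ) : ℂ) * (up p * a (p + (0, 0, s)) - a p * up p) := by
    funext p; simp only [hb]; ring
  rw [e, mulOp_const_mul ((isCoef_up.mul (ha.coef.comp_add _)).sub (ha.coef.mul isCoef_up)),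
    mulOp_sub (isCoef_up.mul (ha.coef.comp_add _)) (ha.coef.mul isCoef_up), ← smul_add]
  congr 1; abel

/-- The coefficient `1_{y ≤ 0}`. -/
lemma isCoef_down : IsCoef (fun p => 1 - up p) := (isCoef_const 1).sub isCoef_up

lemma trY_sub_shY (s : ℝ) (w : HH) : trY s w - shY s w = mulOp (fun p => 1 - up p) (trY s w) := by
  rw [mulOp_sub (isCoef_const 1) isCoef_up, mulOp_one]; rfl

/-- Vanishing of the trace means that the mass pushed below y = 0 by a translation of length s is
o(s). -/
lemma HasD.toTrY {w w' : HH} (h : HasD shY w w')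
    (h0 : Tendsto (fun s : ℝ => ((s⁻¹ : ℝ) : ℂ) • mulOp (fun p => 1 - up p) (trY s w)) (𝓝[>] 0)
      (𝓝 0)) : HasD trY w w' := by
  have := Filter.Tendsto.add h h0
  rw [add_zero] at this
  refine this.congr fun s => ?_
  rw [← smul_add, ← trY_sub_shY]; congr 1; abel

lemma down_eq_zero {w : HH} (hw : IsUp w) : mulOp (fun p => 1 - up p) w = 0 := by
  rw [mulOp_sub (isCoef_const 1) isCoef_up, mulOp_one, hw, sub_self]

lemma YDiff.mul_trY {a a' : R3 → ℂ} (ha : YDiff a a') {w w' : HH} (h : HasD trY w w')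
    (hw : IsUp w) (hw' : IsUp w') : HasD trY (mulOp a w) (mulOp a' w + mulOp a w') := by
  refine (ha.mul_shY (h.toShY hw hw') hw).toTrY ?_
  have h1 := ((mulOp (fun p => 1 - up p)).continuous.tendsto w').comp h
  rw [down_eq_zero hw'] at h1
  obtain ⟨-, K, hK⟩ := id ha.coef
  refine squeeze_zero_norm (a := fun s => K * ‖mulOp (fun p => 1 - up p)
    (((s⁻¹ : ℝ) : ℂ) • (trY s w - w))‖) (fun s => ?_) (by simpa using h1.norm.const_mul K)
  rw [map_smul, map_sub, down_eq_zero hw, sub_zero, norm_smul, norm_smul, mul_left_comm]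
  refine mul_le_mul_of_nonneg_left ?_ (norm_nonneg _)
  rw [trY, tr_mulOp ha.coef, mulOp_mulOp isCoef_down (ha.coef.comp_add _)]
  refine norm_mulOp_le_norm (isCoef_down.mul (ha.coef.comp_add _)) isCoef_down _ fun p => ?_
  rw [norm_mul, mul_comm]
  exact mul_le_mul_of_nonneg_right (hK _) (norm_nonneg _)

/-- A coefficient that is O(y) kills the trace: on −s < y ≤ 0 its translate is at most Ks, while the
mass of the translate of w there tends to zero. -/
lemma YDiff.mul_trY_of_le {a a' : R3 → ℂ} (ha : YDiff a a') {K : ℝ}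
    (hK : ∀ p : R3, 0 < p.2.2 → ‖a p‖ ≤ K * p.2.2) {w w' : HH} (h : HasD shY w w')
    (hw : IsUp w) : HasD trY (mulOp a w) (mulOp a' w + mulOp a w') := by
  refine (ha.mul_shY h hw).toTrY ?_
  have h1 : Tendsto (fun s => mulOp (fun p => 1 - up p) (trY s w)) (𝓝[>] 0) (𝓝 0) := by
    have hc : Continuous fun s : ℝ => tr (0, 0, s) w := (continuous_tr w).comp (by fun_prop)
    have := ((mulOp (fun p => 1 - up p)).continuous.tendsto w).comp
      (((hc.tendsto 0).mono_left (nhdsWithin_le_nhds (s := Ioi (0 : ℝ)))).trans (by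
        rw [show ((0, 0, 0) : R3) = 0 from rfl, tr_zero]))
    rw [down_eq_zero hw] at this
    exact this
  have hK0 : 0 ≤ K := by
    have := (norm_nonneg _).trans (hK (0, 0, 1) (by norm_num)); simpa using this
  refine squeeze_zero_norm' (a := fun s => K * ‖mulOp (fun p => 1 - up p) (trY s w)‖) ?_
    (by simpa using h1.norm.const_mul K)
  filter_upwards [self_mem_nhdsWithin] with s hs
  have hs : (0 : ℝ) < s := hs
  have e : trY s (mulOp a w) = mulOp (fun p => a (p + (0, 0, s)) * up (p + (0, 0, s))) (trY s w) := by
    conv_lhs => rw [← hw, mulOp_mulOp ha.coef isCoef_up, trY,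
      tr_mulOp (ha.coef.mul isCoef_up)]
    rfl
  rw [e, norm_smul, mulOp_mulOp isCoef_down ((ha.coef.comp_add _).mul (isCoef_up.comp_add _)),
    Complex.norm_real, norm_inv, Real.norm_of_nonneg hs.le, inv_mul_le_iff₀ hs]
  rw [← mul_assoc]
  refine norm_mulOp_le_norm (isCoef_down.mul ((ha.coef.comp_add _).mul (isCoef_up.comp_add _)))
    isCoef_down _ fun p => ?_
  by_cases hp : 0 < p.2.2
  · simp [up, hp]
  · by_cases hp' : 0 < p.2.2 + s
    · have := hK (p + (0, 0, s)) (by simpa using hp')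
      simp [up, hp, hp'] at this ⊢
      nlinarith [not_lt.1 hp]
    · simp [up, hp, hp']
      positivity

/-- Integration by parts in `x` with a Lipschitz coefficient. -/
lemma HasD.lipX {a L : R3 → ℝ} (ha : IsCoef (fun p => (a p : ℂ))) (hL : IsCoef (fun p => (L p : ℂ)))
    (h : ∀ s > 0, ∀ p : R3, |a (p - (0, s, 0)) - a p| ≤ s * L p) {p p' q q' : HH}
    (hp : HasD trX p p') (hq : HasD trX q q') :
    ‖(inner ℂ p' (mulOp (fun z => (a z : ℂ)) q) + inner ℂ p (mulOp (fun z => (a z : ℂ)) q') : ℂ)‖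
      ≤ ‖p‖ * ‖mulOp (fun z => (L z : ℂ)) q‖ := by
  have h1 := hp.tendsto_inner (V := fun s w => tr (0, s, 0) w) hq
  set A := mulOp (fun z => (a z : ℂ)) with hA
  have h2 : Tendsto (fun s : ℝ => inner ℂ (((s⁻¹ : ℝ) : ℂ) • (trX s p - p)) (A (trX s q))
      + inner ℂ p (A (((s⁻¹ : ℝ) : ℂ) • (trX s q - q)))) (𝓝[>] 0)
      (𝓝 (inner ℂ p' (A q) + inner ℂ p (A q'))) :=
    (Filter.Tendsto.inner (𝕜 := ℂ) hp ((A.continuous.tendsto q).comp hq.tendsto)).add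
      (Filter.Tendsto.inner (𝕜 := ℂ) tendsto_const_nhds ((A.continuous.tendsto q').comp hq))
  refine le_of_tendsto h2.norm ?_
  filter_upwards [self_mem_nhdsWithin] with s hs
  have hs : (0 : ℝ) < s := hs
  have hac : IsCoef (fun z => ((a (z - (0, s, 0)) : ℝ) : ℂ)) := by
    simpa [sub_eq_add_neg] using ha.comp_add (-(0, s, 0))
  -- Shifting both arguments back moves the translation onto the coefficient, so that only an
  -- increment of a is left and a need not be differentiable.
  have e1 : A (trX s q) = trX s (mulOp (fun z => ((a (z - (0, s, 0)) : ℝ) : ℂ)) q) := by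
    rw [trX, trX, tr_mulOp hac]
    simp [hA]
  have e2 : inner ℂ (((s⁻¹ : ℝ) : ℂ) • (trX s p - p)) (A (trX s q))
      + inner ℂ p (A (((s⁻¹ : ℝ) : ℂ) • (trX s q - q)))
      = ((s⁻¹ : ℝ) : ℂ) * inner ℂ p (mulOp (fun z => ((a (z - (0, s, 0)) : ℝ) : ℂ) - a z) q) := by
    have e3 : inner ℂ (trX s p) (A (trX s q)) =
        inner ℂ p (mulOp (fun z => ((a (z - (0, s, 0)) : ℝ) : ℂ)) q) := by
      rw [e1]; exact inner_tr_tr _ _ _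
    rw [inner_smul_left, inner_sub_left, e3, map_smul, map_sub, inner_smul_right, inner_sub_right,
      mulOp_sub hac ha, inner_sub_right, Complex.conj_ofReal]
    ring
  rw [e2, norm_mul, Complex.norm_real, norm_inv, Real.norm_of_nonneg hs.le, inv_mul_le_iff₀ hs]
  refine (norm_inner_le_norm _ _).trans ?_
  rw [mul_left_comm]
  refine mul_le_mul_of_nonneg_left ?_ (norm_nonneg _)
  refine norm_mulOp_le_norm (hac.sub ha) hL _ fun z => ?_
  rw [← Complex.ofReal_sub, Complex.norm_real, Complex.norm_real]
  exact (h s hs z).trans (mul_le_mul_of_nonneg_left (le_abs_self _) hs.le)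

/-- Discrete form of Re⟨a p_x, p⟩ = −½⟨a_x p, p⟩ for functions p that have no x-derivative.
Positivity of a is used to discard the square ⟨a(p − T_{-s}p), p − T_{-s}p⟩. -/
lemma re_inner_sub_trX {a : R3 → ℝ} (ha : IsCoef (fun p => (a p : ℂ))) (ha0 : ∀ p, 0 ≤ a p)
    {K s : ℝ} (h : ∀ p : R3, |a (p + (0, s, 0)) - a p| ≤ K * s) (p : HH) :
    -(K * s / 2 * ‖p‖ ^ 2) ≤ (inner ℂ (mulOp (fun z => (a z : ℂ)) (p - trX (-s) p)) p).re := by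
  set A := mulOp (fun z => (a z : ℂ)) with hA
  have h0 : 0 ≤ (inner ℂ (A (p - trX (-s) p)) (p - trX (-s) p)).re := by
    rw [mulOp_pos_re ha]
    exact integral_nonneg fun z => mul_nonneg (ha0 z) (by positivity)
  have hac : IsCoef (fun z => ((a (z + (0, s, 0)) : ℝ) : ℂ)) := ha.comp_add _
  have e1 : A (trX (-s) p) = trX (-s) (mulOp (fun z => ((a (z + (0, s, 0)) : ℝ) : ℂ)) p) := by
    rw [trX, trX, tr_mulOp hac, hA]
    simp only [add_assoc, Prod.mk_add_mk, add_zero, neg_add_cancel]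
    rw [show ((0, 0, 0) : R3) = 0 from rfl]
    simp only [add_zero]
  have e2 : (inner ℂ (A (trX (-s) p)) (trX (-s) p)).re ≤ (inner ℂ (A p) p).re + K * s * ‖p‖ ^ 2 := by
    rw [e1, trX, trX, inner_tr_tr, mulOp_pos_re hac, mulOp_pos_re ha, norm_sq_HH,
      ← integral_const_mul, ← integral_add (integrable_coef_mul_norm_sq ha p)
        ((integrable_norm_sq p).const_mul _)]
    refine integral_mono (integrable_coef_mul_norm_sq hac p)
      ((integrable_coef_mul_norm_sq ha p).add ((integrable_norm_sq p).const_mul _)) fun z => ?_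
    have := (le_abs_self _).trans (h z)
    nlinarith [sq_nonneg ‖p z‖]
  have e3 : (inner ℂ (A p) (trX (-s) p)).re = (inner ℂ (A (trX (-s) p)) p).re := by
    rw [hA, inner_mulOp_real ha, ← inner_conj_symm, Complex.conj_re]
  simp only [map_sub, inner_sub_left, inner_sub_right, Complex.sub_re] at h0 ⊢
  linarith

/-! ### The partial Fourier transform in `x` -/

/-- The Hilbert space `L²(ℝ)`. -/
abbrev H1 := Lp ℂ 2 (volume : Measure ℝ)

instance : Fact ((2 : ℝ≥0∞) ≠ ⊤) := ⟨by simp⟩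

instance : SecondCountableTopology H1 := Lp.SecondCountableTopology

/-- `((t, y), x) ↦ (t, x, y)`. -/
def perm (z : (ℝ × ℝ) × ℝ) : R3 := (z.1.1, z.2, z.1.2)

lemma measurePreserving_perm : MeasurePreserving perm volume volume := by
  have h1 : MeasurePreserving (MeasurableEquiv.prodAssoc : (ℝ × ℝ) × ℝ ≃ᵐ ℝ × ℝ × ℝ)
    volume volume := volume_preserving_prodAssoc
  have h2 : MeasurePreserving (Prod.map id Prod.swap : ℝ × ℝ × ℝ → ℝ × ℝ × ℝ) volume volume :=
    (MeasurePreserving.id (volume : Measure ℝ)).prod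
      (Measure.measurePreserving_swap (μ := (volume : Measure ℝ)) (ν := (volume : Measure ℝ)))
  exact h2.comp h1

/-- The slice `x ↦ w(t, x, y)`, `q = (t, y)`. -/
def slice (w : R3 → ℂ) (q : ℝ × ℝ) (x : ℝ) : ℂ := w (q.1, x, q.2)

lemma ae_slices {Q : R3 → Prop} (h : ∀ᵐ p : R3, Q p) :
    ∀ᵐ q : ℝ × ℝ, ∀ᵐ x : ℝ, Q (q.1, x, q.2) :=
  Measure.ae_ae_of_ae_prod (measurePreserving_perm.quasiMeasurePreserving.ae h)

lemma lintegral_slices {f : R3 → ℝ≥0∞} (hf : AEMeasurable f) :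
    ∫⁻ p, f p = ∫⁻ q : ℝ × ℝ, ∫⁻ x : ℝ, f (q.1, x, q.2) := by
  rw [lintegral_congr_ae hf.ae_eq_mk,
    ← measurePreserving_perm.lintegral_comp hf.measurable_mk]
  change ∫⁻ a, _ ∂((volume : Measure (ℝ × ℝ)).prod (volume : Measure ℝ)) = _
  rw [lintegral_prod (fun a => hf.mk f (perm a))
    (hf.measurable_mk.comp measurePreserving_perm.measurable).aemeasurable]
  refine lintegral_congr_ae ?_
  filter_upwards [ae_slices hf.ae_eq_mk] with q hq
  exact lintegral_congr_ae (hq.mono fun x hx => hx.symm)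

lemma eLpNorm_two_sq {α E : Type*} [MeasurableSpace α] [NormedAddCommGroup E] (μ : Measure α)
    (f : α → E) : eLpNorm f 2 μ ^ 2 = ∫⁻ x, ‖f x‖ₑ ^ 2 ∂μ := by
  rw [eLpNorm_eq_lintegral_rpow_enorm_toReal (by simp) (by simp), ← ENNReal.rpow_natCast,
    ← ENNReal.rpow_mul]
  simp

lemma eLpNorm_sq_slices {w : R3 → ℂ} (hw : AEStronglyMeasurable w) :
    eLpNorm w 2 volume ^ 2 = ∫⁻ q, eLpNorm (slice w q) 2 volume ^ 2 := by
  simp_rw [eLpNorm_two_sq]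
  exact lintegral_slices (hw.enorm.pow_const 2)

lemma memLp_slice {w : R3 → ℂ} (hw : MemLp w 2 volume) :
    ∀ᵐ q, MemLp (slice w q) 2 volume := by
  have hW := hw.1.measurable_mk
  have h0 : Measurable fun q : ℝ × ℝ => ∫⁻ x, ‖slice (hw.1.mk w) q x‖ₑ ^ 2 := by
    refine Measurable.lintegral_prod_right' (f := fun z : (ℝ × ℝ) × ℝ => ‖hw.1.mk w (perm z)‖ₑ ^ 2)
      (((hW.comp measurePreserving_perm.measurable).enorm).pow_const 2)
  have h1 := eLpNorm_sq_slices hw.1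
  have h2 : ∀ᵐ q, slice w q =ᵐ[volume] slice (hw.1.mk w) q := ae_slices hw.1.ae_eq_mk
  have h3 : ∀ᵐ q : ℝ × ℝ, ∫⁻ x, ‖slice (hw.1.mk w) q x‖ₑ ^ 2 < ⊤ := by
    refine ae_lt_top h0 (ne_of_lt ?_)
    have : ∫⁻ q : ℝ × ℝ, ∫⁻ x, ‖slice (hw.1.mk w) q x‖ₑ ^ 2 = eLpNorm w 2 volume ^ 2 := by
      rw [h1]
      refine lintegral_congr_ae ?_
      filter_upwards [h2] with q hq
      rw [← eLpNorm_two_sq, eLpNorm_congr_ae hq]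
    rw [this]
    exact ENNReal.pow_lt_top hw.2
  filter_upwards [h2, h3] with q hq hq3
  refine (memLp_congr_ae hq).2 ⟨(Measurable.comp (g := hw.1.mk w) hW
    (by fun_prop : Measurable fun x : ℝ => ((q.1, x, q.2) : R3))).aestronglyMeasurable, ?_⟩
  rw [← eLpNorm_two_sq] at hq3
  by_contra h
  rw [not_lt, top_le_iff] at h
  simp [h] at hq3

open Classical in
/-- The slice `x ↦ w(t, x, y)` as an element of `L²(ℝ)` (and `0` if it is not in `L²`). -/
def slL (w : R3 → ℂ) (q : ℝ × ℝ) : H1 :=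
  if h : MemLp (slice w q) 2 volume then h.toLp _ else 0

lemma slL_ae {w : R3 → ℂ} {q : ℝ × ℝ} (h : MemLp (slice w q) 2 volume) :
    slL w q =ᵐ[volume] slice w q := by
  simp only [slL, h, dite_true]
  exact h.coeFn_toLp

lemma slL_congr {w w' : R3 → ℂ} {q : ℝ × ℝ} (h : slice w q =ᵐ[volume] slice w' q) :
    slL w q = slL w' q := by
  by_cases hw : MemLp (slice w q) 2 volume
  · have hw' := (memLp_congr_ae h).1 hw
    apply Lp.ext
    exact (slL_ae hw).trans (h.trans (slL_ae hw').symm)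
  · have hw' : ¬ MemLp (slice w' q) 2 volume := fun h' => hw ((memLp_congr_ae h).2 h')
    simp [slL, hw, hw']

/-- Membership in a closed set is the vanishing of an infimum of distances to a countable dense
subset. This reduces measurability of the L²(ℝ)-valued slice map to that of scalar integrals. -/
lemma measurable_of_edist {α X : Type*} [MeasurableSpace α] [PseudoEMetricSpace X]
    [SecondCountableTopology X] [MeasurableSpace X] [BorelSpace X] {f : α → X}
    (h : ∀ x, Measurable fun a => edist (f a) x) : Measurable f := by
  refine measurable_of_isClosed fun C hC => ?_
  obtain ⟨c, hcC, hcc, hd⟩ := (TopologicalSpace.IsSeparable.of_separableSpace C)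
    |>.exists_countable_dense_subset
  have e : f ⁻¹' C = {a | (⨅ x ∈ c, edist (f a) x) = 0} := by
    ext a
    have h1 : Metric.infEDist (f a) C = Metric.infEDist (f a) c := by
      refine le_antisymm (Metric.infEDist_anti hcC) ?_
      rw [← Metric.infEDist_closure (s := c)]
      exact Metric.infEDist_anti hd
    rw [mem_preimage, Metric.mem_iff_infEDist_zero_of_closed hC, h1]
    rfl
  rw [e]
  exact (Measurable.biInf c hcc fun x _ => h x) (measurableSet_singleton 0)

lemma stronglyMeasurable_slL {w : R3 → ℂ} (hw : Measurable w) : StronglyMeasurable (slL w) := by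
  borelize (↥H1)
  refine Measurable.stronglyMeasurable (measurable_of_edist fun h => ?_)
  have hs : ∀ q, Measurable (slice w q) := fun q =>
    hw.comp (by fun_prop : Measurable fun x : ℝ => ((q.1, x, q.2) : R3))
  have hset : MeasurableSet {q | MemLp (slice w q) 2 volume} := by
    have h0 : Measurable fun q : ℝ × ℝ => ∫⁻ x, ‖slice w q x‖ₑ ^ 2 := by
      refine Measurable.lintegral_prod_right' (f := fun z : (ℝ × ℝ) × ℝ => ‖w (perm z)‖ₑ ^ 2)
        (((hw.comp measurePreserving_perm.measurable).enorm).pow_const 2)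
    have e : {q | MemLp (slice w q) 2 volume} = {q | ∫⁻ x, ‖slice w q x‖ₑ ^ 2 < ⊤} := by
      ext q
      simp only [mem_ofPred_eq, MemLp, (hs q).aestronglyMeasurable, true_and]
      rw [← eLpNorm_two_sq]
      exact ⟨fun h => ENNReal.pow_lt_top h, fun h => by
        by_contra h'
        rw [not_lt, top_le_iff] at h'
        simp [h'] at h⟩
    rw [e]
    exact measurableSet_lt h0 measurable_const
  have h1 : Measurable fun q : ℝ × ℝ => (∫⁻ x, ‖slice w q x - h x‖ₑ ^ 2) ^ (1 / 2 : ℝ) := by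
    refine Measurable.pow_const (Measurable.lintegral_prod_right'
      (f := fun z : (ℝ × ℝ) × ℝ => ‖w (perm z) - h z.2‖ₑ ^ 2) ?_) _
    exact (((hw.comp measurePreserving_perm.measurable).sub
      ((Lp.stronglyMeasurable h).measurable.comp measurable_snd)).enorm).pow_const 2
  classical
  have e : (fun q => edist (slL w q) h) = fun q => if MemLp (slice w q) 2 volume then
      (∫⁻ x, ‖slice w q x - h x‖ₑ ^ 2) ^ (1 / 2 : ℝ) else edist 0 h := by
    funext q
    split_ifs with hq
    · rw [edist_eq_enorm_sub, Lp.enorm_def, eLpNorm_eq_lintegral_rpow_enorm_toReal (by simp)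
        (by simp)]
      simp only [ENNReal.toReal_ofNat]
      congr 1
      refine lintegral_congr_ae ?_
      filter_upwards [slL_ae hq, Lp.coeFn_sub (slL w q) h] with x h1 h2
      rw [h2, Pi.sub_apply, h1]
      norm_cast
    · simp [slL, hq]
  rw [e]
  exact Measurable.ite hset h1 measurable_const

lemma slL_HH_ae (w : HH) : ∀ᵐ q, slL w q =ᵐ[volume] slice w q := by
  filter_upwards [memLp_slice (Lp.memLp w)] with q hq using slL_ae hq

lemma lintegral_slL (w : HH) : ∫⁻ q, ‖slL w q‖ₑ ^ 2 = ‖w‖ₑ ^ 2 := by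
  rw [Lp.enorm_def, eLpNorm_sq_slices (Lp.memLp w).1]
  refine lintegral_congr_ae ?_
  filter_upwards [slL_HH_ae w] with q hq
  rw [Lp.enorm_def, eLpNorm_congr_ae hq]

/-- The Hilbert space `L²(ℝ²; L²(ℝ))`. -/
abbrev HB := Lp H1 2 (volume : Measure (ℝ × ℝ))

lemma memLp_slL (w : HH) : MemLp (slL w) 2 volume := by
  refine ⟨(stronglyMeasurable_slL (Lp.stronglyMeasurable w).measurable).aestronglyMeasurable, ?_⟩
  have h : eLpNorm (slL w) 2 volume ^ 2 < ⊤ := by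
    rw [eLpNorm_two_sq, lintegral_slL]
    exact ENNReal.pow_lt_top enorm_lt_top
  by_contra h'
  rw [not_lt, top_le_iff] at h'
  simp [h'] at h

lemma slL_add (w w' : HH) : ∀ᵐ q, slL (w + w' : HH) q = slL w q + slL w' q := by
  filter_upwards [slL_HH_ae w, slL_HH_ae w', slL_HH_ae (w + w'),
    ae_slices (Lp.coeFn_add w w')] with q h1 h2 h3 h4
  apply Lp.ext
  filter_upwards [h1, h2, h3, h4, Lp.coeFn_add (slL w q) (slL w' q)] with x h1 h2 h3 h4 h5
  rw [h3, h5, Pi.add_apply, h1, h2]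
  exact h4

lemma slL_smul (c : ℂ) (w : HH) : ∀ᵐ q, slL (c • w : HH) q = c • slL w q := by
  filter_upwards [slL_HH_ae w, slL_HH_ae (c • w),
    ae_slices (Lp.coeFn_smul c w)] with q h1 h3 h4
  apply Lp.ext
  filter_upwards [h1, h3, h4, Lp.coeFn_smul c (slL w q)] with x h1 h3 h4 h5
  rw [h3, h5, Pi.smul_apply, h1]
  exact h4

/-- Slicing as a linear isometry `L²(ℝ³) → L²(ℝ²; L²(ℝ))`. -/
def slicing : HH →ₗᵢ[ℂ] HB where
  toFun w := (memLp_slL w).toLp _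
  map_add' w w' := by
    rw [← MemLp.toLp_add]
    exact MemLp.toLp_congr _ _ (slL_add w w')
  map_smul' c w := by
    rw [RingHom.id_apply, ← MemLp.toLp_const_smul]
    exact MemLp.toLp_congr _ _ (slL_smul c w)
  norm_map' w := by
    have h : ‖(memLp_slL w).toLp _‖ₑ ^ 2 = ‖w‖ₑ ^ 2 := by
      rw [← lintegral_slL, Lp.enorm_def, eLpNorm_two_sq]
      refine lintegral_congr_ae ?_
      filter_upwards [(memLp_slL w).coeFn_toLp] with q hq
      rw [hq]
    have h' : ‖(memLp_slL w).toLp _‖ₑ = ‖w‖ₑ := (ENNReal.pow_right_strictMono two_ne_zero).injective h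
    exact congrArg ENNReal.toReal h' |> (by simpa using ·)

lemma slicing_ae (w : HH) : slicing w =ᵐ[volume] slL w := (memLp_slL w).coeFn_toLp

/-- The range of an isometry is closed, and it contains 1_s ⊗ c for every set s of finite measure
and every c ∈ L²(ℝ). -/
lemma slicing_surjective : Function.Surjective slicing := by
  intro F
  change F ∈ Set.range slicing
  refine Lp.induction (by simp) (fun F => F ∈ Set.range slicing) ?_ ?_
    slicing.isometry.isClosedEmbedding.isClosed_range F
  · intro c s hs hμs
    set W : R3 → ℂ := fun p => s.indicator (fun _ => (1 : ℂ)) (p.1, p.2.2) * c p.2.1 with hW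
    have hWm : Measurable W := by
      refine Measurable.mul ?_ ((Lp.stronglyMeasurable c).measurable.comp (by fun_prop))
      exact (measurable_const.indicator hs).comp (by fun_prop : Measurable fun p : R3 => (p.1, p.2.2))
    have hsl : ∀ q, slice W q = fun x => s.indicator (fun _ => (1 : ℂ)) q * c x := fun q => rfl
    have hsl' : ∀ q, slL W q = s.indicator (fun _ => c) q := by
      intro q
      by_cases hq : q ∈ s
      · have : slice W q = c := by funext x; rw [hsl]; simp [hq]
        have hm : MemLp (slice W q) 2 volume := by rw [this]; exact Lp.memLp c
        rw [indicator_of_mem hq]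
        apply Lp.ext
        rw [← this]; exact slL_ae hm
      · have : slice W q = 0 := by funext x; rw [hsl]; simp [hq]
        have hm : MemLp (slice W q) 2 volume := by rw [this]; exact MemLp.zero
        rw [indicator_of_notMem hq]
        apply Lp.ext
        refine (slL_ae hm).trans ?_
        rw [this]; exact (Lp.coeFn_zero ℂ 2 volume).symm
    have hmem : MemLp W 2 volume := by
      refine ⟨hWm.aestronglyMeasurable, ?_⟩
      have h : eLpNorm W 2 volume ^ 2 < ⊤ := by
        rw [eLpNorm_sq_slices hWm.aestronglyMeasurable]
        have : ∀ q, eLpNorm (slice W q) 2 volume ^ 2 = s.indicator (fun _ => ‖c‖ₑ ^ 2) q := by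
          intro q
          by_cases hq : q ∈ s
          · have : slice W q = c := by funext x; rw [hsl]; simp [hq]
            rw [this, indicator_of_mem hq, Lp.enorm_def]
          · have : slice W q = 0 := by funext x; rw [hsl]; simp [hq]
            rw [this, indicator_of_notMem hq]; simp
        simp_rw [this]
        rw [lintegral_indicator hs, setLIntegral_const]
        exact ENNReal.mul_lt_top (ENNReal.pow_lt_top enorm_lt_top) hμs
      by_contra h'
      rw [not_lt, top_le_iff] at h'
      simp [h'] at h
    refine ⟨hmem.toLp W, ?_⟩
    apply Lp.ext
    refine (slicing_ae _).trans ?_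
    have h1 : ∀ᵐ q, slL (hmem.toLp W) q = slL W q := by
      filter_upwards [ae_slices hmem.coeFn_toLp] with q hq using slL_congr hq
    have h2 := Lp.simpleFunc.coe_indicatorConst (p := 2) hs hμs.ne c
    rw [h2]
    filter_upwards [h1, indicatorConstLp_coeFn (p := 2) (hs := hs) (hμs := hμs.ne) (c := c)] with q h3 h4
    rw [h3, h4, hsl']
  · rintro f g hf hg - ⟨a, ha⟩ ⟨b, hb⟩
    exact ⟨a + b, by rw [map_add, ha, hb]⟩

/-- Slicing as a unitary map `L²(ℝ³) → L²(ℝ²; L²(ℝ))`. -/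
def slicingE : HH ≃ₗᵢ[ℂ] HB := LinearIsometryEquiv.ofSurjective slicing slicing_surjective

lemma slL_ext {w w' : HH} (h : ∀ᵐ q, slL w q = slL w' q) : w = w' := by
  apply slicing.injective
  apply Lp.ext
  filter_upwards [slicing_ae w, slicing_ae w', h] with q h1 h2 h3
  rw [h1, h2, h3]

/-- The operator on `L²(ℝ³)` which acts as `A` on slices in the variable `x`. -/
def liftOp (A : H1 →L[ℂ] H1) (w : HH) : HH := slicingE.symm (A.compLp (slicingE w))

lemma slL_liftOp (A : H1 →L[ℂ] H1) (w : HH) : ∀ᵐ q, slL (liftOp A w) q = A (slL w q) := by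
  have h1 : slicing (liftOp A w) = A.compLp (slicing w) := slicingE.apply_symm_apply _
  filter_upwards [slicing_ae (liftOp A w), slicing_ae w, A.coeFn_compLp (slicing w)] with q h2 h3 h4
  rw [← h2, h1, h4, h3]

/-- The Fourier transform on `L²(ℝ)` as a unitary map. -/
abbrev F1 : H1 ≃ₗᵢ[ℂ] H1 := Lp.fourierTransformₗᵢ ℝ ℂ

/-- The partial Fourier transform in `x`. -/
def Fx : HH ≃ₗᵢ[ℂ] HH where
  toFun := liftOp F1.toContinuousLinearEquiv.toContinuousLinearMap
  invFun := liftOp F1.symm.toContinuousLinearEquiv.toContinuousLinearMap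
  map_add' w w' := by
    apply slL_ext
    set A := F1.toContinuousLinearEquiv.toContinuousLinearMap
    filter_upwards [slL_liftOp A (w + w'), slL_liftOp A w, slL_liftOp A w', slL_add w w',
      slL_add (liftOp A w) (liftOp A w')] with q h1 h2 h3 h4 h5
    rw [h1, h5, h2, h3, h4, map_add]
  map_smul' c w := by
    apply slL_ext
    set A := F1.toContinuousLinearEquiv.toContinuousLinearMap
    filter_upwards [slL_liftOp A (c • w), slL_liftOp A w, slL_smul c w,
      slL_smul c (liftOp A w)] with q h1 h2 h3 h4
    rw [h1, RingHom.id_apply, h4, h2, h3, map_smul]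
  left_inv w := by
    apply slL_ext
    filter_upwards [slL_liftOp F1.symm.toContinuousLinearEquiv.toContinuousLinearMap
      (liftOp F1.toContinuousLinearEquiv.toContinuousLinearMap w),
      slL_liftOp F1.toContinuousLinearEquiv.toContinuousLinearMap w] with q h1 h2
    rw [h1, h2]
    exact F1.symm_apply_apply _
  right_inv w := by
    apply slL_ext
    filter_upwards [slL_liftOp F1.toContinuousLinearEquiv.toContinuousLinearMap
      (liftOp F1.symm.toContinuousLinearEquiv.toContinuousLinearMap w),
      slL_liftOp F1.symm.toContinuousLinearEquiv.toContinuousLinearMap w] with q h1 h2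
    rw [h1, h2]
    exact F1.apply_symm_apply _
  norm_map' w := by
    have h : ‖liftOp F1.toContinuousLinearEquiv.toContinuousLinearMap w‖ₑ ^ 2 = ‖w‖ₑ ^ 2 := by
      rw [← lintegral_slL, ← lintegral_slL]
      refine lintegral_congr_ae ?_
      filter_upwards [slL_liftOp F1.toContinuousLinearEquiv.toContinuousLinearMap w] with q h1
      rw [h1]
      congr 1
      exact (by rw [← ofReal_norm, F1.norm_map, ofReal_norm] :
        ‖F1 (slL w q)‖ₑ = ‖slL w q‖ₑ)
    have h' := (ENNReal.pow_right_strictMono two_ne_zero).injective h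
    exact congrArg ENNReal.toReal h' |> (by simpa using ·)

lemma slL_Fx (w : HH) : ∀ᵐ q, slL (Fx w) q = F1 (slL w q) :=
  slL_liftOp F1.toContinuousLinearEquiv.toContinuousLinearMap w

/-! ### Fourier multipliers in `x` -/

/-- Bounded measurable symbols. -/
def IsSym (m : ℝ → ℂ) : Prop := Measurable m ∧ ∃ K : ℝ, ∀ ξ, ‖m ξ‖ ≤ K

lemma IsSym.coef {m : ℝ → ℂ} (h : IsSym m) : IsCoef (fun p => m p.2.1) := by
  obtain ⟨hm, K, hK⟩ := h
  exact ⟨hm.comp (by fun_prop), K, fun p => hK _⟩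

lemma IsSym.mul {a b : ℝ → ℂ} (ha : IsSym a) (hb : IsSym b) : IsSym (fun ξ => a ξ * b ξ) := by
  obtain ⟨ha, K, hK⟩ := ha
  obtain ⟨hb, L, hL⟩ := hb
  refine ⟨ha.mul hb, K * L, fun p => ?_⟩
  rw [norm_mul]
  exact mul_le_mul (hK p) (hL p) (norm_nonneg _) ((norm_nonneg _).trans (hK p))

lemma isSym_const (c : ℂ) : IsSym (fun _ => c) := ⟨measurable_const, ‖c‖, fun _ => le_rfl⟩

/-- The Fourier multiplier in `x` with symbol `m`. -/
def mult (m : ℝ → ℂ) : HH →L[ℂ] HH :=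
  Fx.symm.toContinuousLinearEquiv.toContinuousLinearMap ∘L (mulOp (fun p => m p.2.1)) ∘L
    Fx.toContinuousLinearEquiv.toContinuousLinearMap

lemma Fx_mult (m : ℝ → ℂ) (w : HH) : Fx (mult m w) = mulOp (fun p => m p.2.1) (Fx w) :=
  Fx.apply_symm_apply _

lemma mult_mult {a b : ℝ → ℂ} (ha : IsSym a) (hb : IsSym b) (w : HH) :
    mult a (mult b w) = mult (fun ξ => a ξ * b ξ) w := by
  apply Fx.injective
  rw [Fx_mult, Fx_mult, Fx_mult, mulOp_mulOp ha.coef hb.coef]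

lemma mult_comm {a b : ℝ → ℂ} (ha : IsSym a) (hb : IsSym b) (w : HH) :
    mult a (mult b w) = mult b (mult a w) := by
  rw [mult_mult ha hb, mult_mult hb ha]
  simp_rw [mul_comm]

lemma mult_one (w : HH) : mult (fun _ => 1) w = w := by
  apply Fx.injective
  rw [Fx_mult, mulOp_one]

lemma mult_sub {a b : ℝ → ℂ} (ha : IsSym a) (hb : IsSym b) (w : HH) :
    mult (fun ξ => a ξ - b ξ) w = mult a w - mult b w := by
  apply Fx.injective
  rw [map_sub, Fx_mult, Fx_mult, Fx_mult, mulOp_sub ha.coef hb.coef]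

lemma mult_const_mul {a : ℝ → ℂ} (ha : IsSym a) (c : ℂ) (w : HH) :
    mult (fun ξ => c * a ξ) w = c • mult a w := by
  apply Fx.injective
  rw [map_smul, Fx_mult, Fx_mult, mulOp_const_mul ha.coef]

lemma inner_mult_left {a : ℝ → ℂ} (ha : IsSym a) (w q : HH) :
    inner ℂ (mult a w) q = inner ℂ w (mult (fun ξ => (starRingEnd ℂ) (a ξ)) q) := by
  rw [← Fx.inner_map_map, Fx_mult, inner_mulOp_left ha.coef,
    ← Fx_mult (fun ξ => (starRingEnd ℂ) (a ξ)), Fx.inner_map_map]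

lemma norm_mult_le_norm {a b : ℝ → ℂ} (ha : IsSym a) (hb : IsSym b) (w : HH)
    {K : ℝ} (h : ∀ ξ, ‖a ξ‖ ≤ K * ‖b ξ‖) : ‖mult a w‖ ≤ K * ‖mult b w‖ := by
  rw [← Fx.norm_map, ← Fx.norm_map (mult b w), Fx_mult, Fx_mult]
  exact norm_mulOp_le_norm ha.coef hb.coef _ fun p => h _

lemma norm_mult_le {a : ℝ → ℂ} (ha : IsSym a) (w : HH)
    {K : ℝ} (h : ∀ ξ, ‖a ξ‖ ≤ K) : ‖mult a w‖ ≤ K * ‖w‖ := by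
  have := norm_mult_le_norm ha (isSym_const 1) w (K := K) (fun p => by simpa using h p)
  rwa [mult_one] at this

lemma slL_mulOp {a : R3 → ℂ} (ha : IsCoef a) {α : ℝ × ℝ → ℂ} (h : ∀ p, a p = α (p.1, p.2.2))
    (w : HH) : ∀ᵐ q, slL (mulOp a w) q = α q • slL w q := by
  filter_upwards [slL_HH_ae w, slL_HH_ae (mulOp a w), ae_slices (mulOp_ae ha w)] with q h1 h2 h3
  apply Lp.ext
  filter_upwards [h1, h2, h3, Lp.coeFn_smul (α q) (slL w q)] with x h1 h2 h3 h4
  rw [h2, h4, Pi.smul_apply, h1]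
  change mulOp a w (q.1, x, q.2) = _
  rw [h3, h]
  rfl

lemma Fx_mulOp {a : R3 → ℂ} (ha : IsCoef a) {α : ℝ × ℝ → ℂ} (h : ∀ p, a p = α (p.1, p.2.2))
    (w : HH) : Fx (mulOp a w) = mulOp a (Fx w) := by
  apply slL_ext
  filter_upwards [slL_Fx (mulOp a w), slL_Fx w, slL_mulOp ha h w, slL_mulOp ha h (Fx w)]
    with q h1 h2 h3 h4
  rw [h1, h3, h4, h2, map_smul]

/-- A coefficient independent of x is a scalar on each slice. This is what lets Λ^{-s} pass the
weights in y, the cutoffs and the indicator of y > 0. -/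
lemma mult_mulOp {a : R3 → ℂ} (ha : IsCoef a) {α : ℝ × ℝ → ℂ} (h : ∀ p, a p = α (p.1, p.2.2))
    {m : ℝ → ℂ} (hm : IsSym m) (w : HH) : mult m (mulOp a w) = mulOp a (mult m w) := by
  apply Fx.injective
  rw [Fx_mult, Fx_mulOp ha h, Fx_mulOp ha h, Fx_mult, mulOp_comm hm.coef ha]

lemma slL_tr (s r : ℝ) (w : HH) : ∀ᵐ q, slL (tr (s, 0, r) w) q = slL w (q + (s, r)) := by
  have h1 : ∀ᵐ q : ℝ × ℝ, slL w (q + (s, r)) =ᵐ[volume] slice w (q + (s, r)) :=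
    (measurePreserving_add_right (volume : Measure (ℝ × ℝ)) (s, r)).quasiMeasurePreserving.ae
      (slL_HH_ae w)
  filter_upwards [h1, slL_HH_ae (tr (s, 0, r) w), ae_slices (tr_ae (s, 0, r) w)] with q h1 h2 h3
  apply Lp.ext
  filter_upwards [h1, h2, h3] with x h1 h2 h3
  rw [h2, h1]
  change tr (s, 0, r) w (q.1, x, q.2) = _
  rw [h3]
  simp [slice]

lemma Fx_tr (s r : ℝ) (w : HH) : Fx (tr (s, 0, r) w) = tr (s, 0, r) (Fx w) := by
  apply slL_ext
  have h1 : ∀ᵐ q : ℝ × ℝ, slL (Fx w) (q + (s, r)) = F1 (slL w (q + (s, r))) :=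
    (measurePreserving_add_right (volume : Measure (ℝ × ℝ)) (s, r)).quasiMeasurePreserving.ae
      (slL_Fx w)
  filter_upwards [h1, slL_Fx (tr (s, 0, r) w), slL_tr s r w, slL_tr s r (Fx w)] with q h1 h2 h3 h4
  rw [h2, h3, h4, h1]

lemma mult_tr (s r : ℝ) {m : ℝ → ℂ} (hm : IsSym m) (w : HH) :
    mult m (tr (s, 0, r) w) = tr (s, 0, r) (mult m w) := by
  apply Fx.injective
  rw [Fx_mult, Fx_tr, Fx_tr, Fx_mult, tr_mulOp hm.coef]
  simp

/-- The translation on `L²(ℝ)`. -/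
def tr1 (s : ℝ) : H1 →L[ℂ] H1 :=
  (Lp.compMeasurePreservingₗᵢ ℂ (fun x : ℝ => x + s)
    (measurePreserving_add_right volume s)).toContinuousLinearMap

lemma tr1_ae (s : ℝ) (w : H1) : tr1 s w =ᵐ[volume] fun x => w (x + s) :=
  Lp.coeFn_compMeasurePreserving w (measurePreserving_add_right volume s)

/-- The symbol of the translation. -/
def trSym (s ξ : ℝ) : ℂ := Real.fourierChar (s * ξ)

lemma isSym_trSym (s : ℝ) : IsSym (trSym s) := by
  refine ⟨?_, 1, fun ξ => (Circle.norm_coe _).le⟩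
  have : Continuous fun ξ : ℝ => trSym s ξ :=
    continuous_subtype_val.comp (Real.continuous_fourierChar.comp (by fun_prop))
  exact this.measurable

/-- Both sides are continuous in w, so it suffices to compare them on Schwartz functions, where the
Fourier transform is an integral. -/
lemma F1_tr1 (s : ℝ) (w : H1) :
    F1 (tr1 s w) =ᵐ[volume] fun ξ => trSym s ξ * F1 w ξ := by
  have hmem : MemLp (fun ξ => trSym s ξ) ∞ (volume : Measure ℝ) := by
    obtain ⟨hm, K, hK⟩ := isSym_trSym s
    exact memLp_top_of_bound hm.aestronglyMeasurable K (Eventually.of_forall hK)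
  let M := (ContinuousLinearMap.mul ℂ ℂ).holderL (volume : Measure ℝ) ∞ 2 2 (hmem.toLp _)
  have hM : ∀ w : H1, M w =ᵐ[volume] fun ξ => trSym s ξ * w ξ := fun w => by
    filter_upwards [(ContinuousLinearMap.mul ℂ ℂ).coeFn_holder (r := 2) (hmem.toLp _) w,
      hmem.coeFn_toLp] with ξ h1 h2
    change (ContinuousLinearMap.mul ℂ ℂ).holder 2 (hmem.toLp _) w ξ = _
    rw [h1, h2]; rfl
  have key : F1 (tr1 s w) = M (F1 w) := by
    refine DenseRange.induction_on (p := fun w : H1 => F1 (tr1 s w) = M (F1 w))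
      (SchwartzMap.denseRange_toLpCLM (E := ℝ) (F := ℂ) (p := 2) (μ := volume) (by simp)) w
      (isClosed_eq (F1.continuous.comp (tr1 s).continuous) (M.continuous.comp F1.continuous))
      fun f => ?_
    have h0 : ∀ᵐ x : ℝ, f.toLp 2 volume x = f x := f.coeFn_toLp 2 volume
    have h1 : tr1 s (SchwartzMap.toLpCLM ℝ ℂ 2 volume f) =
        (SchwartzMap.compSubConstCLM ℂ (-s) f).toLp 2 := by
      apply Lp.ext
      filter_upwards [tr1_ae s (f.toLp 2),
        (measurePreserving_add_right volume s).quasiMeasurePreserving.ae h0,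
        (SchwartzMap.compSubConstCLM ℂ (-s) f).coeFn_toLp 2] with x h1 h2 h3
      rw [h3, SchwartzMap.compSubConstCLM_apply, sub_neg_eq_add, ← h2]
      exact h1
    have h2 : F1 ((SchwartzMap.compSubConstCLM ℂ (-s) f).toLp 2) =
        (𝓕 (SchwartzMap.compSubConstCLM ℂ (-s) f)).toLp 2 := SchwartzMap.toLp_fourier_eq _
    have h3 : F1 (SchwartzMap.toLpCLM ℝ ℂ 2 volume f) = (𝓕 f).toLp 2 :=
      SchwartzMap.toLp_fourier_eq _
    rw [h1, h2, h3]
    apply Lp.ext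
    filter_upwards [(𝓕 (SchwartzMap.compSubConstCLM ℂ (-s) f)).coeFn_toLp 2,
      hM ((𝓕 f).toLp 2), (𝓕 f).coeFn_toLp 2] with ξ h4 h5 h6
    rw [h4, h5, h6, SchwartzMap.fourier_coe, SchwartzMap.fourier_coe]
    have h7 := congrFun (Fourier.fourierIntegral_comp_add_right Real.fourierChar volume f s) ξ
    have h8 : (f : ℝ → ℂ) ∘ (fun v => v + s) = ⇑(SchwartzMap.compSubConstCLM ℂ (-s) f) := by
      funext v
      simp [SchwartzMap.compSubConstCLM_apply]
    rw [h8] at h7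
    simp only [Fourier.fourierIntegral, VectorFourier.fourierIntegral] at h7
    rw [Real.fourier_real_eq, Real.fourier_real_eq]
    simp only [LinearMap.mul_apply'] at h7
    rw [h7]
    rfl
  rw [key]
  exact hM _

lemma slL_trX (s : ℝ) (w : HH) : ∀ᵐ q, slL (trX s w) q = tr1 s (slL w q) := by
  filter_upwards [slL_HH_ae w, slL_HH_ae (trX s w), ae_slices (tr_ae (0, s, 0) w)] with q h1 h2 h3
  apply Lp.ext
  filter_upwards [(measurePreserving_add_right volume s).quasiMeasurePreserving.ae h1, h2, h3,
    tr1_ae s (slL w q)] with x h1 h2 h3 h4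
  rw [h2, h4, h1]
  change tr (0, s, 0) w (q.1, x, q.2) = _
  rw [h3]
  simp [slice]

lemma Fx_trX (s : ℝ) (w : HH) : Fx (trX s w) = mulOp (fun p => trSym s p.2.1) (Fx w) := by
  apply slL_ext
  filter_upwards [slL_Fx (trX s w), slL_trX s w, slL_Fx w, slL_HH_ae (Fx w),
    slL_HH_ae (mulOp (fun p => trSym s p.2.1) (Fx w)),
    ae_slices (mulOp_ae (isSym_trSym s).coef (Fx w))] with q h1 h2 h3 h4 h5 h6
  rw [h1, h2]
  apply Lp.ext
  rw [h3] at h4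
  filter_upwards [F1_tr1 s (slL w q), h4, h5, h6] with ξ h7 h8 h9 h10
  rw [h7, h8, h9]
  exact h10.symm

lemma trX_eq_mult (s : ℝ) (w : HH) : trX s w = mult (trSym s) w := by
  apply Fx.injective
  rw [Fx_trX, Fx_mult]

lemma mult_trX (s : ℝ) {m : ℝ → ℂ} (hm : IsSym m) (w : HH) :
    mult m (trX s w) = trX s (mult m w) := by
  rw [trX_eq_mult, trX_eq_mult, mult_comm hm (isSym_trSym s)]

lemma mult_isUp {m : ℝ → ℂ} (hm : IsSym m) {w : HH} (hw : IsUp w) : IsUp (mult m w) := by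
  unfold IsUp
  rw [← mult_mulOp isCoef_up (α := fun q => if 0 < q.2 then 1 else 0) (fun p => rfl) hm, hw]

lemma HasD.multT {m : ℝ → ℂ} (hm : IsSym m) {w w' : HH} (h : HasD trT w w') :
    HasD trT (mult m w) (mult m w') := h.map _ fun _ => mult_tr _ _ hm _

lemma HasD.multX {m : ℝ → ℂ} (hm : IsSym m) {w w' : HH} (h : HasD trX w w') :
    HasD trX (mult m w) (mult m w') := h.map _ fun _ => mult_trX _ hm _

lemma HasD.multY {m : ℝ → ℂ} (hm : IsSym m) {w w' : HH} (h : HasD trY w w') :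
    HasD trY (mult m w) (mult m w') := h.map _ fun _ => mult_tr _ _ hm _

lemma HasD.mult_shY {m : ℝ → ℂ} (hm : IsSym m) {w w' : HH} (h : HasD shY w w') :
    HasD shY (mult m w) (mult m w') := h.map _ fun s => by
  rw [shY, mult_mulOp isCoef_up (α := fun q => if 0 < q.2 then 1 else 0) (fun p => rfl) hm,
    mult_tr _ _ hm]
  rfl

/-- The symbol of `∂_x`. -/
def dsym (ξ : ℝ) : ℂ := 2 * Real.pi * ξ * Complex.I

lemma norm_dsym (ξ : ℝ) : ‖dsym ξ‖ = 2 * Real.pi * |ξ| := by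
  simp [dsym, abs_of_pos Real.pi_pos]

lemma trSym_eq (s ξ : ℝ) : trSym s ξ = Complex.exp (((2 * Real.pi * (s * ξ) : ℝ) : ℂ) * Complex.I) := by
  rw [trSym, Real.fourierChar_apply]

lemma norm_trSym_sub_one_le (s ξ : ℝ) : ‖trSym s ξ - 1‖ ≤ |s| * ‖dsym ξ‖ := by
  rw [trSym_eq, norm_dsym]
  have := Real.norm_exp_I_mul_ofReal_sub_one_le (x := 2 * Real.pi * (s * ξ))
  rw [mul_comm] at this
  refine this.trans (le_of_eq ?_)
  rw [Real.norm_eq_abs, abs_mul, abs_mul, abs_mul, abs_of_pos Real.pi_pos]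
  simp; ring

lemma tendsto_trSym (ξ : ℝ) :
    Tendsto (fun s : ℝ => ((s⁻¹ : ℝ) : ℂ) * (trSym s ξ - 1)) (𝓝[>] 0) (𝓝 (dsym ξ)) := by
  have h1 : HasDerivAt (fun s : ℝ => Complex.exp ((s : ℂ) * dsym ξ)) (dsym ξ) 0 := by
    have h2 : HasDerivAt (fun s : ℝ => (s : ℂ) * dsym ξ) (dsym ξ) 0 := by
      simpa using (Complex.ofRealCLM.hasDerivAt (x := 0)).mul_const (dsym ξ)
    simpa using h2.cexp
  have h3 := (hasDerivAt_iff_tendsto_slope_zero.1 h1).mono_left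
    (nhdsWithin_mono 0 (fun s hs => ne_of_gt hs : Ioi (0 : ℝ) ⊆ {0}ᶜ))
  refine h3.congr fun s => ?_
  have e : Complex.exp ((s : ℂ) * dsym ξ) = trSym s ξ := by
    rw [trSym_eq]; congr 1; simp [dsym]; ring
  simp only [zero_add, Complex.ofReal_zero, zero_mul, Complex.exp_zero, e]
  exact Complex.real_smul

/-- On the Fourier side the difference quotients multiply by s⁻¹(e^{2πisξ} − 1)m(ξ), bounded by
|∂_x-symbol · m| uniformly in s; dominated convergence applies. -/
lemma hasD_mult {m : ℝ → ℂ} (hm : IsSym m) (hm' : IsSym (fun ξ => dsym ξ * m ξ)) (w : HH) :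
    HasD trX (mult m w) (mult (fun ξ => dsym ξ * m ξ) w) := by
  have hb : ∀ s : ℝ, IsSym (fun ξ => ((s⁻¹ : ℝ) : ℂ) * (trSym s ξ * m ξ - m ξ)) := by
    intro s
    obtain ⟨h1, K, hK⟩ := hm
    obtain ⟨h2, L, hL⟩ := isSym_trSym s
    refine (isSym_const _).mul ⟨(h2.mul h1).sub h1, L * K + K, fun ξ => ?_⟩
    refine (norm_sub_le _ _).trans (add_le_add ?_ (hK ξ))
    rw [norm_mul]
    exact mul_le_mul (hL ξ) (hK ξ) (norm_nonneg _) ((norm_nonneg _).trans (hL ξ))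
  have hb' : ∀ s : ℝ, IsSym (fun ξ => (trSym s ξ * m ξ - m ξ)) := by
    intro s
    obtain ⟨h1, K, hK⟩ := hm
    obtain ⟨h2, L, hL⟩ := isSym_trSym s
    refine ⟨(h2.mul h1).sub h1, L * K + K, fun ξ => ?_⟩
    refine (norm_sub_le _ _).trans (add_le_add ?_ (hK ξ))
    rw [norm_mul]
    exact mul_le_mul (hL ξ) (hK ξ) (norm_nonneg _) ((norm_nonneg _).trans (hL ξ))
  obtain ⟨-, K, hK⟩ := id hm'
  have h1 := tendsto_mulOp (l := 𝓝[>] 0) (K := K) (fun s => (hb s).coef) hm'.coef (by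
    filter_upwards [self_mem_nhdsWithin] with s hs p
    have hs : (0 : ℝ) < s := hs
    have e : trSym s p.2.1 * m p.2.1 - m p.2.1 = (trSym s p.2.1 - 1) * m p.2.1 := by ring
    rw [e, norm_mul, norm_mul, Complex.norm_real, norm_inv, Real.norm_of_nonneg hs.le,
      inv_mul_le_iff₀ hs]
    have h2 := norm_trSym_sub_one_le s p.2.1
    have h3 := hK p.2.1
    rw [norm_mul] at h3
    rw [abs_of_pos hs] at h2
    calc _ ≤ s * ‖dsym p.2.1‖ * ‖m p.2.1‖ := mul_le_mul_of_nonneg_right h2 (norm_nonneg _)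
      _ = s * (‖dsym p.2.1‖ * ‖m p.2.1‖) := by ring
      _ ≤ s * K := mul_le_mul_of_nonneg_left h3 hs.le) (Fx w) (Eventually.of_forall fun p _ => by
    have := (tendsto_trSym p.2.1).mul_const (m p.2.1)
    refine this.congr fun s => ?_
    ring)
  have h2 := (Fx.symm.continuous.tendsto _).comp h1
  refine h2.congr fun s => ?_
  rw [trX_eq_mult, mult_mult (isSym_trSym s) hm, ← mult_sub ((isSym_trSym s).mul hm) hm,
    ← mult_const_mul (hb' s)]
  rfl

/-- Uniqueness of the derivative allows ∂_x to be absorbed by any multiplier of order −1 or lower.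
-/
lemma HasD.mult_eq {m : ℝ → ℂ} (hm : IsSym m) (hm' : IsSym (fun ξ => dsym ξ * m ξ)) {w w' : HH}
    (h : HasD trX w w') : mult m w' = mult (fun ξ => dsym ξ * m ξ) w :=
  (h.multX hm).unique (hasD_mult hm hm' w)

/-! ### Bessel potentials and the tangential norms -/

lemma one_le_bracket (r : ℝ) : 1 ≤ bracket r := by
  unfold bracket
  rw [Real.one_le_sqrt]
  nlinarith [sq_nonneg r]

lemma bracket_pos (r : ℝ) : 0 < bracket r := one_pos.trans_le (one_le_bracket r)

lemma bracket_sq (r : ℝ) : bracket r ^ 2 = 1 + r ^ 2 := Real.sq_sqrt (by positivity)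

lemma abs_le_bracket (r : ℝ) : |r| ≤ bracket r :=
  Real.abs_le_sqrt (by linarith)

lemma bracket_le (r : ℝ) : bracket r ≤ 1 + |r| := by
  unfold bracket
  rw [Real.sqrt_le_left (by positivity)]
  nlinarith [sq_abs r, abs_nonneg r]

lemma continuous_bracket : Continuous bracket := by
  unfold bracket; fun_prop

/-- The symbol `⟨ξ⟩` in the frequency variable of Mathlib's Fourier transform. -/
def br (ξ : ℝ) : ℝ := bracket (2 * Real.pi * ξ)

lemma one_le_br (ξ : ℝ) : 1 ≤ br ξ := one_le_bracket _

lemma br_pos (ξ : ℝ) : 0 < br ξ := bracket_pos _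

lemma continuous_br : Continuous br := continuous_bracket.comp (by fun_prop)

lemma continuous_br_rpow (s : ℝ) : Continuous fun ξ => br ξ ^ s :=
  continuous_br.rpow_const fun ξ => Or.inl (br_pos ξ).ne'

lemma norm_dsym_le (ξ : ℝ) : ‖dsym ξ‖ ≤ br ξ := by
  rw [norm_dsym]
  refine le_trans (le_of_eq ?_) (abs_le_bracket _)
  rw [abs_mul, abs_of_pos (by positivity : (0 : ℝ) < 2 * Real.pi)]

lemma br_sq (ξ : ℝ) : br ξ ^ 2 = 1 + ‖dsym ξ‖ ^ 2 := by
  rw [br, bracket_sq, norm_dsym, mul_pow, mul_pow (2 * Real.pi) |ξ|, sq_abs]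

/-- The symbol of `Λ^{-s}`. -/
def jsym (s ξ : ℝ) : ℂ := ((br ξ ^ (-s) : ℝ) : ℂ)

lemma norm_jsym (s ξ : ℝ) : ‖jsym s ξ‖ = br ξ ^ (-s) := by
  rw [jsym, Complex.norm_real, Real.norm_of_nonneg (Real.rpow_nonneg (br_pos ξ).le _)]

lemma norm_jsym_le {s : ℝ} (hs : 0 ≤ s) (ξ : ℝ) : ‖jsym s ξ‖ ≤ 1 := by
  rw [norm_jsym]
  exact Real.rpow_le_one_of_one_le_of_nonpos (one_le_br ξ) (by linarith)

lemma measurable_jsym (s : ℝ) : Measurable (jsym s) :=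
  (Complex.continuous_ofReal.comp (continuous_br_rpow _)).measurable

lemma isSym_jsym {s : ℝ} (hs : 0 ≤ s) : IsSym (jsym s) :=
  ⟨measurable_jsym s, 1, norm_jsym_le hs⟩

lemma jsym_mul (s r ξ : ℝ) : jsym s ξ * jsym r ξ = jsym (s + r) ξ := by
  rw [jsym, jsym, jsym, ← Complex.ofReal_mul, ← Real.rpow_add (br_pos ξ), neg_add]

lemma conj_jsym (s ξ : ℝ) : (starRingEnd ℂ) (jsym s ξ) = jsym s ξ := Complex.conj_ofReal _

lemma continuous_dsym : Continuous dsym := by unfold dsym; fun_prop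

lemma norm_dsym_jsym_le {s : ℝ} (hs : 1 ≤ s) (ξ : ℝ) : ‖dsym ξ * jsym s ξ‖ ≤ 1 := by
  rw [norm_mul, norm_jsym]
  calc _ ≤ br ξ ^ (1 : ℝ) * br ξ ^ (-s) := by
        refine mul_le_mul_of_nonneg_right ?_ (Real.rpow_nonneg (br_pos ξ).le _)
        rw [Real.rpow_one]; exact norm_dsym_le ξ
    _ = br ξ ^ (1 - s) := by rw [← Real.rpow_add (br_pos ξ), sub_eq_add_neg]
    _ ≤ 1 := Real.rpow_le_one_of_one_le_of_nonpos (one_le_br ξ) (by linarith)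

lemma isSym_dsym_jsym {s : ℝ} (hs : 1 ≤ s) : IsSym (fun ξ => dsym ξ * jsym s ξ) :=
  ⟨continuous_dsym.measurable.mul (measurable_jsym s), 1, norm_dsym_jsym_le hs⟩

/-- The operator `Λ^{-s}`. -/
def J (s : ℝ) : HH →L[ℂ] HH := mult (jsym s)

/-- The operator `∂_x Λ^{-s}`. -/
def DJ (s : ℝ) : HH →L[ℂ] HH := mult (fun ξ => dsym ξ * jsym s ξ)

lemma J_J {s r : ℝ} (hs : 0 ≤ s) (hr : 0 ≤ r) (w : HH) : J s (J r w) = J (s + r) w := by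
  rw [J, J, mult_mult (isSym_jsym hs) (isSym_jsym hr)]
  simp_rw [jsym_mul]; rfl

lemma J_DJ {s r : ℝ} (hs : 0 ≤ s) (hr : 1 ≤ r) (w : HH) : J s (DJ r w) = DJ (s + r) w := by
  rw [J, DJ, mult_mult (isSym_jsym hs) (isSym_dsym_jsym hr)]
  have : (fun ξ => jsym s ξ * (dsym ξ * jsym r ξ)) = fun ξ => dsym ξ * jsym (s + r) ξ := by
    funext ξ; rw [← jsym_mul]; ring
  rw [this]; rfl

lemma norm_J_le {s : ℝ} (hs : 0 ≤ s) (w : HH) : ‖J s w‖ ≤ ‖w‖ := by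
  simpa [J] using norm_mult_le (isSym_jsym hs) w (K := 1) (norm_jsym_le hs)

lemma norm_DJ_le {s : ℝ} (hs : 1 ≤ s) (w : HH) : ‖DJ s w‖ ≤ ‖w‖ := by
  simpa [DJ] using norm_mult_le (isSym_dsym_jsym hs) w (K := 1) (norm_dsym_jsym_le hs)

lemma norm_J_anti {s r : ℝ} (hs : 0 ≤ s) (h : s ≤ r) (w : HH) : ‖J r w‖ ≤ ‖J s w‖ := by
  have := J_J (s := r - s) (by linarith) hs w
  rw [sub_add_cancel] at this
  rw [← this]
  exact norm_J_le (by linarith) _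

lemma inner_J {s : ℝ} (hs : 0 ≤ s) (w q : HH) : inner ℂ (J s w) q = inner ℂ w (J s q) := by
  rw [J, inner_mult_left (isSym_jsym hs)]
  simp_rw [conj_jsym]

lemma conj_dsym (ξ : ℝ) : (starRingEnd ℂ) (dsym ξ) = - dsym ξ := by
  have : (starRingEnd ℂ) 2 = 2 := Complex.conj_ofReal 2
  simp [dsym, this]

lemma inner_DJ {s : ℝ} (hs : 1 ≤ s) (w q : HH) : inner ℂ (DJ s w) q = -inner ℂ w (DJ s q) := by
  rw [DJ, inner_mult_left (isSym_dsym_jsym hs), ← inner_neg_right]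
  congr 1
  have : (fun ξ => (starRingEnd ℂ) (dsym ξ * jsym s ξ)) =
      fun ξ => (-1 : ℂ) * (dsym ξ * jsym s ξ) := by
    funext ξ; rw [map_mul, conj_jsym, conj_dsym]; ring
  rw [this, mult_const_mul (isSym_dsym_jsym hs)]
  simp

lemma HasD.J_eq {s : ℝ} (hs : 1 ≤ s) {w w' : HH} (h : HasD trX w w') : J s w' = DJ s w :=
  h.mult_eq (isSym_jsym (by linarith)) (isSym_dsym_jsym hs)

/-! ### Extension by zero, and the norms of the statement on the Fourier side. -/

/-- Extension by zero of a function on the slab, as an element of `L²(ℝ³)`. -/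
def ez (T : ℝ) (w : R3 → ℂ) : HH := by
  classical
  exact if h : MemLp ((slab T).indicator w) 2 (volume : Measure R3) then h.toLp _ else 0

lemma isOpen_slab (T : ℝ) : IsOpen (slab T) :=
  isOpen_Ioo.prod (isOpen_univ.prod isOpen_Ioi)

lemma measurableSet_slab (T : ℝ) : MeasurableSet (slab T) := (isOpen_slab T).measurableSet

lemma ez_ae {T : ℝ} {w : R3 → ℂ} (h : MemLp w 2 (volume.restrict (slab T))) :
    ez T w =ᵐ[volume] (slab T).indicator w := by
  have h' := (memLp_indicator_iff_restrict (measurableSet_slab T)).2 h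
  simp only [ez, h', dite_true]
  exact h'.coeFn_toLp

lemma normL2_eq {T : ℝ} {w : R3 → ℂ} (h : MemLp w 2 (volume.restrict (slab T))) :
    normL2 T w = ‖ez T w‖ₑ := by
  rw [normL2, Lp.enorm_def, eLpNorm_congr_ae (ez_ae h),
    eLpNorm_indicator_eq_eLpNorm_restrict (measurableSet_slab T)]

/-- By Plancherel every admissible ψ has the norm on the right, and one exists exactly when that
norm is finite; the empty infimum supplies the value ⊤ otherwise. -/
lemma lamNorm_eq (s : ℝ) {φ : ℝ → ℂ} (h : MemLp φ 2 volume) :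
    lamNorm s φ = eLpNorm (fun ξ => ((br ξ ^ s : ℝ) : ℂ) * F1 (h.toLp φ) ξ) 2 volume := by
  set g : ℝ → ℂ := fun ξ => ((br ξ ^ s : ℝ) : ℂ) * F1 (h.toLp φ) ξ with hg
  have hgm : AEStronglyMeasurable g volume :=
    (Complex.continuous_ofReal.comp (continuous_br_rpow s)).aestronglyMeasurable.mul
      (Lp.memLp _).1
  have hψ : ∀ ψ : H1, IsLam s φ ψ → ‖ψ‖ₑ = eLpNorm g 2 volume := by
    rintro ψ ⟨h', hψ⟩
    have e : ‖ψ‖ₑ = ‖F1 ψ‖ₑ := by rw [← ofReal_norm, ← F1.norm_map, ofReal_norm]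
    rw [e, Lp.enorm_def]
    exact eLpNorm_congr_ae hψ
  unfold lamNorm
  by_cases hmem : MemLp g 2 volume
  · refine le_antisymm ?_ (le_iInf₂ fun ψ h' => (hψ ψ h').ge)
    have hL : IsLam s φ (F1.symm (hmem.toLp g)) := by
      refine ⟨h, ?_⟩
      have : (𝓕 (F1.symm (hmem.toLp g)) : H1) = hmem.toLp g := F1.apply_symm_apply _
      rw [this]
      exact hmem.coeFn_toLp
    exact iInf₂_le_of_le _ hL (hψ _ hL).le
  · have htop : eLpNorm g 2 volume = ⊤ := by
      by_contra h'
      exact hmem ⟨hgm, lt_top_iff_ne_top.2 h'⟩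
    rw [htop]
    refine le_antisymm le_top (le_iInf₂ fun ψ h' => ?_)
    rw [hψ ψ h', htop]

lemma normLam_eq {T : ℝ} (a s : ℝ) {w : R3 → ℂ} (h : MemLp w 2 (volume.restrict (slab T))) :
    normLam T a s w = eLpNorm (fun p : R3 =>
      ((bracket p.2.2 ^ a * br p.2.1 ^ s : ℝ) : ℂ) * Fx (ez T w) p) 2 volume := by
  set W := ez T w with hW
  set G : R3 → ℂ := fun p => ((bracket p.2.2 ^ a * br p.2.1 ^ s : ℝ) : ℂ) * Fx W p with hG
  have hcont : Continuous fun p : R3 => bracket p.2.2 ^ a * br p.2.1 ^ s :=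
    ((continuous_bracket.rpow_const fun y => Or.inl (bracket_pos y).ne').comp
      (by fun_prop : Continuous fun p : R3 => p.2.2)).mul
      ((continuous_br_rpow s).comp (by fun_prop))
  have hGm : AEStronglyMeasurable G volume :=
    (Complex.continuous_ofReal.comp hcont).aestronglyMeasurable.mul (Lp.memLp _).1
  have hsq : eLpNorm G 2 volume = (eLpNorm G 2 volume ^ 2) ^ (1 / 2 : ℝ) := by
    rw [← ENNReal.rpow_natCast, ← ENNReal.rpow_mul]; simp
  rw [hsq, eLpNorm_sq_slices hGm, normLam]
  congr 1
  set S : Set (ℝ × ℝ) := Ioo 0 T ×ˢ Ioi 0 with hS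
  have hSm : MeasurableSet S := measurableSet_Ioo.prod measurableSet_Ioi
  set Φ : ℝ × ℝ → ℝ≥0∞ := fun q => eLpNorm (slice G q) 2 volume ^ 2 with hΦ
  have hΦm : AEMeasurable Φ volume := by
    have e : ∀ᵐ q : ℝ × ℝ, (∫⁻ x, ‖slice (hGm.mk G) q x‖ₑ ^ 2) = Φ q := by
      filter_upwards [ae_slices hGm.ae_eq_mk] with q hq
      rw [← eLpNorm_two_sq, hΦ]
      exact congrArg (· ^ 2) (eLpNorm_congr_ae (hq.mono fun x hx => hx.symm))
    refine AEMeasurable.congr (Measurable.aemeasurable ?_) e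
    exact Measurable.lintegral_prod_right' (f := fun z : (ℝ × ℝ) × ℝ => ‖hGm.mk G (perm z)‖ₑ ^ 2)
      (((hGm.measurable_mk.comp measurePreserving_perm.measurable).enorm).pow_const 2)
  have hcut : ∀ᵐ q : ℝ × ℝ, slice G q =ᵐ[volume] fun ξ =>
      ((bracket q.2 ^ a * br ξ ^ s : ℝ) : ℂ) * F1 (slL W q) ξ := by
    filter_upwards [slL_HH_ae (Fx W), slL_Fx W] with q h1 h2
    rw [h2] at h1
    filter_upwards [h1] with ξ h3
    rw [h3]; rfl
  -- The partial Fourier transform does not enlarge the support in (t, y), so integrating over all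
  -- (t, y) adds nothing.
  have hout : ∀ᵐ q : ℝ × ℝ, q ∉ S → Φ q = 0 := by
    filter_upwards [hcut, slL_HH_ae W, ae_slices (ez_ae h)] with q h1 h2 h3 hq
    have e : slL W q = 0 := by
      apply Lp.ext
      filter_upwards [h2, h3, Lp.coeFn_zero ℂ 2 (volume : Measure ℝ)] with x h4 h5 h6
      rw [h4, h6]
      change ez T w (q.1, x, q.2) = 0
      rw [h5, indicator_of_notMem]
      intro hmem
      exact hq ⟨hmem.1, hmem.2.2⟩
    rw [hΦ]
    simp only
    rw [eLpNorm_congr_ae h1, e, map_zero]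
    have : (fun ξ => ((bracket q.2 ^ a * br ξ ^ s : ℝ) : ℂ) * (0 : H1) ξ) =ᵐ[volume]
        (fun _ => (0 : ℂ)) := by
      filter_upwards [Lp.coeFn_zero ℂ 2 (volume : Measure ℝ)] with ξ h6
      rw [h6]; simp
    rw [eLpNorm_congr_ae this]
    simp
  have hin : ∀ᵐ q : ℝ × ℝ, q ∈ S →
      (ENNReal.ofReal (bracket q.2 ^ a) * lamNorm s (fun x => w (q.1, x, q.2))) ^ 2 = Φ q := by
    filter_upwards [hcut, slL_HH_ae W, ae_slices (ez_ae h)] with q h1 h2 h3 hq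
    have e : slL W q =ᵐ[volume] fun x => w (q.1, x, q.2) := by
      filter_upwards [h2, h3] with x h4 h5
      rw [h4]
      change ez T w (q.1, x, q.2) = _
      rw [h5, indicator_of_mem]
      exact ⟨hq.1, mem_univ _, hq.2⟩
    have hmem : MemLp (fun x => w (q.1, x, q.2)) 2 volume := (memLp_congr_ae e).1 (Lp.memLp _)
    have e2 : hmem.toLp _ = slL W q := by
      apply Lp.ext
      exact hmem.coeFn_toLp.trans e.symm
    rw [lamNorm_eq s hmem, e2, hΦ]
    simp only
    rw [eLpNorm_congr_ae h1]
    congr 1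
    have hb : 0 ≤ bracket q.2 ^ a := Real.rpow_nonneg (bracket_pos _).le _
    have e3 : (fun ξ => ((bracket q.2 ^ a * br ξ ^ s : ℝ) : ℂ) * F1 (slL W q) ξ) =
        ((bracket q.2 ^ a : ℝ) : ℂ) • fun ξ => ((br ξ ^ s : ℝ) : ℂ) * F1 (slL W q) ξ := by
      funext ξ
      simp only [Pi.smul_apply, smul_eq_mul, Complex.ofReal_mul]
      ring
    rw [e3, eLpNorm_const_smul, ← ofReal_norm, Complex.norm_real, Real.norm_of_nonneg hb]
  have hT : ∀ᵐ q ∂((volume.restrict (Ioo 0 T)).prod (volume.restrict (Ioi (0 : ℝ)))),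
      (ENNReal.ofReal (bracket q.2 ^ a) * lamNorm s (fun x => w (q.1, x, q.2))) ^ 2 = Φ q := by
    rw [Measure.prod_restrict]
    exact (ae_restrict_iff' hSm).2 hin
  calc _ = ∫⁻ t in Ioo 0 T, ∫⁻ y in Ioi 0, Φ (t, y) := by
        refine lintegral_congr_ae ?_
        filter_upwards [Measure.ae_ae_of_ae_prod hT] with t ht
        exact lintegral_congr_ae ht
    _ = ∫⁻ q in S, Φ q := by
        rw [← lintegral_prod Φ]
        · rw [Measure.prod_restrict]; rfl
        · rw [Measure.prod_restrict]; exact hΦm.restrict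
    _ = ∫⁻ q, Φ q := by
        rw [← lintegral_indicator hSm]
        refine lintegral_congr_ae ?_
        filter_upwards [hout] with q hq
        by_cases hqS : q ∈ S
        · rw [indicator_of_mem hqS]
        · rw [indicator_of_notMem hqS, hq hqS]

lemma normLam_neg {T s : ℝ} (hs : 0 ≤ s) {w : R3 → ℂ}
    (h : MemLp w 2 (volume.restrict (slab T))) : normLam T 0 (-s) w = ‖J s (ez T w)‖ₑ := by
  rw [normLam_eq 0 (-s) h]
  have e : ‖J s (ez T w)‖ₑ = ‖Fx (J s (ez T w))‖ₑ := by
    rw [← ofReal_norm, ← Fx.norm_map, ofReal_norm]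
  rw [e, J, Fx_mult, Lp.enorm_def]
  refine eLpNorm_congr_ae ?_
  filter_upwards [mulOp_ae (isSym_jsym hs).coef (Fx (ez T w))] with p hp
  rw [hp]; simp [jsym]

/-! ### From weak derivatives to one-parameter families -/

/-- The indicator function of a set as a coefficient. -/
def ind (Ω : Set R3) : R3 → ℂ := Ω.indicator (fun _ => 1)

lemma isCoef_ind {Ω : Set R3} (hΩ : MeasurableSet Ω) : IsCoef (ind Ω) := by
  refine ⟨measurable_const.indicator hΩ, 1, fun p => ?_⟩
  by_cases h : p ∈ Ω <;> simp [ind, h]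

/-- The integral form of `d/ds V_s w = V_s w'`. -/
def HasI (V : ℝ → HH → HH) (w w' : HH) : Prop :=
  Continuous (fun r => V r w') ∧ ∀ s, 0 ≤ s → V s w - w = ∫ r in (0 : ℝ)..s, V r w'

lemma HasI.hasD {V : ℝ → HH → HH} {w w' : HH} (h : HasI V w w') (h0 : V 0 w' = w') :
    HasD V w w' := by
  have h1 : HasDerivAt (fun s => ∫ r in (0 : ℝ)..s, V r w') (V 0 w') 0 :=
    intervalIntegral.integral_hasDerivAt_right (h.1.intervalIntegrable _ _)
      (h.1.stronglyMeasurableAtFilter _ _) h.1.continuousAt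
  have h3 := (hasDerivAt_iff_tendsto_slope_zero.1 h1).mono_left
    (nhdsWithin_mono 0 (fun s hs => ne_of_gt hs : Ioi (0 : ℝ) ⊆ {0}ᶜ))
  rw [h0] at h3
  refine h3.congr' ?_
  filter_upwards [self_mem_nhdsWithin] with s hs
  rw [h.2 s (le_of_lt hs), zero_add, intervalIntegral.integral_same, sub_zero]
  rfl

lemma hasDerivAt_integral_translate {φ : R3 → ℝ} (hφ : ContDiff ℝ ∞ φ) (hc : HasCompactSupport φ)
    (e : R3) (W : HH) (r₀ : ℝ) :
    HasDerivAt (fun r : ℝ => ∫ p, φ (p - r • e) • W p)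
      (∫ p, -(fderiv ℝ φ (p - r₀ • e) e) • W p) r₀ := by
  have hd : Continuous fun p => fderiv ℝ φ p e :=
    (hφ.continuous_fderiv (by simp)).clm_apply continuous_const
  have hdc : HasCompactSupport fun p => fderiv ℝ φ p e := hc.fderiv_apply ℝ e
  obtain ⟨M, hM⟩ := hdc.exists_bound_of_continuous hd
  -- The compact set swept by the support of φ for parameters within 1 of r₀ carries the dominating
  -- function.
  set K : Set R3 := (fun z : R3 × ℝ => z.1 + z.2 • e) '' (tsupport φ ×ˢ Icc (r₀ - 1) (r₀ + 1))
    with hK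
  have hKc : IsCompact K := (IsCompact.prod hc isCompact_Icc).image (by fun_prop)
  have hloc : LocallyIntegrable (fun p => W p) (volume : Measure R3) :=
    (Lp.memLp W).locallyIntegrable (by norm_num)
  have hint : Integrable (fun p => K.indicator (fun p => M * ‖W p‖) p) (volume : Measure R3) := by
    rw [integrable_indicator_iff hKc.measurableSet]
    exact ((hloc.integrableOn_isCompact hKc).norm.const_mul M)
  have hφm : ∀ r : ℝ, Continuous fun p : R3 => φ (p - r • e) := fun r =>
    hφ.continuous.comp (by fun_prop)
  refine (hasDerivAt_integral_of_dominated_loc_of_deriv_le (s := Ioo (r₀ - 1) (r₀ + 1))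
    (bound := fun p => K.indicator (fun p => M * ‖W p‖) p)
    (F' := fun r p => -(fderiv ℝ φ (p - r • e) e) • W p)
    (Ioo_mem_nhds (by linarith) (by linarith)) ?_ ?_ ?_ ?_ hint ?_).2
  · exact Eventually.of_forall fun r => (hφm r).aestronglyMeasurable.smul (Lp.memLp W).1
  · have hcs : HasCompactSupport fun p : R3 => φ (p - r₀ • e) :=
      hc.comp_homeomorph (Homeomorph.subRight (r₀ • e))
    exact hloc.integrable_smul_left_of_hasCompactSupport (hφm r₀) hcs
  · exact ((hd.comp (by fun_prop : Continuous fun p : R3 => p - r₀ • e)).neg).aestronglyMeasurable.smul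
      (Lp.memLp W).1
  · refine Eventually.of_forall fun p r hr => ?_
    by_cases hp : p ∈ K
    · rw [indicator_of_mem hp, norm_smul, norm_neg]
      exact mul_le_mul_of_nonneg_right (hM _) (norm_nonneg _)
    · have : p - r • e ∉ tsupport fun p => fderiv ℝ φ p e := by
        intro hmem
        refine hp ⟨(p - r • e, r), ⟨tsupport_fderiv_apply_subset ℝ e hmem, hr.1.le, hr.2.le⟩, ?_⟩
        simp
      rw [indicator_of_notMem hp, image_eq_zero_of_notMem_tsupport this]
      simp
  · refine Eventually.of_forall fun p r _ => ?_
    have h1 : HasDerivAt (fun r : ℝ => p - r • e) (-e) r := by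
      simpa using ((hasDerivAt_id r).smul_const e).const_sub p
    have h2 : HasFDerivAt φ (fderiv ℝ φ (p - r • e)) (p - r • e) :=
      (hφ.differentiable (by simp) _).hasFDerivAt
    have h3 := (h2.comp_hasDerivAt r h1).smul_const (W p)
    simpa using h3

/-- Tested against φ, the translation falls on φ and moves its support along +e, hence inside Ω. The
weak derivative then identifies the derivative in r of the pairing, and the fundamental theorem of
calculus applies. -/
lemma weak_to_integral {Ω : Set R3} (hΩ : IsOpen Ω) {e : R3}
    (hinv : ∀ p ∈ Ω, ∀ s : ℝ, 0 ≤ s → p + s • e ∈ Ω) {W W' : HH}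
    (hweak : ∀ φ : R3 → ℝ, ContDiff ℝ ∞ φ → HasCompactSupport φ → tsupport φ ⊆ Ω →
      ∫ p, (fderiv ℝ φ p e) • W p = -∫ p, φ p • W' p) {s : ℝ} (hs : 0 ≤ s) :
    mulOp (ind Ω) (tr (s • e) W - W) = ∫ r in (0 : ℝ)..s, mulOp (ind Ω) (tr (r • e) W') := by
  have hcont : Continuous fun r : ℝ => tr (r • e) W' := (continuous_tr W').comp (by fun_prop)
  set Z := tr (s • e) W - W - ∫ r in (0 : ℝ)..s, tr (r • e) W' with hZ
  suffices hz : ∀ᵐ p : R3, p ∈ Ω → Z p = 0 by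
    have h1 : mulOp (ind Ω) Z = 0 := by
      rw [← mulOp_zero Z]
      refine mulOp_congr (isCoef_ind hΩ.measurableSet) (isCoef_const 0) ?_
      filter_upwards [hz] with p hp
      by_cases hpΩ : p ∈ Ω
      · rw [hp hpΩ]; simp
      · simp [ind, hpΩ]
    rw [hZ, map_sub, sub_eq_zero] at h1
    rw [h1]
    exact ((mulOp (ind Ω)).intervalIntegral_comp_comm (hcont.intervalIntegrable _ _)).symm
  refine hΩ.ae_eq_zero_of_integral_contDiff_smul_eq_zero
    (((Lp.memLp Z).locallyIntegrable (by norm_num)).locallyIntegrableOn _) fun φ hφ hc hsub => ?_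
  have hmem : MemLp (fun p => (φ p : ℂ)) 2 (volume : Measure R3) :=
    (Complex.continuous_ofReal.comp hφ.continuous).memLp_of_hasCompactSupport
      (hc.comp_left (g := fun x : ℝ => (x : ℂ)) Complex.ofReal_zero)
  set Φ : HH := hmem.toLp _ with hΦ
  have hin : ∀ w : HH, inner ℂ Φ w = ∫ p, φ p • w p := by
    intro w
    rw [inner_HH]
    refine integral_congr_ae ?_
    filter_upwards [hmem.coeFn_toLp] with p hp
    rw [hp, Complex.conj_ofReal]
    exact Complex.real_smul.symm
  rw [← hin, hZ, inner_sub_right, inner_sub_right]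
  have htr : ∀ (r : ℝ) (w : HH), inner ℂ Φ (tr (r • e) w) = ∫ p, φ (p - r • e) • w p := by
    intro r w
    rw [hin]
    have h1 : ∫ p, φ p • tr (r • e) w p = ∫ p, φ (p + r • e - r • e) • w (p + r • e) := by
      refine integral_congr_ae ?_
      filter_upwards [tr_ae (r • e) w] with p hp
      rw [hp, add_sub_cancel_right]
    rw [h1]
    exact integral_add_right_eq_self (fun p => φ (p - r • e) • w p) (r • e)
  have hd := fun r => hasDerivAt_integral_translate hφ hc e W r
  have hval : ∀ r : ℝ, 0 ≤ r → ∫ p, -(fderiv ℝ φ (p - r • e) e) • W p =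
      inner ℂ Φ (tr (r • e) W') := by
    intro r hr
    have hφr : ContDiff ℝ ∞ fun p : R3 => φ (p - r • e) := hφ.comp (by fun_prop)
    have hcr : HasCompactSupport fun p : R3 => φ (p - r • e) :=
      hc.comp_homeomorph (Homeomorph.subRight (r • e))
    have hsr : tsupport (fun p : R3 => φ (p - r • e)) ⊆ Ω := by
      intro p hp
      have h1 : p - r • e ∈ tsupport φ := by
        have := tsupport_comp_subset_preimage φ (f := fun p : R3 => p - r • e) (by fun_prop)
        exact this hp
      have := hinv _ (hsub h1) r hr
      simpa using this
    have h2 := hweak _ hφr hcr hsr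
    have h3 : ∀ p, fderiv ℝ (fun p : R3 => φ (p - r • e)) p = fderiv ℝ φ (p - r • e) := fun p => by
      simpa only [sub_eq_add_neg] using fderiv_comp_add_right (f := φ) (x := p) (-(r • e))
    simp_rw [h3] at h2
    rw [htr]
    simp_rw [neg_smul]
    rw [integral_neg, h2, neg_neg]
  have hF' : Continuous fun r : ℝ => ∫ p, -(fderiv ℝ φ (p - r • e) e) • W p := by
    have hd' : Continuous fun p => fderiv ℝ φ p e :=
      (hφ.continuous_fderiv (by simp)).clm_apply continuous_const
    have hmem' : MemLp (fun p => (-(fderiv ℝ φ p e : ℝ) : ℂ)) 2 (volume : Measure R3) :=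
      ((Complex.continuous_ofReal.comp hd').memLp_of_hasCompactSupport
        ((hc.fderiv_apply ℝ e).comp_left (g := fun x : ℝ => (x : ℂ)) Complex.ofReal_zero)).neg
    have h1 : ∀ r : ℝ, ∫ p, -(fderiv ℝ φ (p - r • e) e) • W p
        = inner ℂ (tr (-(r • e)) (hmem'.toLp _)) W := by
      intro r
      rw [inner_HH]
      refine integral_congr_ae ?_
      filter_upwards [tr_ae (-(r • e)) (hmem'.toLp _), ae_add (-(r • e)) hmem'.coeFn_toLp]
        with p h1 h2
      rw [h1, h2, ← sub_eq_add_neg, map_neg, Complex.conj_ofReal, ← Complex.ofReal_neg]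
      exact Complex.real_smul
    simp_rw [h1]
    exact Continuous.inner ((continuous_tr _).comp (by fun_prop)) continuous_const
  have hFTC := intervalIntegral.integral_eq_sub_of_hasDerivAt (a := 0) (b := s)
    (fun r _ => hd r) (hF'.intervalIntegrable _ _)
  have hcongr : ∫ r in (0 : ℝ)..s, ∫ p, -(fderiv ℝ φ (p - r • e) e) • W p =
      ∫ r in (0 : ℝ)..s, inner ℂ Φ (tr (r • e) W') := by
    refine intervalIntegral.integral_congr fun r hr => ?_
    rw [uIcc_of_le hs] at hr
    exact hval r hr.1
  have hcomm : ∫ r in (0 : ℝ)..s, inner ℂ Φ (tr (r • e) W') =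
      inner ℂ Φ (∫ r in (0 : ℝ)..s, tr (r • e) W') :=
    (innerSL ℂ Φ).intervalIntegral_comp_comm (hcont.intervalIntegrable _ _)
  rw [← hcomm, ← hcongr, hFTC, htr, hin]
  simp

lemma weak_unique {Ω : Set R3} (hΩ : IsOpen Ω) {e : R3} {w a b : R3 → ℂ}
    (ha : HasWeakDeriv Ω e w a) (hb : HasWeakDeriv Ω e w b) : a =ᵐ[volume.restrict Ω] b := by
  refine (ae_restrict_iff' hΩ.measurableSet).2 ?_
  have h := hΩ.ae_eq_zero_of_integral_contDiff_smul_eq_zero (f := fun p => a p - b p)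
    (ha.2.1.sub hb.2.1) fun φ hφ hc hsub => ?_
  · filter_upwards [h] with p hp hpΩ using sub_eq_zero.1 (hp hpΩ)
  · have h1 : ∫ p in Ω, φ p • a p = ∫ p in Ω, φ p • b p := by
      have := (ha.2.2 φ hφ hc hsub).symm.trans (hb.2.2 φ hφ hc hsub)
      exact neg_injective this
    have hi : ∀ {a : R3 → ℂ}, LocallyIntegrableOn a Ω volume →
        IntegrableOn (fun p => φ p • a p) Ω volume := by
      intro a ha
      have h2 : IntegrableOn a (tsupport φ) volume := ha.integrableOn_compact_subset hsub hc
      have h3 : IntegrableOn (fun p => φ p • a p) (tsupport φ) volume :=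
        h2.continuousOn_smul hφ.continuous.continuousOn hc
      have h4 : Integrable (fun p => φ p • a p) volume := by
        rw [← integrableOn_iff_integrable_of_support_subset (s := tsupport φ)]
        · exact h3
        · intro p hp
          by_contra hne
          exact hp (by simp [image_eq_zero_of_notMem_tsupport hne])
      exact h4.integrableOn
    have h5 : ∫ p, φ p • (a p - b p) = ∫ p in Ω, φ p • (a p - b p) := by
      rw [setIntegral_eq_integral_of_forall_compl_eq_zero]
      intro p hp
      rw [image_eq_zero_of_notMem_tsupport fun h => hp (hsub h), zero_smul]
    rw [h5]
    simp_rw [smul_sub]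
    rw [integral_sub (hi ha.2.1) (hi hb.2.1), h1, sub_self]

lemma integral_smul_ez {T : ℝ} {w : R3 → ℂ} (h : MemLp w 2 (volume.restrict (slab T)))
    (φ : R3 → ℝ) : ∫ p, φ p • ez T w p = ∫ p in slab T, φ p • w p := by
  rw [← integral_indicator (measurableSet_slab T)]
  refine integral_congr_ae ?_
  filter_upwards [ez_ae h] with p hp
  rw [hp]
  by_cases hm : p ∈ slab T <;> simp [hm]

lemma mulOp_ind_tr_ez {Ω : Set R3} (hΩ : MeasurableSet Ω) {T : ℝ} {e : R3} {w : R3 → ℂ}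
    (hw : MemLp w 2 (volume.restrict (slab T))) {b : R3 → ℂ} (hb : IsCoef b)
    (h : ∀ p : R3, p + e ∈ slab T → ind Ω p = b p) :
    mulOp (ind Ω) (tr e (ez T w)) = mulOp b (tr e (ez T w)) := by
  refine mulOp_congr (isCoef_ind hΩ) hb ?_
  filter_upwards [tr_ae e (ez T w), ae_add e (ez_ae hw)] with p h1 h2
  by_cases hp : p + e ∈ slab T
  · rw [h p hp]
  · rw [h1, h2, indicator_of_notMem hp]; simp

lemma isUp_ez {T : ℝ} {w : R3 → ℂ} (hw : MemLp w 2 (volume.restrict (slab T))) :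
    IsUp (ez T w) := by
  unfold IsUp
  conv_rhs => rw [← mulOp_one (ez T w)]
  refine mulOp_congr isCoef_up (isCoef_const 1) ?_
  filter_upwards [ez_ae hw] with p h2
  by_cases hp : p ∈ slab T
  · simp [up, show 0 < p.2.2 from hp.2.2]
  · rw [h2, indicator_of_notMem hp]; simp

lemma ez_congr {T : ℝ} {w w' : R3 → ℂ} (hw : MemLp w 2 (volume.restrict (slab T)))
    (h : w =ᵐ[volume.restrict (slab T)] w') : ez T w = ez T w' := by
  apply Lp.ext
  have hw' := (memLp_congr_ae h).1 hw
  filter_upwards [ez_ae hw, ez_ae hw', (ae_restrict_iff' (measurableSet_slab T)).1 h] with p h1 h2 h3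
  rw [h1, h2]
  by_cases hp : p ∈ slab T
  · rw [indicator_of_mem hp, indicator_of_mem hp, h3 hp]
  · rw [indicator_of_notMem hp, indicator_of_notMem hp]

/-- The set Ω where test functions may live decides the boundary condition: enlarging the slab
across a face expresses a zero trace there. On translates of functions supported in the slab its
indicator is replaced by b, which is 1 or the cutoff to y > 0. -/
lemma hasI_of_weak {Ω : Set R3} (hΩ : IsOpen Ω) {T : ℝ} {e : R3}
    (hinv : ∀ p ∈ Ω, ∀ s : ℝ, 0 ≤ s → p + s • e ∈ Ω) {w w' : R3 → ℂ}
    (hw : MemLp w 2 (volume.restrict (slab T))) (hw' : MemLp w' 2 (volume.restrict (slab T)))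
    (hweak : ∀ φ : R3 → ℝ, ContDiff ℝ ∞ φ → HasCompactSupport φ → tsupport φ ⊆ Ω →
      ∫ p in slab T, (fderiv ℝ φ p e) • w p = -∫ p in slab T, φ p • w' p)
    {b : R3 → ℂ} (hb : IsCoef b)
    (hbΩ : ∀ r : ℝ, 0 ≤ r → ∀ p : R3, p + r • e ∈ slab T → ind Ω p = b p)
    (hb1 : ∀ p ∈ slab T, b p = 1) :
    HasI (fun r w => mulOp b (tr (r • e) w)) (ez T w) (ez T w') := by
  refine ⟨(mulOp b).continuous.comp ((continuous_tr _).comp (by fun_prop)), fun s hs => ?_⟩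
  have h1 := weak_to_integral hΩ hinv (W := ez T w) (W' := ez T w') (fun φ h1 h2 h3 => by
    rw [integral_smul_ez hw, integral_smul_ez hw']; exact hweak φ h1 h2 h3) hs
  have h0 : mulOp (ind Ω) (ez T w) = ez T w := by
    conv_rhs => rw [← mulOp_one (ez T w)]
    refine mulOp_congr (isCoef_ind hΩ.measurableSet) (isCoef_const 1) ?_
    filter_upwards [ez_ae hw] with p h2
    by_cases hp : p ∈ slab T
    · rw [hbΩ 0 le_rfl p (by simpa using hp), hb1 p hp]
    · rw [h2, indicator_of_notMem hp]; simp
  rw [map_sub, h0, mulOp_ind_tr_ez hΩ.measurableSet hw hb (hbΩ s hs)] at h1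
  rw [h1]
  refine intervalIntegral.integral_congr fun r hr => ?_
  rw [uIcc_of_le hs] at hr
  exact mulOp_ind_tr_ez hΩ.measurableSet hw' hb (hbΩ r hr.1)

lemma HasWeakDeriv.hasI_X {T : ℝ} {w w' : R3 → ℂ}
    (hw : MemLp w 2 (volume.restrict (slab T))) (hw' : MemLp w' 2 (volume.restrict (slab T)))
    (h : HasWeakDeriv (slab T) (0, 1, 0) w w') : HasI trX (ez T w) (ez T w') := by
  have := hasI_of_weak (isOpen_slab T) (e := (0, 1, 0)) (fun p hp s _ => by
    simpa [slab] using hp) hw hw' h.2.2 (isCoef_const 1)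
    (fun r _ p hp => by
      have hp : p ∈ slab T := by simpa [slab] using hp
      simp [ind, hp]) (fun _ _ => rfl)
  simpa [HasI, mulOp_one, trX] using this

lemma HasWeakDeriv.hasI_Y {T : ℝ} {w w' : R3 → ℂ}
    (hw : MemLp w 2 (volume.restrict (slab T))) (hw' : MemLp w' 2 (volume.restrict (slab T)))
    (h : HasWeakDeriv (slab T) (0, 0, 1) w w') : HasI shY (ez T w) (ez T w') := by
  have := hasI_of_weak (isOpen_slab T) (e := (0, 0, 1)) (fun p hp s hs => by
      have h1 : 0 < p.2.2 := hp.2.2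
      have : 0 < p.2.2 + s := by linarith
      simpa [slab, this] using hp.1) hw hw' h.2.2 isCoef_up
    (fun r _ p hp => by
      have hp1 : p.1 ∈ Ioo 0 T := by simpa using hp.1
      by_cases hy : 0 < p.2.2
      · have : p ∈ slab T := ⟨hp1, mem_univ _, hy⟩
        simp [ind, up, hy, this]
      · have : p ∉ slab T := fun h => hy h.2.2
        simp [ind, up, hy, this]) (fun p hp => by simp [up, show 0 < p.2.2 from hp.2.2])
  simpa [HasI, shY] using this

lemma HasZeroTrace.hasI_T {T : ℝ} {w : R3 → ℂ}
    (h : HasZeroTrace (slab T) (univ ×ˢ (univ ×ˢ Ioi 0)) (1, 0, 0) w) :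
    ∃ w' : R3 → ℂ, MemLp w' 2 (volume.restrict (slab T)) ∧
      HasWeakDeriv (slab T) (1, 0, 0) w w' ∧ HasI trT (ez T w) (ez T w') := by
  obtain ⟨hw, w', hw', hwd, hweak⟩ := h
  refine ⟨w', hw', hwd, ?_⟩
  have := hasI_of_weak (Ω := univ ×ˢ (univ ×ˢ Ioi 0))
    (isOpen_univ.prod (isOpen_univ.prod isOpen_Ioi)) (e := (1, 0, 0))
    (fun p hp s hs => by simpa using hp) hw hw' hweak (isCoef_const 1)
    (fun r _ p hp => by
      have : 0 < p.2.2 := by simpa using hp.2.2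
      simp [ind, this]) (fun _ _ => rfl)
  simpa [HasI, mulOp_one, trT] using this

lemma HasZeroTrace.hasI_Y {T : ℝ} {w : R3 → ℂ}
    (h : HasZeroTrace (slab T) (Ioo 0 T ×ˢ (univ ×ˢ univ)) (0, 0, 1) w) :
    ∃ w' : R3 → ℂ, MemLp w' 2 (volume.restrict (slab T)) ∧
      HasWeakDeriv (slab T) (0, 0, 1) w w' ∧ HasI trY (ez T w) (ez T w') := by
  obtain ⟨hw, w', hw', hwd, hweak⟩ := h
  refine ⟨w', hw', hwd, ?_⟩
  have := hasI_of_weak (Ω := Ioo 0 T ×ˢ (univ ×ˢ univ))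
    (isOpen_Ioo.prod (isOpen_univ.prod isOpen_univ)) (e := (0, 0, 1))
    (fun p hp s hs => by simpa using hp) hw hw' hweak (isCoef_const 1)
    (fun r _ p hp => by
      have : p.1 ∈ Ioo 0 T := by simpa using hp.1
      simp [ind, mem_prod, this.1, this.2]) (fun _ _ => rfl)
  simpa [HasI, mulOp_one, trY] using this

/-- Commutation of derivatives. -/
lemma HasI.deriv_comm {e : R3} {f a b c : HH} (hb : HasI (fun r => tr (r • e)) f b)
    (ha : HasD shY f a) (hc : HasD shY b c) (he : e.2.2 = 0) :
    HasI (fun r => tr (r • e)) a c := by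
  have hcont : ∀ w : HH, Continuous fun r : ℝ => tr (r • e) w := fun w =>
    (continuous_tr w).comp (by fun_prop)
  refine ⟨hcont c, fun s hs => ?_⟩
  -- The difference quotients in y are bounded operators commuting with translations in t and x, so
  -- they pass under the integral; the limit h → 0 is uniform in the translation parameter because
  -- translations are isometric.
  set D : ℝ → HH →L[ℂ] HH := fun h =>
    ((h⁻¹ : ℝ) : ℂ) • (mulOp up ∘L tr (0, 0, h) - ContinuousLinearMap.id ℂ HH) with hD
  have hDa : ∀ h w, D h w = ((h⁻¹ : ℝ) : ℂ) • (shY h w - w) := fun h w => rfl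
  have hcomm : ∀ (h r : ℝ) (w : HH), D h (tr (r • e) w) = tr (r • e) (D h w) := by
    intro h r w
    rw [hDa, hDa, map_smul, map_sub, shY, shY, tr_mulOp isCoef_up, tr_comm]
    have : (fun p => up (p + r • e)) = up := by
      funext p; simp [up, he]
    rw [this]
  have h1 : ∀ h, tr (s • e) (D h f) - D h f = ∫ r in (0 : ℝ)..s, tr (r • e) (D h b) := by
    intro h
    rw [← hcomm, ← map_sub, hb.2 s hs,
      ← (D h).intervalIntegral_comp_comm ((hcont b).intervalIntegrable _ _)]
    simp_rw [hcomm]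
  have h2 : Tendsto (fun h => tr (s • e) (D h f) - D h f) (𝓝[>] 0) (𝓝 (tr (s • e) a - a)) :=
    (((tr (s • e)).continuous.tendsto a).comp ha).sub ha
  refine tendsto_nhds_unique h2 ?_
  simp_rw [h1]
  rw [tendsto_iff_norm_sub_tendsto_zero]
  refine squeeze_zero (fun _ => norm_nonneg _) (g := fun h => ‖D h b - c‖ * |s - 0|) (fun h => ?_) ?_
  · rw [← intervalIntegral.integral_sub ((hcont _).intervalIntegrable _ _)
      ((hcont _).intervalIntegrable _ _)]
    refine intervalIntegral.norm_integral_le_of_norm_le_const fun r _ => ?_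
    rw [← map_sub, norm_tr]
  · have := (tendsto_iff_norm_sub_tendsto_zero.1 hc).mul_const |s - 0|
    rw [zero_mul] at this
    exact this

/-! ### Commutators of Bessel potentials with Lipschitz functions -/

/-- Fubini for matrix coefficients on the Fourier side; the later commutator bounds are bounds of
matrix coefficients, so no operator-valued integral is needed. -/
lemma inner_mult_integral {n : ℝ → ℝ → ℂ} (hn : Measurable (Function.uncurry n)) {b : ℝ → ℝ}
    (hb : IntegrableOn b (Ioi 0)) (hle : ∀ r ∈ Ioi (0 : ℝ), ∀ ξ, ‖n r ξ‖ ≤ b r) {M : ℝ → ℂ}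
    (hMs : IsSym M) (hM : ∀ ξ, M ξ = ∫ r in Ioi (0 : ℝ), n r ξ) (w q : HH) :
    IntegrableOn (fun r => inner ℂ (mult (n r) w) q) (Ioi 0) ∧
    inner ℂ (mult M w) q = ∫ r in Ioi (0 : ℝ), inner ℂ (mult (n r) w) q := by
  have hsym : ∀ r ∈ Ioi (0 : ℝ), IsSym (n r) := fun r hr =>
    ⟨hn.comp (by fun_prop : Measurable fun ξ : ℝ => (r, ξ)), b r, hle r hr⟩
  set g : R3 → ℂ := fun p => (starRingEnd ℂ) (Fx w p) * Fx q p with hg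
  have hgi : Integrable g (volume : Measure R3) := by
    have := MemLp.integrable_mul (Lp.memLp (Fx w)).star (Lp.memLp (Fx q))
    exact this
  set F : ℝ × R3 → ℂ := fun z => (starRingEnd ℂ) (n z.1 z.2.2.1) * g z.2 with hF
  have hint : Integrable F ((volume.restrict (Ioi (0 : ℝ))).prod (volume : Measure R3)) := by
    have h1 : Integrable (fun z : ℝ × R3 => b z.1 * ‖g z.2‖)
      ((volume.restrict (Ioi (0 : ℝ))).prod (volume : Measure R3)) := Integrable.mul_prod hb hgi.norm
    refine h1.mono ?_ ?_
    · refine AEStronglyMeasurable.mul ?_ hgi.1.comp_snd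
      exact (Complex.continuous_conj.measurable.comp
        (hn.comp (by fun_prop : Measurable fun z : ℝ × R3 => (z.1, z.2.2.1)))).aestronglyMeasurable
    · have h2 : ∀ᵐ z ∂((volume.restrict (Ioi (0 : ℝ))).prod (volume : Measure R3)),
          z.1 ∈ Ioi (0 : ℝ) := by
        have : ∀ᵐ r ∂(volume.restrict (Ioi (0 : ℝ))), r ∈ Ioi (0 : ℝ) :=
          ae_restrict_mem measurableSet_Ioi
        exact Measure.quasiMeasurePreserving_fst.ae this
      filter_upwards [h2] with z hz
      rw [hF, norm_mul, RCLike.norm_conj, norm_mul (b z.1), norm_norm]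
      exact mul_le_mul_of_nonneg_right ((hle _ hz _).trans (le_abs_self _)) (norm_nonneg _)
  have h3 : ∀ r ∈ Ioi (0 : ℝ), inner ℂ (mult (n r) w) q = ∫ p, F (r, p) := by
    intro r hr
    rw [← Fx.inner_map_map, Fx_mult, inner_HH]
    refine integral_congr_ae ?_
    filter_upwards [mulOp_ae (hsym r hr).coef (Fx w)] with p hp
    rw [hp, map_mul, hF, hg]; ring
  refine ⟨hint.integral_prod_left.congr ?_, ?_⟩
  · filter_upwards [ae_restrict_mem measurableSet_Ioi] with r hr
    exact (h3 r hr).symm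
  · rw [setIntegral_congr_fun measurableSet_Ioi h3]
    rw [integral_integral_swap (f := fun r p => F (r, p)) hint, ← Fx.inner_map_map, Fx_mult,
      inner_HH]
    refine integral_congr_ae ?_
    filter_upwards [mulOp_ae hMs.coef (Fx w)] with p hp
    rw [hp, map_mul, hM, hF]
    simp only
    rw [integral_mul_const, ← integral_conj, hg]
    ring

lemma integrableOn_rpow_mul {α β : ℝ} (hα : α < 1) (hαβ : 1 < α + β) :
    IntegrableOn (fun r : ℝ => r ^ (-α) * (1 + r) ^ (-β)) (Ioi 0) := by
  have hm : AEStronglyMeasurable (fun r : ℝ => r ^ (-α) * (1 + r) ^ (-β)) volume :=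
    ((measurable_id.pow_const _).mul ((measurable_id.const_add 1).pow_const _)).aestronglyMeasurable
  rw [← Ioc_union_Ioi_eq_Ioi (zero_le_one' ℝ)]
  refine IntegrableOn.union ?_ ?_
  · have h1 : IntegrableOn (fun r : ℝ => r ^ (-α)) (Ioc 0 1) := by
      rw [← intervalIntegrable_iff_integrableOn_Ioc_of_le zero_le_one]
      exact intervalIntegral.intervalIntegrable_rpow' (by linarith)
    refine h1.mono' hm.restrict ?_
    filter_upwards [ae_restrict_mem measurableSet_Ioc] with r hr
    have h2 : (1 + r) ^ (-β) ≤ 1 :=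
      Real.rpow_le_one_of_one_le_of_nonpos (by linarith [hr.1]) (by linarith)
    have h3 : 0 ≤ r ^ (-α) := Real.rpow_nonneg hr.1.le _
    have h4 : 0 ≤ (1 + r) ^ (-β) := Real.rpow_nonneg (by linarith [hr.1]) _
    rw [Real.norm_of_nonneg (mul_nonneg h3 h4)]
    nlinarith
  · have h1 : IntegrableOn (fun r : ℝ => r ^ (-(α + β))) (Ioi 1) :=
      integrableOn_Ioi_rpow_of_lt (by linarith) one_pos
    refine h1.mono' hm.restrict ?_
    filter_upwards [ae_restrict_mem measurableSet_Ioi] with r hr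
    have hr : (1 : ℝ) < r := hr
    have h3 : 0 ≤ r ^ (-α) := Real.rpow_nonneg (by linarith) _
    have h4 : 0 ≤ (1 + r) ^ (-β) := Real.rpow_nonneg (by linarith) _
    rw [Real.norm_of_nonneg (mul_nonneg h3 h4), neg_add, Real.rpow_add (by linarith)]
    exact mul_le_mul_of_nonneg_left
      (Real.rpow_le_rpow_of_nonpos (by linarith) (by linarith) (by linarith)) h3

/-- The symbol of the resolvent `(λ - ∂_x²)⁻¹`. -/
def rsym (l ξ : ℝ) : ℂ := ((l + ‖dsym ξ‖ ^ 2 : ℝ) : ℂ)⁻¹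

lemma norm_rsym {l : ℝ} (hl : 0 < l) (ξ : ℝ) : ‖rsym l ξ‖ = (l + ‖dsym ξ‖ ^ 2)⁻¹ := by
  rw [rsym, norm_inv, Complex.norm_real, Real.norm_of_nonneg (by positivity)]

lemma norm_rsym_le {l : ℝ} (hl : 0 < l) (ξ : ℝ) : ‖rsym l ξ‖ ≤ l⁻¹ := by
  rw [norm_rsym hl]
  gcongr
  nlinarith [sq_nonneg ‖dsym ξ‖]

lemma norm_dsym_rsym_le {l : ℝ} (hl : 0 < l) (ξ : ℝ) : ‖dsym ξ * rsym l ξ‖ ≤ (√l)⁻¹ := by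
  have h := Real.sqrt_pos.2 hl
  rw [norm_mul, norm_rsym hl, ← div_eq_mul_inv, div_le_iff₀ (by positivity), inv_mul_eq_div,
    le_div_iff₀ h]
  nlinarith [Real.sq_sqrt hl.le, sq_nonneg (‖dsym ξ‖ - √l), norm_nonneg (dsym ξ)]

lemma norm_dsym_dsym_rsym_le {l : ℝ} (hl : 0 < l) (ξ : ℝ) :
    ‖dsym ξ * (dsym ξ * rsym l ξ)‖ ≤ 1 := by
  rw [norm_mul, norm_mul, norm_rsym hl, ← mul_assoc, ← div_eq_mul_inv,
    div_le_iff₀ (by positivity)]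
  nlinarith

lemma measurable_rsym : Measurable (Function.uncurry rsym) := by
  unfold rsym dsym
  simp only [Function.uncurry_def]
  fun_prop

lemma measurable_rsym' (l : ℝ) : Measurable (rsym l) :=
  measurable_rsym.comp (by fun_prop : Measurable fun ξ : ℝ => (l, ξ))

lemma isSym_rsym {l : ℝ} (hl : 0 < l) : IsSym (rsym l) :=
  ⟨measurable_rsym' l, _, norm_rsym_le hl⟩

lemma isSym_dsym_rsym {l : ℝ} (hl : 0 < l) : IsSym (fun ξ => dsym ξ * rsym l ξ) :=
  ⟨continuous_dsym.measurable.mul (measurable_rsym' l), _, norm_dsym_rsym_le hl⟩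

lemma isSym_dsym_dsym_rsym {l : ℝ} (hl : 0 < l) :
    IsSym (fun ξ => dsym ξ * (dsym ξ * rsym l ξ)) :=
  ⟨continuous_dsym.measurable.mul (continuous_dsym.measurable.mul (measurable_rsym' l)), _,
    norm_dsym_dsym_rsym_le hl⟩

lemma norm_le_of_norm_inner_self_le {w : HH} {C : ℝ} (hC : 0 ≤ C)
    (h : ‖(inner ℂ w w : ℂ)‖ ≤ C * ‖w‖) : ‖w‖ ≤ C := by
  rw [inner_self_eq_norm_sq_to_K, norm_pow, RCLike.norm_ofReal, abs_norm] at h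
  rcases (norm_nonneg w).eq_or_lt with h0 | h0
  · rw [← h0]; exact hC
  · nlinarith

lemma resolvent_eq {l : ℝ} (hl : 0 < l) (w : HH) :
    w = (l : ℂ) • mult (rsym l) w - mult (fun ξ => dsym ξ * (dsym ξ * rsym l ξ)) w := by
  conv_lhs => rw [← mult_one w]
  rw [← mult_const_mul (isSym_rsym hl), ← mult_sub ((isSym_const _).mul (isSym_rsym hl))
    (isSym_dsym_dsym_rsym hl)]
  congr 2
  funext ξ
  have h1 : (dsym ξ) * dsym ξ = -((‖dsym ξ‖ ^ 2 : ℝ) : ℂ) := by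
    have := Complex.mul_conj (dsym ξ)
    rw [conj_dsym, Complex.normSq_eq_norm_sq] at this
    rw [← this]; ring
  have h2 : ((l + ‖dsym ξ‖ ^ 2 : ℝ) : ℂ) ≠ 0 := by
    rw [Complex.ofReal_ne_zero]; positivity
  rw [← mul_assoc, h1, ← sub_mul, rsym]
  rw [sub_neg_eq_add, ← Complex.ofReal_add, mul_inv_cancel₀ h2]

/-- The weight in the representation of `Λ^{-s}` by resolvents. -/
def wt (s r : ℝ) : ℝ := (∫ r in Ioi (0 : ℝ), r ^ (-(s / 2)) * (1 + r) ^ (-1 : ℝ))⁻¹ * r ^ (-(s / 2))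

lemma wt_integral_pos {s : ℝ} (hs : 0 < s) (hs2 : s < 2) :
    0 < ∫ r in Ioi (0 : ℝ), r ^ (-(s / 2)) * (1 + r) ^ (-1 : ℝ) := by
  rw [setIntegral_pos_iff_support_of_nonneg_ae]
  · have : Ioi (0 : ℝ) ⊆ Function.support fun r : ℝ => r ^ (-(s / 2)) * (1 + r) ^ (-1 : ℝ) := by
      intro r hr
      have hr : (0 : ℝ) < r := hr
      exact (by positivity : r ^ (-(s / 2)) * (1 + r) ^ (-1 : ℝ) ≠ 0)
    rw [inter_eq_self_of_subset_right this]
    simp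
  · filter_upwards [ae_restrict_mem measurableSet_Ioi] with r hr
    have hr : (0 : ℝ) < r := hr
    simp only [Pi.zero_apply]; positivity
  · exact integrableOn_rpow_mul (by linarith) (by linarith)

lemma wt_nonneg {s : ℝ} (hs : 0 < s) (hs2 : s < 2) {r : ℝ} (hr : 0 < r) : 0 ≤ wt s r :=
  mul_nonneg (inv_nonneg.2 (wt_integral_pos hs hs2).le) (Real.rpow_nonneg hr.le _)

lemma integrableOn_wt {s β : ℝ} (hs2 : s < 2) (h : 1 < s / 2 + β) :
    IntegrableOn (fun r => wt s r * (1 + r) ^ (-β)) (Ioi 0) := by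
  have := (integrableOn_rpow_mul (α := s / 2) (by linarith) h).const_mul
    (∫ r in Ioi (0 : ℝ), r ^ (-(s / 2)) * (1 + r) ^ (-1 : ℝ))⁻¹
  refine this.congr (Eventually.of_forall fun r => ?_)
  simp only [wt, mul_assoc]

/-- The substitution r ↦ ⟨ξ⟩²r extracts the factor ⟨ξ⟩^{-s} and leaves the integral that normalizes
`wt`. Convergence at 0 and at ∞ is the condition 0 < s < 2. -/
lemma jsym_eq_integral {s : ℝ} (hs : 0 < s) (hs2 : s < 2) (ξ : ℝ) :
    jsym s ξ = ∫ r in Ioi (0 : ℝ), (wt s r : ℂ) * rsym (1 + r) ξ := by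
  set B := br ξ ^ 2 with hB
  have hBpos : 0 < B := pow_pos (br_pos ξ) 2
  have h1 : ∀ r ∈ Ioi (0 : ℝ), (wt s r : ℂ) * rsym (1 + r) ξ
      = ((wt s r * (B + r)⁻¹ : ℝ) : ℂ) := by
    intro r hr
    rw [rsym, hB, br_sq]; push_cast; congr 2; ring
  rw [setIntegral_congr_fun measurableSet_Ioi h1, integral_complex_ofReal, jsym]
  congr 1
  have h2 := integral_comp_mul_left_Ioi (fun r => wt s r * (B + r)⁻¹) 0 hBpos
  rw [mul_zero, smul_eq_mul] at h2
  have h3 : ∫ r in Ioi (0 : ℝ), wt s r * (B + r)⁻¹ =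
      B * ∫ r in Ioi (0 : ℝ), wt s (B * r) * (B + B * r)⁻¹ := by
    rw [h2, ← mul_assoc, mul_inv_cancel₀ hBpos.ne', one_mul]
  rw [h3, ← integral_const_mul]
  have h4 : ∀ r ∈ Ioi (0 : ℝ), B * (wt s (B * r) * (B + B * r)⁻¹) =
      B ^ (-(s / 2)) * (∫ r in Ioi (0 : ℝ), r ^ (-(s / 2)) * (1 + r) ^ (-1 : ℝ))⁻¹ *
        (r ^ (-(s / 2)) * (1 + r) ^ (-1 : ℝ)) := by
    intro r hr
    have hr : (0 : ℝ) < r := hr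
    rw [wt, Real.mul_rpow hBpos.le hr.le, Real.rpow_neg_one]
    field_simp
  rw [setIntegral_congr_fun measurableSet_Ioi h4, integral_const_mul, mul_assoc,
    inv_mul_cancel₀ (wt_integral_pos hs hs2).ne', mul_one, hB, ← Real.rpow_natCast,
    ← Real.rpow_mul (br_pos ξ).le]
  congr 1; push_cast; ring

section Lipschitz

variable {a L : R3 → ℝ} (ha : IsCoef (fun p => (a p : ℂ))) (hL : IsCoef (fun p => (L p : ℂ)))
  (hlip : ∀ s > 0, ∀ p : R3, |a (p - (0, s, 0)) - a p| ≤ s * L p)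

include ha hL hlip

/-- With Q = (l − ∂_x²)⁻¹ one has [Q, a] = Q[∂_x², a]Q, and [∂_x², a] = ∂_x a_x + a_x ∂_x. Acting on
f_x this costs two derivatives against four orders of smoothing, one of the derivatives falling on
f, whence l⁻¹. The modulus L is independent of x, so it commutes with Q and stays on h. -/
lemma resolvent_commutator {ℓ : ℝ × ℝ → ℂ} (hLℓ : ∀ p, (L p : ℂ) = ℓ (p.1, p.2.2)) {l : ℝ}
    (hl : 0 < l) {f fx : HH} (hf : HasD trX f fx) (h : HH) :
    ‖(inner ℂ (mult (rsym l) fx) (mulOp (fun p => (a p : ℂ)) h) -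
      inner ℂ (mult (rsym l) (mulOp (fun p => (a p : ℂ)) fx)) h : ℂ)‖
      ≤ 2 * l⁻¹ * (‖f‖ * ‖mulOp (fun p => (L p : ℂ)) h‖) := by
  set A := mulOp (fun p => (a p : ℂ))
  set M := mulOp (fun p => (L p : ℂ))
  have h0 := isSym_rsym hl
  have h1 := isSym_dsym_rsym hl
  have h2 := isSym_dsym_dsym_rsym hl
  have e1 : inner ℂ (mult (rsym l) (A fx)) h = inner ℂ fx (A (mult (rsym l) h)) := by
    have : (fun ξ => (starRingEnd ℂ) (rsym l ξ)) = rsym l := by funext ξ; simp [rsym]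
    rw [inner_mult_left h0, inner_mulOp_real ha, this]
  have hm : mult (rsym l) fx = mult (fun ξ => dsym ξ * rsym l ξ) f := hf.mult_eq h0 h1
  have hm1 := hasD_mult h1 h2 f
  have hm2 := hf.multX h2
  have hk := hasD_mult h0 h1 h
  have hk1 := hasD_mult h1 h2 h
  have b1 := HasD.lipX ha hL hlip hm2 hk
  have b2 := HasD.lipX ha hL hlip hm1 hk1
  have ef := resolvent_eq hl fx
  have eh := resolvent_eq hl h
  -- Substituting w = lQw − ∂_x²Qw for f_x and for h cancels the terms with l. Adding and
  -- subtracting one mixed term exhibits two integrations by parts in x, the only place where the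
  -- Lipschitz bound enters.
  have e2 : inner ℂ (mult (rsym l) fx) (A h) - inner ℂ fx (A (mult (rsym l) h)) =
      (inner ℂ (mult (fun ξ => dsym ξ * (dsym ξ * rsym l ξ)) fx) (A (mult (rsym l) h)) +
        inner ℂ (mult (fun ξ => dsym ξ * (dsym ξ * rsym l ξ)) f)
          (A (mult (fun ξ => dsym ξ * rsym l ξ) h))) -
      (inner ℂ (mult (fun ξ => dsym ξ * (dsym ξ * rsym l ξ)) f)
          (A (mult (fun ξ => dsym ξ * rsym l ξ) h)) +
        inner ℂ (mult (fun ξ => dsym ξ * rsym l ξ) f)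
          (A (mult (fun ξ => dsym ξ * (dsym ξ * rsym l ξ)) h))) := by
    rw [← hm]
    nth_rw 2 [ef]
    nth_rw 1 [eh]
    rw [map_sub, map_smul, inner_sub_left, inner_sub_right, inner_smul_left, inner_smul_right,
      Complex.conj_ofReal]
    ring
  have c1 : ‖M (mult (rsym l) h)‖ ≤ l⁻¹ * ‖M h‖ := by
    rw [← mult_mulOp hL hLℓ h0]
    exact norm_mult_le h0 _ (norm_rsym_le hl)
  have c2 : ‖M (mult (fun ξ => dsym ξ * rsym l ξ) h)‖ ≤ (√l)⁻¹ * ‖M h‖ := by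
    rw [← mult_mulOp hL hLℓ h1]
    exact norm_mult_le h1 _ (norm_dsym_rsym_le hl)
  have c3 := norm_mult_le h1 f (norm_dsym_rsym_le hl)
  have c4 := norm_mult_le h2 f (norm_dsym_dsym_rsym_le hl)
  have hsq : (√l)⁻¹ * (√l)⁻¹ = l⁻¹ := by rw [← mul_inv, Real.mul_self_sqrt hl.le]
  rw [e1, e2]
  refine (norm_sub_le _ _).trans ((add_le_add b1 b2).trans ?_)
  calc _ ≤ 1 * ‖f‖ * (l⁻¹ * ‖M h‖) + (√l)⁻¹ * ‖f‖ * ((√l)⁻¹ * ‖M h‖) := by gcongr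
    _ = (l⁻¹ + (√l)⁻¹ * (√l)⁻¹) * (‖f‖ * ‖M h‖) := by ring
    _ = _ := by rw [hsq]; ring

/-- The resolvent bound 2(1 + r)⁻¹ is integrated against `wt`, and the normalization makes that
integral 1. The commutator absorbs the whole derivative of f_x, and the modulus L is kept as a
weight. -/
lemma commutator_J {ℓ : ℝ × ℝ → ℂ} (hLℓ : ∀ p, (L p : ℂ) = ℓ (p.1, p.2.2)) {s : ℝ}
    (hs : 0 < s) (hs2 : s < 2) {f fx : HH} (hf : HasD trX f fx) (h : HH) :
    ‖(inner ℂ (J s fx) (mulOp (fun p => (a p : ℂ)) h) -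
      inner ℂ fx (mulOp (fun p => (a p : ℂ)) (J s h)) : ℂ)‖
      ≤ 2 * (‖f‖ * ‖mulOp (fun p => (L p : ℂ)) h‖) := by
  set A := mulOp (fun p => (a p : ℂ)) with hA
  set M := mulOp (fun p => (L p : ℂ))
  have hn : Measurable (Function.uncurry fun r ξ => (wt s r : ℂ) * rsym (1 + r) ξ) := by
    refine Measurable.mul ?_ (measurable_rsym.comp
      (by fun_prop : Measurable fun z : ℝ × ℝ => (1 + z.1, z.2)))
    exact Complex.measurable_ofReal.comp ((measurable_fst.pow_const _).const_mul _)
  have hbi := integrableOn_wt (s := s) (β := 1) hs2 (by linarith)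
  have hle : ∀ r ∈ Ioi (0 : ℝ), ∀ ξ, ‖(wt s r : ℂ) * rsym (1 + r) ξ‖ ≤
      wt s r * (1 + r) ^ (-1 : ℝ) := by
    intro r hr ξ
    have hr : (0 : ℝ) < r := hr
    rw [norm_mul, Complex.norm_real, Real.norm_of_nonneg (wt_nonneg hs hs2 hr), Real.rpow_neg_one]
    exact mul_le_mul_of_nonneg_left (norm_rsym_le (by linarith) ξ) (wt_nonneg hs hs2 hr)
  have key := fun w q => inner_mult_integral hn hbi hle (isSym_jsym hs.le)
    (jsym_eq_integral hs hs2) w q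
  have e1 : inner ℂ fx (A (J s h)) = inner ℂ (J s (A fx)) h := by
    rw [inner_J hs.le, inner_mulOp_real ha]
  rw [e1, J, (key fx (A h)).2, (key (A fx) h).2, ← integral_sub (key fx (A h)).1 (key (A fx) h).1]
  have hint1 : ∫ r in Ioi (0 : ℝ), wt s r * (1 + r) ^ (-1 : ℝ) = 1 := by
    simp_rw [wt, mul_assoc]
    rw [integral_const_mul, inv_mul_cancel₀ (wt_integral_pos hs hs2).ne']
  have hb2 : ∫ r in Ioi (0 : ℝ), (wt s r * (1 + r) ^ (-1 : ℝ)) * (2 * (‖f‖ * ‖M h‖)) =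
      2 * (‖f‖ * ‖M h‖) := by rw [integral_mul_const, hint1, one_mul]
  rw [← hb2]
  refine norm_integral_le_of_norm_le (hbi.mul_const _) ?_
  filter_upwards [ae_restrict_mem measurableSet_Ioi] with r hr
  have hr : (0 : ℝ) < r := hr
  have hl : 0 < 1 + r := by linarith
  have := resolvent_commutator ha hL hlip hLℓ hl hf h
  rw [mult_const_mul (isSym_rsym hl), mult_const_mul (isSym_rsym hl), inner_smul_left,
    inner_smul_left, ← mul_sub, norm_mul, RCLike.norm_conj, Complex.norm_real,
    Real.norm_of_nonneg (wt_nonneg hs hs2 hr), mul_assoc, Real.rpow_neg_one]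
  refine mul_le_mul_of_nonneg_left (this.trans (le_of_eq ?_)) (wt_nonneg hs hs2 hr)
  ring

end Lipschitz

section BoundedLipschitz

variable {a : R3 → ℝ} {K : ℝ} (ha : IsCoef (fun p => (a p : ℂ)))
  (hlip : ∀ s > 0, ∀ p : R3, |a (p - (0, s, 0)) - a p| ≤ s * K)

include hlip in
lemma nonneg_of_lip : 0 ≤ K := by
  have := (abs_nonneg _).trans (hlip 1 one_pos 0)
  linarith

include ha hlip

lemma HasD.lipX_const {p p' q q' : HH} (hp : HasD trX p p') (hq : HasD trX q q') :
    ‖(inner ℂ p' (mulOp (fun z => (a z : ℂ)) q) + inner ℂ p (mulOp (fun z => (a z : ℂ)) q') : ℂ)‖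
      ≤ K * (‖p‖ * ‖q‖) := by
  have h0 := nonneg_of_lip hlip
  refine (HasD.lipX (L := fun _ => K) ha (isCoef_const _) hlip hp hq).trans ?_
  rw [mul_left_comm]
  refine mul_le_mul_of_nonneg_left (norm_mulOp_le (isCoef_const _) _ fun p => ?_) (norm_nonneg _)
  rw [Complex.norm_real, Real.norm_of_nonneg h0]

lemma commutator_J_const {s : ℝ}
    (hs : 0 < s) (hs2 : s < 2) {f fx : HH} (hf : HasD trX f fx) (h : HH) :
    ‖(inner ℂ (J s fx) (mulOp (fun p => (a p : ℂ)) h) -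
      inner ℂ fx (mulOp (fun p => (a p : ℂ)) (J s h)) : ℂ)‖ ≤ 2 * K * (‖f‖ * ‖h‖) := by
  have h0 := nonneg_of_lip hlip
  refine (commutator_J (L := fun _ => K) (ℓ := fun _ => (K : ℂ)) ha (isCoef_const _) hlip
    (fun _ => rfl) hs hs2 hf h).trans ?_
  rw [mul_assoc 2 K, mul_left_comm K]
  refine mul_le_mul_of_nonneg_left (mul_le_mul_of_nonneg_left
    (norm_mulOp_le (isCoef_const _) _ fun p => ?_) (norm_nonneg _)) zero_le_two
  rw [Complex.norm_real, Real.norm_of_nonneg h0]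

/-- Split p = Λ^{-2}p − ∂_x²Λ^{-2}p. The first part is bounded by Λ^{-s}p outright; the second is
∂_x of ∂_xΛ^{-2}p, which is bounded by Λ^{-s}p because s ≤ 1, so the commutator estimate applies.
The constants add up to K + K + 2K. -/
lemma norm_J_mulOp_le (hK : ∀ p, |a p| ≤ K) {s : ℝ} (hs : 0 < s) (hs1 : s ≤ 1) (p : HH) :
    ‖J s (mulOp (fun p => (a p : ℂ)) p)‖ ≤ 4 * K * ‖J s p‖ := by
  have h0 := nonneg_of_lip hlip
  set A := mulOp (fun p => (a p : ℂ)) with hA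
  have hAle : ∀ w, ‖A w‖ ≤ K * ‖w‖ := fun w => norm_mulOp_le ha w fun p => by
    rw [Complex.norm_real]; exact hK p
  have hb : ∀ ξ, ‖dsym ξ * (dsym ξ * jsym 2 ξ)‖ ≤ 1 := by
    intro ξ
    rw [norm_mul, norm_mul, norm_jsym, ← mul_assoc, Real.rpow_neg (br_pos ξ).le, Real.rpow_two,
      ← div_eq_mul_inv, div_le_one (pow_pos (br_pos ξ) 2), br_sq]
    nlinarith
  have hsym : IsSym (fun ξ => dsym ξ * (dsym ξ * jsym 2 ξ)) :=
    ⟨continuous_dsym.measurable.mul (continuous_dsym.measurable.mul (measurable_jsym 2)), 1, hb⟩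
  have hP : HasD trX (DJ 2 p) (mult (fun ξ => dsym ξ * (dsym ξ * jsym 2 ξ)) p) :=
    hasD_mult (isSym_dsym_jsym one_le_two) hsym p
  set Px := mult (fun ξ => dsym ξ * (dsym ξ * jsym 2 ξ)) p with hPx
  have hp : p = J 2 p - Px := by
    conv_lhs => rw [← mult_one p]
    rw [J, hPx, ← mult_sub (isSym_jsym zero_le_two) hsym]
    congr 2
    funext ξ
    have h1 : (dsym ξ) * dsym ξ = -((‖dsym ξ‖ ^ 2 : ℝ) : ℂ) := by
      have := Complex.mul_conj (dsym ξ)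
      rw [conj_dsym, Complex.normSq_eq_norm_sq] at this
      rw [← this]; ring
    have h2 : ((br ξ ^ 2 : ℝ) : ℂ) ≠ 0 := by
      rw [Complex.ofReal_ne_zero]; exact (pow_pos (br_pos ξ) 2).ne'
    have h3 : jsym 2 ξ = ((br ξ ^ 2 : ℝ) : ℂ)⁻¹ := by
      rw [jsym, Real.rpow_neg (br_pos ξ).le, Real.rpow_two, Complex.ofReal_inv]
    rw [← mul_assoc, h1, neg_mul, sub_neg_eq_add, ← one_add_mul, h3,
      ← Complex.ofReal_one, ← Complex.ofReal_add, ← br_sq, Complex.ofReal_one, mul_inv_cancel₀ h2]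
  have b1 : ‖J 2 p‖ ≤ ‖J s p‖ := norm_J_anti hs.le (by linarith) p
  have b2 : ‖DJ 2 p‖ ≤ ‖J s p‖ := by
    have : ‖DJ 2 p‖ ≤ 1 * ‖J s p‖ := by
      refine norm_mult_le_norm (isSym_dsym_jsym one_le_two) (isSym_jsym hs.le) p fun ξ => ?_
      rw [norm_mul, norm_jsym, norm_jsym, one_mul]
      calc _ ≤ br ξ ^ (1 : ℝ) * br ξ ^ (-2 : ℝ) := by
            refine mul_le_mul_of_nonneg_right ?_ (Real.rpow_nonneg (br_pos ξ).le _)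
            rw [Real.rpow_one]; exact norm_dsym_le ξ
        _ = br ξ ^ (-1 : ℝ) := by rw [← Real.rpow_add (br_pos ξ)]; norm_num
        _ ≤ _ := Real.rpow_le_rpow_of_exponent_le (one_le_br ξ) (by linarith)
    linarith
  have b3 : ‖J s Px‖ ≤ ‖J s p‖ := by
    rw [hPx, J, mult_comm (isSym_jsym hs.le) hsym]
    simpa using norm_mult_le hsym (mult (jsym s) p) hb
  have key : ∀ q, ‖(inner ℂ (J s (A p)) q : ℂ)‖ ≤ 4 * K * ‖J s p‖ * ‖q‖ := by
    intro q
    have c1 := commutator_J_const ha hlip hs (by linarith) hP q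
    have e1 : inner ℂ (J s (A p)) q = inner ℂ (J 2 p) (A (J s q)) - inner ℂ (J s Px) (A q)
        + (inner ℂ (J s Px) (A q) - inner ℂ Px (A (J s q))) := by
      rw [inner_J hs.le, hA, inner_mulOp_real ha]
      conv_lhs => rw [hp, inner_sub_left]
      ring
    have n1 : ‖(inner ℂ (J 2 p) (A (J s q)) : ℂ)‖ ≤ ‖J s p‖ * (K * ‖q‖) :=
      (norm_inner_le_norm _ _).trans (mul_le_mul b1 ((hAle _).trans
        (mul_le_mul_of_nonneg_left (norm_J_le hs.le q) h0)) (norm_nonneg _) (norm_nonneg _))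
    have n2 : ‖(inner ℂ (J s Px) (A q) : ℂ)‖ ≤ ‖J s p‖ * (K * ‖q‖) :=
      (norm_inner_le_norm _ _).trans (mul_le_mul b3 (hAle _) (norm_nonneg _) (norm_nonneg _))
    have n3 : 2 * K * (‖DJ 2 p‖ * ‖q‖) ≤ 2 * K * (‖J s p‖ * ‖q‖) := by gcongr
    rw [e1]
    refine (norm_add_le _ _).trans ((add_le_add (norm_sub_le _ _) c1).trans ?_)
    linarith
  exact norm_le_of_norm_inner_self_le (by positivity) (key _)

/-- The same substitution for ∂_xQ, which is skew and one order weaker, so only l^{-1/2} is gained: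
the commutator is l times one integration by parts in x minus another. -/
lemma resolvent_anticommutator {l : ℝ} (hl : 0 < l) {f fx : HH} (hf : HasD trX f fx) (w : HH) :
    ‖(inner ℂ (mult (fun ξ => dsym ξ * rsym l ξ) fx) (mulOp (fun p => (a p : ℂ)) w) -
      inner ℂ (mult (fun ξ => dsym ξ * rsym l ξ) (mulOp (fun p => (a p : ℂ)) fx)) w : ℂ)‖
      ≤ 2 * K * (√l)⁻¹ * (‖f‖ * ‖w‖) := by
  have hK0 := nonneg_of_lip hlip
  set A := mulOp (fun p => (a p : ℂ))
  have h0 := isSym_rsym hl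
  have h1 := isSym_dsym_rsym hl
  have h2 := isSym_dsym_dsym_rsym hl
  have e1 : inner ℂ (mult (fun ξ => dsym ξ * rsym l ξ) (A fx)) w =
      -inner ℂ fx (A (mult (fun ξ => dsym ξ * rsym l ξ) w)) := by
    rw [inner_mult_left h1, inner_mulOp_real ha, ← inner_neg_right]
    have : (fun ξ => (starRingEnd ℂ) (dsym ξ * rsym l ξ)) =
        fun ξ => (-1 : ℂ) * (dsym ξ * rsym l ξ) := by
      funext ξ
      rw [map_mul, conj_dsym]
      simp [rsym]
    rw [this, mult_const_mul h1]
    simp [A]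
  have hm : mult (rsym l) fx = mult (fun ξ => dsym ξ * rsym l ξ) f := hf.mult_eq h0 h1
  have hm' : mult (fun ξ => dsym ξ * rsym l ξ) fx =
    mult (fun ξ => dsym ξ * (dsym ξ * rsym l ξ)) f := hf.mult_eq h1 h2
  have hm1 := hasD_mult h1 h2 f
  have hm2 := hf.multX h2
  have hk := hasD_mult h0 h1 w
  have hk1 := hasD_mult h1 h2 w
  have b1 := HasD.lipX_const ha hlip hm1 hk
  have b2 := HasD.lipX_const ha hlip hm2 hk1
  have ef := resolvent_eq hl fx
  have eh := resolvent_eq hl w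
  have e2 : inner ℂ (mult (fun ξ => dsym ξ * rsym l ξ) fx) (A w) +
        inner ℂ fx (A (mult (fun ξ => dsym ξ * rsym l ξ) w)) =
      (l : ℂ) * (inner ℂ (mult (fun ξ => dsym ξ * (dsym ξ * rsym l ξ)) f) (A (mult (rsym l) w)) +
        inner ℂ (mult (fun ξ => dsym ξ * rsym l ξ) f)
          (A (mult (fun ξ => dsym ξ * rsym l ξ) w))) -
      (inner ℂ (mult (fun ξ => dsym ξ * (dsym ξ * rsym l ξ)) fx)
          (A (mult (fun ξ => dsym ξ * rsym l ξ) w)) +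
        inner ℂ (mult (fun ξ => dsym ξ * (dsym ξ * rsym l ξ)) f)
          (A (mult (fun ξ => dsym ξ * (dsym ξ * rsym l ξ)) w))) := by
    rw [← hm, hm']
    nth_rw 1 [ef]
    nth_rw 1 [eh]
    rw [map_sub, map_smul, inner_sub_left, inner_sub_right, inner_smul_left, inner_smul_right,
      Complex.conj_ofReal]
    ring
  have c1 := norm_mult_le h0 w (norm_rsym_le hl)
  have c2 := norm_mult_le h1 w (norm_dsym_rsym_le hl)
  have c3 := norm_mult_le h1 f (norm_dsym_rsym_le hl)
  have c4 := norm_mult_le h2 f (norm_dsym_dsym_rsym_le hl)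
  rw [e1, sub_neg_eq_add, e2]
  refine (norm_sub_le _ _).trans ?_
  rw [norm_mul, Complex.norm_real, Real.norm_of_nonneg hl.le]
  calc _ ≤ l * (K * (((√l)⁻¹ * ‖f‖) * (l⁻¹ * ‖w‖))) + K * ((1 * ‖f‖) * ((√l)⁻¹ * ‖w‖)) :=
        add_le_add (mul_le_mul_of_nonneg_left (b1.trans (by gcongr)) hl.le) (b2.trans (by gcongr))
    _ = _ := by field_simp; ring

/-- Since ∂_xΛ^{-4/3} is skew, the sum is a commutator with a. The integral over resolvents
converges because r^{-2/3}(1 + r)^{-1/2} is integrable on (0, ∞). -/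
lemma anticommutator_DJ {f fx : HH} (hf : HasD trX f fx) (w : HH) :
    ‖(inner ℂ (DJ (4 / 3) fx) (mulOp (fun p => (a p : ℂ)) w) +
      inner ℂ fx (mulOp (fun p => (a p : ℂ)) (DJ (4 / 3) w)) : ℂ)‖
      ≤ (∫ r in Ioi (0 : ℝ), wt (4 / 3) r * (1 + r) ^ (-(1 / 2) : ℝ)) * (2 * K * (‖f‖ * ‖w‖)) := by
  set A := mulOp (fun p => (a p : ℂ)) with hA
  have hs : (0 : ℝ) < 4 / 3 := by norm_num
  have hs2 : (4 / 3 : ℝ) < 2 := by norm_num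
  have hn : Measurable (Function.uncurry fun r ξ =>
      (wt (4 / 3) r : ℂ) * (dsym ξ * rsym (1 + r) ξ)) := by
    refine Measurable.mul ?_ ((continuous_dsym.measurable.comp measurable_snd).mul
      (measurable_rsym.comp (by fun_prop : Measurable fun z : ℝ × ℝ => (1 + z.1, z.2))))
    exact Complex.measurable_ofReal.comp ((measurable_fst.pow_const _).const_mul _)
  have hbi := integrableOn_wt (s := 4 / 3) (β := 1 / 2) hs2 (by norm_num)
  have hpow : ∀ r : ℝ, 0 < r → (1 + r) ^ (-(1 / 2) : ℝ) = (√(1 + r))⁻¹ := fun r hr => by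
    rw [Real.rpow_neg (by linarith), Real.sqrt_eq_rpow]
  have hle : ∀ r ∈ Ioi (0 : ℝ), ∀ ξ, ‖(wt (4 / 3) r : ℂ) * (dsym ξ * rsym (1 + r) ξ)‖ ≤
      wt (4 / 3) r * (1 + r) ^ (-(1 / 2) : ℝ) := by
    intro r hr ξ
    have hr : (0 : ℝ) < r := hr
    rw [norm_mul, Complex.norm_real, Real.norm_of_nonneg (wt_nonneg hs hs2 hr), hpow r hr]
    exact mul_le_mul_of_nonneg_left (norm_dsym_rsym_le (by linarith) ξ) (wt_nonneg hs hs2 hr)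
  have hM : ∀ ξ, dsym ξ * jsym (4 / 3) ξ =
      ∫ r in Ioi (0 : ℝ), (wt (4 / 3) r : ℂ) * (dsym ξ * rsym (1 + r) ξ) := by
    intro ξ
    rw [jsym_eq_integral hs hs2, ← integral_const_mul]
    congr 1; funext r; ring
  have key := fun w q => inner_mult_integral hn hbi hle (isSym_dsym_jsym (by norm_num)) hM w q
  have e1 : inner ℂ fx (A (DJ (4 / 3) w)) = -inner ℂ (DJ (4 / 3) (A fx)) w := by
    rw [inner_DJ (by norm_num), neg_neg, inner_mulOp_real ha]
  rw [e1, DJ, ← sub_eq_add_neg, (key fx (A w)).2, (key (A fx) w).2,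
    ← integral_sub (key fx (A w)).1 (key (A fx) w).1, ← integral_mul_const]
  refine norm_integral_le_of_norm_le (hbi.mul_const _) ?_
  filter_upwards [ae_restrict_mem measurableSet_Ioi] with r hr
  have hr : (0 : ℝ) < r := hr
  have hl : 0 < 1 + r := by linarith
  have := resolvent_anticommutator ha hlip hl hf w
  rw [mult_const_mul (isSym_dsym_rsym hl), mult_const_mul (isSym_dsym_rsym hl), inner_smul_left,
    inner_smul_left, ← mul_sub, norm_mul, RCLike.norm_conj, Complex.norm_real,
    Real.norm_of_nonneg (wt_nonneg hs hs2 hr), mul_assoc, hpow r hr]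
  refine mul_le_mul_of_nonneg_left (this.trans (le_of_eq ?_)) (wt_nonneg hs hs2 hr)
  ring

end BoundedLipschitz

/-! ### A Sobolev inequality on the half plane -/

lemma isOpen_halfPlane : IsOpen halfPlane := isOpen_univ.prod isOpen_Ioi

lemma measurableSet_halfPlane : MeasurableSet halfPlane := isOpen_halfPlane.measurableSet

/-- Mollification of the extension by zero of a function on the half plane. -/
def moll (b : ContDiffBump (0 : ℝ × ℝ)) (D : ℝ × ℝ → ℝ) : ℝ × ℝ → ℝ :=
  convolution (b.normed volume) (halfPlane.indicator D) (ContinuousLinearMap.lsmul ℝ ℝ) volume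

lemma memLp_halfPlane_indicator {D : ℝ × ℝ → ℝ} (hD : MemLp D 2 (volume.restrict halfPlane)) :
    MemLp (halfPlane.indicator D) 2 (volume : Measure (ℝ × ℝ)) :=
  (memLp_indicator_iff_restrict measurableSet_halfPlane).2 hD

lemma locallyIntegrable_halfPlane_indicator {D : ℝ × ℝ → ℝ}
    (hD : MemLp D 2 (volume.restrict halfPlane)) :
    LocallyIntegrable (halfPlane.indicator D) (volume : Measure (ℝ × ℝ)) :=
  (memLp_halfPlane_indicator hD).locallyIntegrable (by norm_num)

lemma continuous_moll (b : ContDiffBump (0 : ℝ × ℝ)) {D : ℝ × ℝ → ℝ}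
    (hD : MemLp D 2 (volume.restrict halfPlane)) : Continuous (moll b D) :=
  b.hasCompactSupport_normed.continuous_convolution_left _ b.continuous_normed
    (locallyIntegrable_halfPlane_indicator hD)

lemma moll_eq (b : ContDiffBump (0 : ℝ × ℝ)) (D : ℝ × ℝ → ℝ) (q : ℝ × ℝ) :
    moll b D q = ∫ z in halfPlane, b.normed volume (q - z) • D z := by
  rw [moll, convolution_lsmul_swap, ← integral_indicator measurableSet_halfPlane]
  congr 1; funext z
  by_cases hz : z ∈ halfPlane <;> simp [hz]

/-- At height above the radius of the mollifier, the reflected kernel is an admissible test function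
on the open half plane, so the jump of the zero extension is not seen. -/
lemma hasDerivAt_moll (b : ContDiffBump (0 : ℝ × ℝ)) {e : ℝ × ℝ} {D D' : ℝ × ℝ → ℝ}
    (h : HasWeakDeriv halfPlane e D D') (hD : MemLp D 2 (volume.restrict halfPlane))
    (q : ℝ × ℝ) (s₀ : ℝ) (hq : b.rOut < (q + s₀ • e).2) :
    HasDerivAt (fun s : ℝ => moll b D (q + s • e)) (moll b D' (q + s₀ • e)) s₀ := by
  set ρ := b.normed (volume : Measure (ℝ × ℝ)) with hρ
  have hρc : HasCompactSupport ρ := b.hasCompactSupport_normed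
  have hρs : ContDiff ℝ ∞ ρ := b.contDiff_normed
  set x := q + s₀ • e with hx
  have hli := locallyIntegrable_halfPlane_indicator hD
  have h1 := hρc.hasFDerivAt_convolution_left (ContinuousLinearMap.lsmul ℝ ℝ)
    (hρs.of_le (by simp)) hli x
  have h2 : HasDerivAt (fun s : ℝ => q + s • e) e s₀ := by
    simpa using ((hasDerivAt_id s₀).smul_const e).const_add q
  have h3 := h1.comp_hasDerivAt s₀ h2
  refine h3.congr_deriv ?_
  have hex : ConvolutionExistsAt (fderiv ℝ ρ) (halfPlane.indicator D) x
      ((ContinuousLinearMap.lsmul ℝ ℝ).precompL (ℝ × ℝ)) volume :=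
    (hρc.fderiv ℝ).convolutionExists_left _ (hρs.continuous_fderiv (by simp)) hli x
  rw [convolution_eq_swap, ContinuousLinearMap.integral_apply hex.integrable_swap, moll_eq]
  have h4 : ∀ z, (((ContinuousLinearMap.lsmul ℝ ℝ).precompL (ℝ × ℝ)) (fderiv ℝ ρ (x - z))
      (halfPlane.indicator D z)) e = halfPlane.indicator (fun z => fderiv ℝ ρ (x - z) e • D z) z := by
    intro z
    by_cases hz : z ∈ halfPlane <;> simp [hz]
  simp_rw [h4]
  rw [integral_indicator measurableSet_halfPlane]
  have h5 := h.2.2 (fun z => ρ (x - z)) (hρs.comp (by fun_prop))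
    (hρc.comp_homeomorph (Homeomorph.subLeft x)) ?_
  · have h6 : ∀ z, fderiv ℝ (fun z => ρ (x - z)) z e = -(fderiv ℝ ρ (x - z) e) := fun z => by
      have h7 : HasFDerivAt (fun z => x - z) (-ContinuousLinearMap.id ℝ (ℝ × ℝ)) z :=
        (hasFDerivAt_id z).const_sub x
      have h8 : HasFDerivAt ρ (fderiv ℝ ρ (x - z)) (x - z) :=
        (hρs.differentiable (by simp) _).hasFDerivAt
      have h9 : HasFDerivAt (fun z => ρ (x - z))
          ((fderiv ℝ ρ (x - z)).comp (-ContinuousLinearMap.id ℝ (ℝ × ℝ))) z := h8.comp z h7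
      rw [h9.fderiv]
      simp
    simp_rw [h6, neg_smul] at h5
    rw [integral_neg, neg_inj] at h5
    exact h5
  · intro z hz
    have h7 : x - z ∈ tsupport ρ :=
      tsupport_comp_subset_preimage ρ (f := fun z => x - z) (by fun_prop) hz
    rw [hρ, b.tsupport_normed_eq, mem_closedBall_zero_iff] at h7
    have h8 : |(x - z).2| ≤ b.rOut := (norm_snd_le (x - z)).trans h7
    have h9 := (abs_le.1 h8).2
    rw [Prod.snd_sub] at h9
    exact ⟨mem_univ _, by simp only [mem_Ioi]; linarith⟩

lemma setIntegral_moll_sq_le (b : ContDiffBump (0 : ℝ × ℝ)) {D : ℝ × ℝ → ℝ}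
    (hD : MemLp D 2 (volume.restrict halfPlane)) {M : ℝ} (hM : 0 ≤ M)
    (hDM : eLpNorm D 2 (volume.restrict halfPlane) ≤ ENNReal.ofReal M) {S : Set (ℝ × ℝ)}
    (hS : IsCompact S) (q : ℝ × ℝ) :
    ∫ z in S, moll b D (q + z) ^ 2 ≤ M ^ 2 := by
  set ρ := b.normed (volume : Measure (ℝ × ℝ)) with hρ
  set g := halfPlane.indicator D with hg
  have hgm := memLp_halfPlane_indicator hD
  have hg2 : Integrable (fun z => g z ^ 2) (volume : Measure (ℝ × ℝ)) :=
    (memLp_two_iff_integrable_sq hgm.1).1 hgm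
  have hli := hgm.locallyIntegrable (by norm_num)
  set R : ℝ × ℝ → ℝ := convolution ρ (fun z => g z ^ 2) (ContinuousLinearMap.lsmul ℝ ℝ) volume
  have hRi : Integrable R := b.integrable_normed.integrable_convolution _ hg2
  have hRint : ∫ z, R z = ∫ z, g z ^ 2 := by
    rw [integral_convolution _ b.integrable_normed hg2, b.integral_normed]; simp
  -- Jensen's inequality for the probability density ρ, in the form that the variance is
  -- nonnegative.
  have hJ : ∀ z, moll b D z ^ 2 ≤ R z := by
    intro z
    have e1 : Integrable (fun w => ρ w * g (z - w)) :=
      b.hasCompactSupport_normed.convolutionExists_left (ContinuousLinearMap.lsmul ℝ ℝ)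
        b.continuous_normed hli z
    have e2 : Integrable (fun w => ρ w * g (z - w) ^ 2) :=
      b.hasCompactSupport_normed.convolutionExists_left (ContinuousLinearMap.lsmul ℝ ℝ)
        b.continuous_normed hg2.locallyIntegrable z
    set m := moll b D z with hm
    have hm' : ∫ w, ρ w * g (z - w) = m := rfl
    have hR' : ∫ w, ρ w * g (z - w) ^ 2 = R z := rfl
    have e3 : 0 ≤ ∫ w, ρ w * (g (z - w) - m) ^ 2 :=
      integral_nonneg fun w => mul_nonneg (b.nonneg_normed w) (sq_nonneg _)
    have e4 : ∫ w, ρ w * (g (z - w) - m) ^ 2 = R z - 2 * m * m + m ^ 2 := by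
      have : ∀ w, ρ w * (g (z - w) - m) ^ 2 =
          ρ w * g (z - w) ^ 2 - 2 * m * (ρ w * g (z - w)) + m ^ 2 * ρ w := fun w => by ring
      simp_rw [this]
      have e5 : Integrable (fun w => 2 * m * (ρ w * g (z - w))) := e1.const_mul _
      have e6 : Integrable (fun w => m ^ 2 * ρ w) := b.integrable_normed.const_mul _
      have e7 : Integrable (fun w => ρ w * g (z - w) ^ 2 - 2 * m * (ρ w * g (z - w))) := e2.sub e5
      rw [integral_add e7 e6, integral_sub e2 e5, integral_const_mul, integral_const_mul, hm', hR',
        b.integral_normed, mul_one]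
    rw [e4] at e3
    linarith [sq m]
  have hc : Continuous fun z => moll b D (q + z) ^ 2 :=
    ((continuous_moll b hD).comp (by fun_prop)).pow 2
  have hRq : Integrable (fun z => R (q + z)) := hRi.comp_add_left q
  calc _ ≤ ∫ z in S, R (q + z) :=
        setIntegral_mono (hc.continuousOn.integrableOn_compact hS) hRq.integrableOn fun z => hJ _
    _ ≤ ∫ z, R (q + z) := setIntegral_le_integral hRq
        (Eventually.of_forall fun z => (sq_nonneg _).trans (hJ _))
    _ = ∫ z, g z ^ 2 := by rw [integral_add_left_eq_self R q, hRint]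
    _ ≤ M ^ 2 := by
        have e1 : eLpNorm g 2 volume ≤ ENNReal.ofReal M := by
          rwa [hg, eLpNorm_indicator_eq_eLpNorm_restrict measurableSet_halfPlane]
        have e2 : eLpNorm g 2 volume = ENNReal.ofReal (√(∫ z, g z ^ 2)) := by
          rw [hgm.eLpNorm_eq_integral_rpow_norm two_ne_zero (by simp)]
          simp [Real.sqrt_eq_rpow, hg]
        rw [e2, ENNReal.ofReal_le_ofReal_iff hM] at e1
        rwa [Real.sqrt_le_left hM] at e1

/-- Integrate the derivative of (1 − s)g(s)², which vanishes at s = 1. -/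
lemma sq_le_intervalIntegral {g g' : ℝ → ℝ} (hg : Continuous g) (hg' : Continuous g')
    (h : ∀ s ∈ Icc (0 : ℝ) 1, HasDerivAt g (g' s) s) :
    g 0 ^ 2 ≤ 2 * ∫ s in (0 : ℝ)..1, (g s ^ 2 + g' s ^ 2) := by
  have h1 : ∀ s ∈ uIcc (0 : ℝ) 1, HasDerivAt (fun s => (1 - s) * g s ^ 2)
      (-(g s ^ 2) + 2 * (1 - s) * (g s * g' s)) s := by
    intro s hs
    rw [uIcc_of_le zero_le_one] at hs
    have := ((hasDerivAt_id s).const_sub 1).mul ((h s hs).pow 2)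
    refine this.congr_deriv ?_
    simp; ring
  have h2 := intervalIntegral.integral_eq_sub_of_hasDerivAt h1
    ((by fun_prop : Continuous fun s => -(g s ^ 2) + 2 * (1 - s) * (g s * g' s)).intervalIntegrable
      0 1)
  have h3 : g 0 ^ 2 = ∫ s in (0 : ℝ)..1, -(-(g s ^ 2) + 2 * (1 - s) * (g s * g' s)) := by
    rw [intervalIntegral.integral_neg, h2]; simp
  rw [h3, ← intervalIntegral.integral_const_mul]
  refine intervalIntegral.integral_mono_on zero_le_one
    ((by fun_prop : Continuous fun s =>
      -(-(g s ^ 2) + 2 * (1 - s) * (g s * g' s))).intervalIntegrable 0 1)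
    ((by fun_prop : Continuous fun s => 2 * (g s ^ 2 + g' s ^ 2)).intervalIntegrable 0 1)
    fun s hs => ?_
  have h4 : (1 - s) * (-(2 * (g s * g' s))) ≤ (1 - s) * (g s ^ 2 + g' s ^ 2) :=
    mul_le_mul_of_nonneg_left (by nlinarith [sq_nonneg (g s + g' s)]) (by linarith [hs.2])
  nlinarith [hs.1, sq_nonneg (g s), sq_nonneg (g' s)]

/-- The one-dimensional inequality is used in x, then in y. The unit square extends upwards from q,
so it never leaves the region where the derivatives are known. -/
lemma sq_le_setIntegral_square {F Fx Fy Fxy : ℝ × ℝ → ℝ} (hF : Continuous F) (hFx : Continuous Fx)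
    (hFy : Continuous Fy) (hFxy : Continuous Fxy) {δ : ℝ}
    (h1 : ∀ (q : ℝ × ℝ) (s : ℝ), δ < (q + s • ((1 : ℝ), (0 : ℝ))).2 →
      HasDerivAt (fun s : ℝ => F (q + s • ((1 : ℝ), (0 : ℝ)))) (Fx (q + s • ((1 : ℝ), (0 : ℝ)))) s)
    (h2 : ∀ (q : ℝ × ℝ) (s : ℝ), δ < (q + s • ((0 : ℝ), (1 : ℝ))).2 →
      HasDerivAt (fun s : ℝ => F (q + s • ((0 : ℝ), (1 : ℝ)))) (Fy (q + s • ((0 : ℝ), (1 : ℝ)))) s)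
    (h3 : ∀ (q : ℝ × ℝ) (s : ℝ), δ < (q + s • ((0 : ℝ), (1 : ℝ))).2 →
      HasDerivAt (fun s : ℝ => Fx (q + s • ((0 : ℝ), (1 : ℝ)))) (Fxy (q + s • ((0 : ℝ), (1 : ℝ)))) s)
    (q : ℝ × ℝ) (hq : δ < q.2) :
    F q ^ 2 ≤ 4 * ∫ z in Icc (0 : ℝ) 1 ×ˢ Icc (0 : ℝ) 1,
      ((F (q + z) ^ 2 + Fy (q + z) ^ 2) + (Fx (q + z) ^ 2 + Fxy (q + z) ^ 2)) := by
  have a1 := sq_le_intervalIntegral (g := fun s => F (q + s • ((1 : ℝ), (0 : ℝ))))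
    (g' := fun s => Fx (q + s • ((1 : ℝ), (0 : ℝ)))) (by fun_prop) (by fun_prop)
    (fun s _ => h1 q s (by simpa using hq))
  set G : ℝ × ℝ → ℝ := fun z => (F (q + z) ^ 2 + Fy (q + z) ^ 2) + (Fx (q + z) ^ 2 + Fxy (q + z) ^ 2)
    with hG
  have hGc : Continuous G := by fun_prop
  have e0 : ∀ s r : ℝ, q + s • ((1 : ℝ), (0 : ℝ)) + r • ((0 : ℝ), (1 : ℝ)) = q + (s, r) := by
    intro s r; ext <;> simp
  have a2 : ∀ s : ℝ, F (q + s • ((1 : ℝ), (0 : ℝ))) ^ 2 + Fx (q + s • ((1 : ℝ), (0 : ℝ))) ^ 2 ≤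
      2 * ∫ r in (0 : ℝ)..1, G (s, r) := by
    intro s
    have b1 := sq_le_intervalIntegral
      (g := fun r => F (q + s • ((1 : ℝ), (0 : ℝ)) + r • ((0 : ℝ), (1 : ℝ))))
      (g' := fun r => Fy (q + s • ((1 : ℝ), (0 : ℝ)) + r • ((0 : ℝ), (1 : ℝ)))) (by fun_prop)
      (by fun_prop) (fun r hr => h2 _ r (by simp; linarith [hr.1]))
    have b2 := sq_le_intervalIntegral
      (g := fun r => Fx (q + s • ((1 : ℝ), (0 : ℝ)) + r • ((0 : ℝ), (1 : ℝ))))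
      (g' := fun r => Fxy (q + s • ((1 : ℝ), (0 : ℝ)) + r • ((0 : ℝ), (1 : ℝ)))) (by fun_prop)
      (by fun_prop) (fun r hr => h3 _ r (by simp; linarith [hr.1]))
    simp only [zero_smul, add_zero, e0] at b1 b2
    have b3 : ∫ r in (0 : ℝ)..1, G (s, r) =
        (∫ r in (0 : ℝ)..1, (F (q + (s, r)) ^ 2 + Fy (q + (s, r)) ^ 2)) +
        ∫ r in (0 : ℝ)..1, (Fx (q + (s, r)) ^ 2 + Fxy (q + (s, r)) ^ 2) :=
      intervalIntegral.integral_add (Continuous.intervalIntegrable (by fun_prop) _ _)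
        (Continuous.intervalIntegrable (by fun_prop) _ _)
    rw [b3]; linarith
  have hsq : ∫ z in Icc (0 : ℝ) 1 ×ˢ Icc (0 : ℝ) 1, G z =
      ∫ s in (0 : ℝ)..1, ∫ r in (0 : ℝ)..1, G (s, r) := by
    have := setIntegral_prod (μ := (volume : Measure ℝ)) (ν := (volume : Measure ℝ)) G
      (s := Icc (0 : ℝ) 1) (t := Icc (0 : ℝ) 1)
      (hGc.continuousOn.integrableOn_compact (isCompact_Icc.prod isCompact_Icc))
    rw [← Measure.volume_eq_prod] at this
    rw [this, intervalIntegral.integral_of_le zero_le_one, integral_Icc_eq_integral_Ioc]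
    congr 1; funext s
    rw [intervalIntegral.integral_of_le zero_le_one, integral_Icc_eq_integral_Ioc]
  have hGi : Continuous fun s => ∫ r in (0 : ℝ)..1, G (s, r) :=
    intervalIntegral.continuous_parametric_intervalIntegral_of_continuous' (by fun_prop) _ _
  have a3 : ∫ s in (0 : ℝ)..1, (F (q + s • ((1 : ℝ), (0 : ℝ))) ^ 2 +
      Fx (q + s • ((1 : ℝ), (0 : ℝ))) ^ 2) ≤ ∫ s in (0 : ℝ)..1, 2 * ∫ r in (0 : ℝ)..1, G (s, r) :=
    intervalIntegral.integral_mono_on zero_le_one (Continuous.intervalIntegrable (by fun_prop) _ _)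
      ((hGi.const_mul 2).intervalIntegrable _ _) fun s _ => a2 s
  rw [intervalIntegral.integral_const_mul] at a3
  rw [hsq]
  simp only [zero_smul, add_zero] at a1
  linarith

lemma abs_moll_le (b : ContDiffBump (0 : ℝ × ℝ)) {k : ℕ} {w : ℝ × ℝ → ℝ}
    {D : ℕ → ℕ → ℝ × ℝ → ℝ} (hjet : IsWeakJet k w D) {M : ℝ} (hM : 0 ≤ M)
    (hmem : ∀ i j, i + j ≤ k → MemLp (D i j) 2 (volume.restrict halfPlane))
    (hD : ∀ i j, i + j ≤ k → eLpNorm (D i j) 2 (volume.restrict halfPlane) ≤ ENNReal.ofReal M)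
    {i j : ℕ} (hij : i + j + 2 ≤ k) (q : ℝ × ℝ) (hq : b.rOut < q.2) :
    |moll b (D i j) q| ≤ 4 * M := by
  have c0 := continuous_moll b (hmem i j (by omega))
  have c1 := continuous_moll b (hmem (i + 1) j (by omega))
  have c2 := continuous_moll b (hmem i (j + 1) (by omega))
  have c3 := continuous_moll b (hmem (i + 1) (j + 1) (by omega))
  have h1 := sq_le_setIntegral_square c0 c1 c2 c3 (δ := b.rOut)
    (fun q s h => hasDerivAt_moll b (hjet.2 i j (by omega)).1 (hmem i j (by omega)) q s h)
    (fun q s h => hasDerivAt_moll b (hjet.2 i j (by omega)).2 (hmem i j (by omega)) q s h)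
    (fun q s h => hasDerivAt_moll b (hjet.2 (i + 1) j (by omega)).2 (hmem (i + 1) j (by omega)) q s h)
    q hq
  have hS : IsCompact (Icc (0 : ℝ) 1 ×ˢ Icc (0 : ℝ) 1) := isCompact_Icc.prod isCompact_Icc
  have hi : ∀ {G : ℝ × ℝ → ℝ}, Continuous G →
      IntegrableOn (fun z => G (q + z) ^ 2) (Icc (0 : ℝ) 1 ×ˢ Icc (0 : ℝ) 1) := fun hG =>
    ContinuousOn.integrableOn_compact hS (by fun_prop)
  have hi2 : ∀ {G G' : ℝ × ℝ → ℝ}, Continuous G → Continuous G' →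
      IntegrableOn (fun z => G (q + z) ^ 2 + G' (q + z) ^ 2) (Icc (0 : ℝ) 1 ×ˢ Icc (0 : ℝ) 1) :=
    fun hG hG' => (hi hG).add (hi hG')
  rw [integral_add (hi2 c0 c2) (hi2 c1 c3), integral_add (hi c0) (hi c2),
    integral_add (hi c1) (hi c3)] at h1
  have d0 := setIntegral_moll_sq_le b (hmem i j (by omega)) hM (hD i j (by omega)) hS q
  have d1 := setIntegral_moll_sq_le b (hmem (i + 1) j (by omega)) hM (hD (i + 1) j (by omega)) hS q
  have d2 := setIntegral_moll_sq_le b (hmem i (j + 1) (by omega)) hM (hD i (j + 1) (by omega)) hS q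
  have d3 := setIntegral_moll_sq_le b (hmem (i + 1) (j + 1) (by omega)) hM
    (hD (i + 1) (j + 1) (by omega)) hS q
  exact abs_le_of_sq_le_sq (by nlinarith) (by positivity)

/-- A continuous function on the half plane that lies in `H³` is bounded and Lipschitz. -/
lemma bounded_lipschitz_of_sobolevNorm {k : ℕ} (hk : 3 ≤ k) {w : ℝ × ℝ → ℝ}
    (hw : ContinuousOn w halfPlane) {C : ℝ} (hC : 0 ≤ C)
    (h : sobolevNorm k w ≤ ENNReal.ofReal C) :
    (∀ q ∈ halfPlane, |w q| ≤ 4 * (C + 1)) ∧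
    (∀ q ∈ halfPlane, ∀ s : ℝ, |w (q + s • ((1 : ℝ), (0 : ℝ))) - w q| ≤ 4 * (C + 1) * |s|) ∧
    (∀ q ∈ halfPlane, ∀ s : ℝ, 0 ≤ s →
      |w (q + s • ((0 : ℝ), (1 : ℝ))) - w q| ≤ 4 * (C + 1) * |s|) := by
  -- The norm is an infimum over weak jets; the extra 1 makes the inequality strict, so that an
  -- actual jet can be picked.
  have hlt : sobolevNorm k w < ENNReal.ofReal (C + 1) :=
    h.trans_lt ((ENNReal.ofReal_lt_ofReal_iff (by linarith)).2 (by linarith))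
  simp only [sobolevNorm, iInf_lt_iff] at hlt
  obtain ⟨D, hjet, hD⟩ := hlt
  have hle : ∀ i j, i + j ≤ k →
      eLpNorm (D i j) 2 (volume.restrict halfPlane) ≤ ENNReal.ofReal (C + 1) := by
    intro i j hij
    refine le_trans ?_ hD.le
    have h1 : eLpNorm (D i j) 2 (volume.restrict halfPlane) ^ 2 ≤
        ∑ i ∈ Finset.range (k + 1), ∑ j ∈ Finset.range (k + 1 - i),
          eLpNorm (D i j) 2 (volume.restrict halfPlane) ^ 2 := by
      refine le_trans ?_ (Finset.single_le_sum (f := fun i => ∑ j ∈ Finset.range (k + 1 - i),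
        eLpNorm (D i j) 2 (volume.restrict halfPlane) ^ 2) (fun _ _ => zero_le)
        (Finset.mem_range.2 (by omega : i < k + 1)))
      exact Finset.single_le_sum (f := fun j => eLpNorm (D i j) 2 (volume.restrict halfPlane) ^ 2)
        (fun _ _ => zero_le) (Finset.mem_range.2 (by omega : j < k + 1 - i))
    have h2 := ENNReal.rpow_le_rpow h1 (by norm_num : (0 : ℝ) ≤ 1 / 2)
    rwa [← ENNReal.rpow_natCast, ← ENNReal.rpow_mul,
      show ((2 : ℕ) : ℝ) * (1 / 2) = 1 by norm_num, ENNReal.rpow_one] at h2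
  have hmeas : ∀ i j, i + j ≤ k → AEStronglyMeasurable (D i j) (volume.restrict halfPlane) := by
    intro i j hij
    rcases Nat.eq_zero_or_pos (i + j) with h0 | h0
    · have : i + j < k := by omega
      exact (hjet.2 i j this).1.1.aestronglyMeasurable
    · rcases i with _ | i
      · rcases j with _ | j
        · omega
        · exact (hjet.2 0 j (by omega)).2.2.1.aestronglyMeasurable
      · exact (hjet.2 i j (by omega)).1.2.1.aestronglyMeasurable
  have hmem : ∀ i j, i + j ≤ k → MemLp (D i j) 2 (volume.restrict halfPlane) := fun i j hij =>
    ⟨hmeas i j hij, (hle i j hij).trans_lt ENNReal.ofReal_lt_top⟩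
  have hC1 : 0 ≤ C + 1 := by linarith
  let b : ℕ → ContDiffBump (0 : ℝ × ℝ) := fun n =>
    ⟨1 / (2 * ((n : ℝ) + 1)), 1 / ((n : ℝ) + 1), by positivity, by
      rw [div_lt_div_iff₀ (by positivity) (by positivity)]
      have : (0 : ℝ) < (n : ℝ) + 1 := by positivity
      linarith⟩
  have hb : ∀ n, (b n).rOut = 1 / ((n : ℝ) + 1) := fun n => rfl
  have hbt : Tendsto (fun n => (b n).rOut) atTop (𝓝 0) := tendsto_one_div_add_atTop_nhds_zero_nat
  have hlim : ∀ q ∈ halfPlane, Tendsto (fun n => moll (b n) (D 0 0) q) atTop (𝓝 (w q)) := by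
    intro q hq
    have hcq : ContinuousAt (halfPlane.indicator w) q := by
      refine (hw.continuousAt (isOpen_halfPlane.mem_nhds hq)).congr ?_
      filter_upwards [isOpen_halfPlane.mem_nhds hq] with z hz
      rw [indicator_of_mem hz]
    have := ContDiffBump.convolution_tendsto_right (μ := (volume : Measure (ℝ × ℝ))) (φ := b)
      (l := atTop) (g := fun _ => halfPlane.indicator w) (k := fun _ => q) (x₀ := q)
      (z₀ := halfPlane.indicator w q) hbt
      (Eventually.of_forall fun _ => (hjet.1 ▸ (memLp_halfPlane_indicator (hmem 0 0 (by omega))).1))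
      (hcq.tendsto.comp tendsto_snd) tendsto_const_nhds
    rw [indicator_of_mem hq] at this
    rw [hjet.1]
    exact this
  have hev : ∀ q ∈ halfPlane, ∀ᶠ n in atTop, (b n).rOut < q.2 := fun q hq =>
    hbt.eventually_lt_const hq.2
  -- Each sup bound costs two further derivatives; bounding first derivatives therefore uses 3 ≤ k.
  -- The bounds are uniform in the mollification and survive the limit by continuity of w.
  have hlipm : ∀ e : ℝ × ℝ, 0 ≤ e.2 → ∀ i j, i + j ≤ 1 →
      HasWeakDeriv halfPlane e (D 0 0) (D i j) → ∀ q : ℝ × ℝ, ∀ n, (b n).rOut < q.2 →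
      ∀ s : ℝ, (0 ≤ s ∨ e.2 = 0) →
        |moll (b n) (D 0 0) (q + s • e) - moll (b n) (D 0 0) q| ≤ 4 * (C + 1) * |s| := by
    intro e he i j hij hwd q n hn s hs
    have hpos : ∀ r ∈ uIcc 0 s, (b n).rOut < (q + r • e).2 := by
      intro r hr
      rcases hs with hs | hs
      · rw [uIcc_of_le hs] at hr
        have : 0 ≤ r * e.2 := mul_nonneg hr.1 he
        simp; linarith
      · simp [hs, hn]
    have h1 := (convex_uIcc (0 : ℝ) s).norm_image_sub_le_of_norm_hasDerivWithin_le
      (f := fun s : ℝ => moll (b n) (D 0 0) (q + s • e))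
      (f' := fun s : ℝ => moll (b n) (D i j) (q + s • e)) (C := 4 * (C + 1))
      (fun r hr => (hasDerivAt_moll (b n) hwd (hmem 0 0 (by omega)) q r
        (hpos r hr)).hasDerivWithinAt)
      (fun r hr => abs_moll_le (b n) hjet hC1 hmem hle (by omega) _ (hpos r hr))
      left_mem_uIcc right_mem_uIcc
    simpa using h1
  refine ⟨fun q hq => ?_, fun q hq s => ?_, fun q hq s hs => ?_⟩
  · refine le_of_tendsto (hlim q hq).abs ?_
    filter_upwards [hev q hq] with n hn
    exact abs_moll_le (b n) hjet hC1 hmem hle (by omega) q hn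
  · have hq' : q + s • ((1 : ℝ), (0 : ℝ)) ∈ halfPlane := by simpa [halfPlane] using hq
    refine le_of_tendsto ((hlim _ hq').sub (hlim q hq)).abs ?_
    filter_upwards [hev q hq] with n hn
    exact hlipm (1, 0) le_rfl 1 0 le_rfl (hjet.2 0 0 (by omega)).1 q n hn s (Or.inr rfl)
  · have hq' : q + s • ((0 : ℝ), (1 : ℝ)) ∈ halfPlane := by
      have : 0 < q.2 := hq.2
      simp [halfPlane]; linarith
    refine le_of_tendsto ((hlim _ hq').sub (hlim q hq)).abs ?_
    filter_upwards [hev q hq] with n hn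
    exact hlipm (0, 1) zero_le_one 0 1 le_rfl (hjet.2 0 0 (by omega)).2 q n hn s (Or.inl hs)

/-! ### Bounds for the coefficients -/

/-- The essential supremum controls almost every t only; continuity in t recovers the remaining
ones. -/
lemma le_of_ae_le_Ioo {T K : ℝ} {g : ℝ → ℝ} (hg : ContinuousOn g (Ioo 0 T))
    (h : ∀ᵐ t ∂(volume.restrict (Ioo 0 T)), g t ≤ K) : ∀ t ∈ Ioo 0 T, g t ≤ K := by
  intro t ht
  have h1 : (fun t => min (g t) K) =ᵐ[volume.restrict (Ioo 0 T)] g := by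
    filter_upwards [h] with t ht using min_eq_left ht
  have h2 := Measure.eqOn_open_of_ae_eq h1 isOpen_Ioo
    (continuous_min.comp_continuousOn (hg.prodMk continuousOn_const)) hg ht
  exact min_eq_left_iff.1 h2

lemma abs_sub_le_of_deriv {f f' G G' : ℝ → ℝ} {a b : ℝ} (hab : a ≤ b)
    (hf : ContinuousOn f (Icc a b)) (hG : ContinuousOn G (Icc a b))
    (hf' : ∀ x ∈ Ioo a b, HasDerivAt f (f' x) x) (hG' : ∀ x ∈ Ioo a b, HasDerivAt G (G' x) x)
    (h : ∀ x ∈ Ioo a b, |f' x| ≤ G' x) : |f b - f a| ≤ G b - G a := by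
  have ha : a ∈ Icc a b := left_mem_Icc.2 hab
  have hb : b ∈ Icc a b := right_mem_Icc.2 hab
  have h1 : MonotoneOn (fun x => G x - f x) (Icc a b) := by
    refine monotoneOn_of_hasDerivWithinAt_nonneg (f' := fun x => G' x - f' x) (convex_Icc a b)
      (hG.sub hf) (fun x hx => ?_) (fun x hx => ?_)
    · rw [interior_Icc] at hx
      exact ((hG' x hx).sub (hf' x hx)).hasDerivWithinAt
    · rw [interior_Icc] at hx
      linarith [le_abs_self (f' x), h x hx]
  have h2 : MonotoneOn (fun x => G x + f x) (Icc a b) := by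
    refine monotoneOn_of_hasDerivWithinAt_nonneg (f' := fun x => G' x + f' x) (convex_Icc a b)
      (hG.add hf) (fun x hx => ?_) (fun x hx => ?_)
    · rw [interior_Icc] at hx
      exact ((hG' x hx).add (hf' x hx)).hasDerivWithinAt
    · rw [interior_Icc] at hx
      linarith [neg_abs_le (f' x), h x hx]
  have h3 := h1 ha hb hab
  have h4 := h2 ha hb hab
  simp only at h3 h4
  rw [abs_le]; constructor <;> linarith

lemma abs_sub_le_mul {f f' : ℝ → ℝ} {a b K : ℝ} (hab : a ≤ b) (hf : ContinuousOn f (Icc a b))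
    (hf' : ∀ x ∈ Ioo a b, HasDerivAt f (f' x) x) (h : ∀ x ∈ Ioo a b, |f' x| ≤ K) :
    |f b - f a| ≤ K * (b - a) := by
  have := abs_sub_le_of_deriv (G := fun x => K * x) (G' := fun _ => K) hab hf (by fun_prop) hf'
    (fun x _ => by simpa using (hasDerivAt_id x).const_mul K) h
  linarith

lemma abs_sub_le_mul_abs {f f' : ℝ → ℝ} {K : ℝ} (hf' : ∀ x, HasDerivAt f (f' x) x)
    (h : ∀ x, |f' x| ≤ K) (x s : ℝ) : |f (x + s) - f x| ≤ K * |s| := by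
  have := convex_univ.norm_image_sub_le_of_norm_hasDerivWithin_le (s := (univ : Set ℝ)) (f := f)
    (f' := f') (C := K) (fun x _ => (hf' x).hasDerivWithinAt) (fun x _ => h x) (mem_univ x)
    (mem_univ (x + s))
  simpa using this

/-- From ⟨y⟩ ≤ 1 + y ≤ (1 + σ/(4c))e^{4cy/σ}, raised to the power σ/2. It converts the decay of ∂_x
u, and later that of the squared cutoff, into the weight of the main norm. -/
lemma exp_le_bracket_rpow {c σ : ℝ} (hc : 0 < c) (hσ : 0 < σ) {y : ℝ} (hy : 0 ≤ y) :
    Real.exp (-(2 * c) * y) ≤ (1 + σ / (4 * c)) ^ (σ / 2) * bracket y ^ (-σ / 2) := by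
  set m := 1 + σ / (4 * c) with hm
  have hd : 0 < σ / (4 * c) := by positivity
  have hm1 : 0 < m := by positivity
  have h1 : bracket y ≤ m * Real.exp (4 * c / σ * y) := by
    have h2 := bracket_le y
    rw [abs_of_nonneg hy] at h2
    have h3 := Real.add_one_le_exp (4 * c / σ * y)
    have h4 : σ / (4 * c) * (4 * c / σ * y) = y := by field_simp
    have h5 : 0 ≤ 4 * c / σ * y := by positivity
    nlinarith
  have h2 : bracket y ^ (σ / 2) ≤ m ^ (σ / 2) * Real.exp (2 * c * y) := by
    refine (Real.rpow_le_rpow (bracket_pos y).le h1 (by positivity)).trans (le_of_eq ?_)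
    rw [Real.mul_rpow hm1.le (Real.exp_pos _).le, ← Real.exp_mul]
    congr 2; field_simp; ring
  have h3 : 0 < bracket y ^ (σ / 2) := Real.rpow_pos_of_pos (bracket_pos y) _
  rw [neg_div, Real.rpow_neg (bracket_pos y).le, ← div_eq_mul_inv, le_div_iff₀ h3, neg_mul,
    Real.exp_neg, inv_mul_le_iff₀ (Real.exp_pos _)]
  linarith

lemma mem_slab_add_x {T : ℝ} (s : ℝ) (p : R3) : p + (0, s, 0) ∈ slab T ↔ p ∈ slab T := by
  simp [slab]

lemma mem_slab_add_y {T : ℝ} {s : ℝ} {p : R3} (hs : 0 ≤ s) (hp : 0 < p.2.2) :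
    p + (0, 0, s) ∈ slab T ↔ p ∈ slab T := by
  have : 0 < p.2.2 + s := by linarith
  simp [slab, hp, this]

section Decay

variable {T c C₀ : ℝ} {N : ℕ} {u v : R3 → ℝ}

/-- The Lipschitz bounds for `e^{2cy} ∂_x u` that follow from the Sobolev inequality. -/
lemma HasDecay.pointwise (h : HasDecay T c C₀ N u) (hN : 3 ≤ N) (hC₀ : 0 < C₀)
    (hcont : ContinuousOn (dx u) (slab T)) (p : R3) (hp : p ∈ slab T) :
    |Real.exp (2 * c * p.2.2) * dx u p| ≤ 4 * (C₀ + 1) ∧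
    (∀ s : ℝ, |Real.exp (2 * c * p.2.2) * dx u (p + (0, s, 0)) -
      Real.exp (2 * c * p.2.2) * dx u p| ≤ 4 * (C₀ + 1) * |s|) ∧
    (∀ s : ℝ, 0 ≤ s → |Real.exp (2 * c * (p.2.2 + s)) * dx u (p + (0, 0, s)) -
      Real.exp (2 * c * p.2.2) * dx u p| ≤ 4 * (C₀ + 1) * |s|) := by
  have hae : ∀ᵐ t ∂(volume.restrict (Ioo 0 T)),
      sobolevNorm N (expWeight c (dx u) t) ≤ ENNReal.ofReal C₀ := by
    filter_upwards [ENNReal.ae_le_essSup (μ := volume.restrict (Ioo 0 T))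
      (fun t => sobolevNorm N (expWeight c (dx u) t))] with t ht
    exact ht.trans (le_self_add.trans h)
  have hslice : ∀ (q : ℝ × ℝ), q ∈ halfPlane →
      ContinuousOn (fun t => expWeight c (dx u) t q) (Ioo 0 T) := by
    intro q hq
    refine continuousOn_const.mul (hcont.comp (by fun_prop) fun t ht => ⟨ht, hq⟩)
  have hae' : ∀ᵐ t ∂(volume.restrict (Ioo 0 T)), ContinuousOn (expWeight c (dx u) t) halfPlane := by
    filter_upwards [ae_restrict_mem measurableSet_Ioo] with t ht
    refine ContinuousOn.mul (by fun_prop) (hcont.comp (by fun_prop) fun q hq => ⟨ht, hq⟩)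
  have hall := (hae.and hae').mono fun t h =>
    bounded_lipschitz_of_sobolevNorm hN h.2 hC₀.le h.1
  obtain ⟨t, x, y⟩ := p
  have hq : ((x, y) : ℝ × ℝ) ∈ halfPlane := hp.2
  refine ⟨?_, fun s => ?_, fun s hs => ?_⟩
  · exact le_of_ae_le_Ioo (hslice _ hq).abs (hall.mono fun t h => h.1 _ hq) t hp.1
  · have hq' : ((x, y) + s • ((1 : ℝ), (0 : ℝ)) : ℝ × ℝ) ∈ halfPlane := by
      simpa [halfPlane] using hq
    have := le_of_ae_le_Ioo ((hslice _ hq').sub (hslice _ hq)).abs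
      (hall.mono fun t h => h.2.1 _ hq s) t hp.1
    simpa [expWeight] using this
  · have hq' : ((x, y) + s • ((0 : ℝ), (1 : ℝ)) : ℝ × ℝ) ∈ halfPlane := by
      have : 0 < y := hq.2
      simp [halfPlane]; linarith
    have := le_of_ae_le_Ioo ((hslice _ hq').sub (hslice _ hq)).abs
      (hall.mono fun t h => h.2.2 _ hq s hs) t hp.1
    simpa [expWeight] using this

lemma HasDecay.abs_dx_le (h : HasDecay T c C₀ N u) (hN : 3 ≤ N) (hC₀ : 0 < C₀)
    (hcont : ContinuousOn (dx u) (slab T)) {p : R3} (hp : p ∈ slab T) :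
    |dx u p| ≤ 4 * (C₀ + 1) * Real.exp (-(2 * c) * p.2.2) := by
  have h1 := (h.pointwise hN hC₀ hcont p hp).1
  rw [abs_mul, abs_of_pos (Real.exp_pos _)] at h1
  rw [neg_mul, Real.exp_neg, ← div_eq_mul_inv, le_div_iff₀ (Real.exp_pos _)]
  linarith

lemma HasDecay.abs_dx_sub_x_le (h : HasDecay T c C₀ N u) (hN : 3 ≤ N) (hC₀ : 0 < C₀)
    (hcont : ContinuousOn (dx u) (slab T)) {p : R3} (hp : p ∈ slab T) (s : ℝ) :
    |dx u (p + (0, s, 0)) - dx u p| ≤ 4 * (C₀ + 1) * |s| * Real.exp (-(2 * c) * p.2.2) := by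
  have h1 := (h.pointwise hN hC₀ hcont p hp).2.1 s
  rw [← mul_sub, abs_mul, abs_of_pos (Real.exp_pos _)] at h1
  rw [neg_mul, Real.exp_neg, ← div_eq_mul_inv, le_div_iff₀ (Real.exp_pos _)]
  linarith

lemma HasDecay.abs_dx_sub_y_le (h : HasDecay T c C₀ N u) (hN : 3 ≤ N) (hC₀ : 0 < C₀)
    (hc : 0 < c) (hcont : ContinuousOn (dx u) (slab T)) {p : R3} (hp : p ∈ slab T) {s : ℝ}
    (hs : 0 ≤ s) : |dx u (p + (0, 0, s)) - dx u p| ≤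
      (1 + 2 * c) * (4 * (C₀ + 1)) * s * Real.exp (-(2 * c) * p.2.2) := by
  have h1 := (h.pointwise hN hC₀ hcont p hp).2.2 s hs
  have h0 := (h.pointwise hN hC₀ hcont p hp).1
  rw [abs_of_nonneg hs] at h1
  set K := 4 * (C₀ + 1)
  set A := Real.exp (2 * c * p.2.2) * dx u p with hA
  set B := Real.exp (2 * c * (p.2.2 + s)) * dx u (p + (0, 0, s)) with hB
  have eA : dx u p = Real.exp (-(2 * c) * p.2.2) * A := by
    rw [hA, ← mul_assoc, ← Real.exp_add]; simp
  have eB : dx u (p + (0, 0, s)) = Real.exp (-(2 * c) * p.2.2) * (Real.exp (-(2 * c) * s) * B) := by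
    rw [hB, ← mul_assoc, ← mul_assoc, ← Real.exp_add, ← Real.exp_add]
    rw [show -(2 * c) * p.2.2 + -(2 * c) * s + 2 * c * (p.2.2 + s) = 0 by ring]; simp
  have hex : Real.exp (-(2 * c) * s) ≤ 1 := Real.exp_le_one_iff.2 (by nlinarith)
  have hex' : 1 - 2 * c * s ≤ Real.exp (-(2 * c) * s) := by
    have := Real.add_one_le_exp (-(2 * c) * s); linarith
  rw [eA, eB, ← mul_sub, abs_mul, abs_of_pos (Real.exp_pos _), mul_comm]
  refine mul_le_mul_of_nonneg_right ?_ (Real.exp_pos _).le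
  have e : Real.exp (-(2 * c) * s) * B - A =
      Real.exp (-(2 * c) * s) * (B - A) - (1 - Real.exp (-(2 * c) * s)) * A := by ring
  rw [e]
  refine (abs_sub _ _).trans ?_
  rw [abs_mul, abs_mul, abs_of_pos (Real.exp_pos _),
    abs_of_nonneg (by linarith : 0 ≤ 1 - Real.exp (-(2 * c) * s))]
  have hK : 0 ≤ K := (abs_nonneg _).trans h0
  calc _ ≤ 1 * (K * s) + (2 * c * s) * K := by
        gcongr
        linarith
    _ = _ := by ring

end Decay

/-- The bounds on the coefficients of the linearized equation that enter the estimates. -/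
structure FlowBound (T σ K : ℝ) (u uy v vy : R3 → ℝ) : Prop where
  coef_u : IsCoef (fun p => (u p : ℂ))
  coef_uy : IsCoef (fun p => (uy p : ℂ))
  coef_v : IsCoef (fun p => (v p : ℂ))
  coef_vy : IsCoef (fun p => (vy p : ℂ))
  u_nonneg : ∀ p, 0 ≤ u p
  u_le : ∀ p, |u p| ≤ K
  uy_le : ∀ p, |uy p| ≤ K
  v_le : ∀ p, |v p| ≤ K
  vy_le : ∀ p, |vy p| ≤ K
  ydiff_u : YDiff (fun p => (u p : ℂ)) (fun p => (uy p : ℂ))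
  ydiff_v : YDiff (fun p => (v p : ℂ)) (fun p => (vy p : ℂ))
  u_le_mul : ∀ p : R3, 0 < p.2.2 → |u p| ≤ K * p.2.2
  u_lip : ∀ (s : ℝ) (p : R3), |u (p + (0, s, 0)) - u p| ≤ K * |s|
  v_lip : ∀ (s : ℝ) (p : R3), |v (p + (0, s, 0)) - v p| ≤ K * |s|
  uy_lip : ∀ (s : ℝ) (p : R3), |uy (p + (0, s, 0)) - uy p| ≤ |s| * (K * bracket p.2.2 ^ (-σ / 2))
  uy_weight : ∀ p : R3, |uy p| ≤ K * bracket p.2.2 ^ (-σ)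
  uy_lower : ∀ p ∈ slab T, K⁻¹ * bracket p.2.2 ^ (-σ) ≤ uy p

lemma isCoef_indicator_slab {T K : ℝ} {a : R3 → ℝ} (ha : ContinuousOn a (slab T))
    (hK : ∀ p ∈ slab T, |a p| ≤ K) (hK0 : 0 ≤ K) :
    IsCoef (fun p => (((slab T).indicator a p : ℝ) : ℂ)) := by
  refine IsCoef.of_real (K := K) ?_ fun p => ?_
  · classical
    rw [← Set.piecewise_eq_indicator]
    exact ha.measurable_piecewise continuousOn_const (measurableSet_slab T)
  · by_cases hp : p ∈ slab T <;> simp [hp, hK, hK0]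

lemma yDiff_indicator_slab {T K : ℝ} {a a' : R3 → ℝ} (ha : ContinuousOn a (slab T))
    (ha' : ContinuousOn a' (slab T)) (hK : ∀ p ∈ slab T, |a p| ≤ K)
    (hK' : ∀ p ∈ slab T, |a' p| ≤ K) (hK0 : 0 ≤ K)
    (hd : ∀ p ∈ slab T, HasDerivAt (fun s => a (p.1, p.2.1, s)) (a' p) p.2.2) :
    YDiff (fun p => (((slab T).indicator a p : ℝ) : ℂ)) (fun p => (((slab T).indicator a' p : ℝ) : ℂ)) := by
  refine ⟨isCoef_indicator_slab ha hK hK0, isCoef_indicator_slab ha' hK' hK0,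
    ⟨K, fun p hp s hs => ?_⟩, fun p hp => ?_⟩
  · rw [← Complex.ofReal_sub, Complex.norm_real, Real.norm_eq_abs]
    by_cases hm : p ∈ slab T
    · have hmem : ∀ y, 0 < y → ((p.1, p.2.1, y) : R3) ∈ slab T := fun y hy => ⟨hm.1, mem_univ _, hy⟩
      have hdy : ∀ y, 0 < y → HasDerivAt (fun s => a (p.1, p.2.1, s)) (a' (p.1, p.2.1, y)) y :=
        fun y hy => hd _ (hmem y hy)
      rw [indicator_of_mem hm, indicator_of_mem ((mem_slab_add_y (le_of_lt hs) hp).2 hm)]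
      have := abs_sub_le_mul (f := fun s => a (p.1, p.2.1, s)) (a := p.2.2) (b := p.2.2 + s) (K := K)
        (by linarith) (fun y hy => (hdy y (by linarith [hy.1])).continuousAt.continuousWithinAt)
        (fun y hy => hdy y (by linarith [hy.1])) (fun y hy => hK' _ (hmem y (by linarith [hy.1])))
      have e : p + (0, 0, s) = (p.1, p.2.1, p.2.2 + s) := by ext <;> simp
      rw [e]
      linarith
    · rw [indicator_of_notMem hm, indicator_of_notMem fun h => hm ((mem_slab_add_y (le_of_lt hs) hp).1 h)]
      simp only [sub_self, abs_zero]
      have : 0 < s := hs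
      positivity
  · by_cases hm : p ∈ slab T
    · rw [indicator_of_mem hm, indicator_of_mem hm]
      have h3 := (hasDerivAt_iff_tendsto_slope_zero.1 (hd p hm)).mono_left
        (nhdsWithin_mono 0 (fun s hs => ne_of_gt hs : Ioi (0 : ℝ) ⊆ {0}ᶜ))
      refine ((Complex.continuous_ofReal.tendsto _).comp h3).congr' ?_
      filter_upwards [self_mem_nhdsWithin] with s hs
      have hs : (0 : ℝ) < s := hs
      rw [indicator_of_mem ((mem_slab_add_y hs.le hp).2 hm)]
      have e : p + (0, 0, s) = (p.1, p.2.1, p.2.2 + s) := by ext <;> simp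
      rw [e]
      simp
    · rw [indicator_of_notMem hm, indicator_of_notMem hm, Complex.ofReal_zero]
      refine tendsto_const_nhds.congr' ?_
      filter_upwards [self_mem_nhdsWithin] with s hs
      rw [indicator_of_notMem fun h => hm ((mem_slab_add_y (le_of_lt hs) hp).1 h)]
      simp

lemma indicator_slab_lip {T : ℝ} {a L : R3 → ℝ} (hL : ∀ p, 0 ≤ L p)
    (h : ∀ p ∈ slab T, ∀ s : ℝ, |a (p + (0, s, 0)) - a p| ≤ |s| * L p) (s : ℝ) (p : R3) :
    |(slab T).indicator a (p + (0, s, 0)) - (slab T).indicator a p| ≤ |s| * L p := by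
  by_cases hm : p ∈ slab T
  · rw [indicator_of_mem hm, indicator_of_mem ((mem_slab_add_x s p).2 hm)]
    exact h p hm s
  · rw [indicator_of_notMem hm, indicator_of_notMem fun h => hm ((mem_slab_add_x s p).1 h)]
    simp only [sub_self, abs_zero]
    exact mul_nonneg (abs_nonneg _) (hL p)

lemma indicator_slab_abs_le {T : ℝ} {a L : R3 → ℝ} (hL : ∀ p, 0 < p.2.2 → 0 ≤ L p)
    (h : ∀ p ∈ slab T, |a p| ≤ L p) (p : R3) (hp : 0 < p.2.2) : |(slab T).indicator a p| ≤ L p := by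
  by_cases hm : p ∈ slab T
  · rw [indicator_of_mem hm]; exact h p hm
  · rw [indicator_of_notMem hm, abs_zero]; exact hL p hp

lemma indicator_slab_abs_le' {T : ℝ} {a L : R3 → ℝ} (hL : ∀ p, 0 ≤ L p)
    (h : ∀ p ∈ slab T, |a p| ≤ L p) (p : R3) : |(slab T).indicator a p| ≤ L p := by
  by_cases hm : p ∈ slab T
  · rw [indicator_of_mem hm]; exact h p hm
  · rw [indicator_of_notMem hm, abs_zero]; exact hL p

lemma bracket_rpow_neg_le_one {σ : ℝ} (hσ : 0 ≤ σ) (y : ℝ) : bracket y ^ (-σ) ≤ 1 :=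
  Real.rpow_le_one_of_one_le_of_nonpos (one_le_bracket y) (by linarith)

/-! ### Pointwise bounds for u, ∂_y u and v. -/

section Flow

variable {T σ Cs c C₀ : ℝ} {N : ℕ} {u v : R3 → ℝ}

lemma IsPrandtlSolution.continuousOn_y_u (hP : IsPrandtlSolution T u v) {p : R3} (ht : p.1 ∈ Ioo 0 T) :
    ContinuousOn (fun y => u (p.1, p.2.1, y)) (Ici 0) :=
  hP.continuousOn_u.comp (by fun_prop) fun _ hy => ⟨Ioo_subset_Icc_self ht, mem_univ _, hy⟩

lemma IsPrandtlSolution.continuousOn_y_v (hP : IsPrandtlSolution T u v) {p : R3} (ht : p.1 ∈ Ioo 0 T) :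
    ContinuousOn (fun y => v (p.1, p.2.1, y)) (Ici 0) :=
  hP.continuousOn_v.comp (by fun_prop) fun _ hy => ⟨ht, mem_univ _, hy⟩

lemma IsPrandtlSolution.hasDerivAt_u_y (hP : IsPrandtlSolution T u v) {p : R3} (hp : p ∈ slab T) :
    HasDerivAt (fun y => u (p.1, p.2.1, y)) (dy u p) p.2.2 :=
  (hP.diff p hp).2.2.1.hasDerivAt

lemma IsPrandtlSolution.hasDerivAt_u_x (hP : IsPrandtlSolution T u v) {p : R3} (hp : p ∈ slab T) :
    HasDerivAt (fun x => u (p.1, x, p.2.2)) (dx u p) p.2.1 :=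
  (hP.diff p hp).2.1.hasDerivAt

lemma IsPrandtlSolution.hasDerivAt_v_y (hP : IsPrandtlSolution T u v) {p : R3} (hp : p ∈ slab T) :
    HasDerivAt (fun y => v (p.1, p.2.1, y)) (-dx u p) p.2.2 := by
  have h := (hP.diff p hp).2.2.2.2.hasDerivAt
  have h2 : dy v p = -dx u p := by linarith [hP.divergence p hp]
  rw [← h2]; exact h

lemma IsMonotoneFlow.dy_bounds (hM : IsMonotoneFlow T σ Cs u) (hσ : 0 < σ) (hCs : 0 < Cs) {p : R3}
    (hp : p ∈ slab T) : 0 < dy u p ∧ dy u p ≤ Cs * bracket p.2.2 ^ (-σ) ∧ dy u p ≤ Cs := by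
  obtain ⟨-, h1, h2, -⟩ := hM p hp
  have h3 : 0 < Cs⁻¹ * bracket p.2.2 ^ (-σ) :=
    mul_pos (inv_pos.2 hCs) (Real.rpow_pos_of_pos (bracket_pos _) _)
  have h4 := bracket_rpow_neg_le_one hσ.le p.2.2
  exact ⟨h3.trans_le h1, h2, h2.trans (by nlinarith)⟩

lemma IsPrandtlSolution.u_bounds (hP : IsPrandtlSolution T u v) (hM : IsMonotoneFlow T σ Cs u)
    (hσ : 0 < σ) (hCs : 0 < Cs) {p : R3} (hp : p ∈ slab T) :
    0 ≤ u p ∧ u p ≤ 1 ∧ u p ≤ Cs * p.2.2 := by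
  have hy : 0 < p.2.2 := hp.2.2
  set U : ℝ → ℝ := fun y => u (p.1, p.2.1, y) with hU
  have hmem : ∀ y, 0 < y → ((p.1, p.2.1, y) : R3) ∈ slab T := fun y hy => ⟨hp.1, mem_univ _, hy⟩
  have hd : ∀ y, 0 < y → HasDerivAt U (dy u (p.1, p.2.1, y)) y := fun y hy =>
    hP.hasDerivAt_u_y (hmem y hy)
  have hc : ContinuousOn U (Ici 0) := hP.continuousOn_y_u hp.1
  have h0 : U 0 = 0 := (hP.boundary p.1 hp.1 p.2.1).1
  have hmono : MonotoneOn U (Ici 0) := by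
    refine monotoneOn_of_hasDerivWithinAt_nonneg (f' := fun y => dy u (p.1, p.2.1, y))
      (convex_Ici 0) hc (fun y hy => ?_) (fun y hy => ?_)
    · rw [interior_Ici] at hy
      exact (hd y hy).hasDerivWithinAt
    · rw [interior_Ici] at hy
      exact (hM.dy_bounds hσ hCs (hmem y hy)).1.le
  refine ⟨?_, ?_, ?_⟩
  · have := hmono (mem_Ici.2 le_rfl) (mem_Ici.2 hy.le) hy.le
    rw [h0] at this; exact this
  · refine ge_of_tendsto (hP.outflow p.1 hp.1 p.2.1) ?_
    filter_upwards [eventually_ge_atTop p.2.2] with y hy'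
    exact hmono (mem_Ici.2 hy.le) (mem_Ici.2 (hy.le.trans hy')) hy'
  · have := abs_sub_le_mul (f := U) hy.le (hc.mono Icc_subset_Ici_self) (fun y hy => hd y hy.1)
      (K := Cs) (fun y hy => by
        have h := hM.dy_bounds hσ hCs (hmem y hy.1)
        rw [abs_of_pos h.1]; exact h.2.2)
    rw [h0, sub_zero, sub_zero] at this
    exact (le_abs_self _).trans this

lemma IsPrandtlSolution.u_lip (hP : IsPrandtlSolution T u v) (hD : HasDecay T c C₀ N u)
    (hN : 3 ≤ N) (hC₀ : 0 < C₀) (hc : 0 < c) {p : R3} (hp : p ∈ slab T) (s : ℝ) :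
    |u (p + (0, s, 0)) - u p| ≤ 4 * (C₀ + 1) * |s| := by
  have hmem : ∀ x, ((p.1, x, p.2.2) : R3) ∈ slab T := fun x => ⟨hp.1, mem_univ _, hp.2.2⟩
  have := abs_sub_le_mul_abs (f := fun x => u (p.1, x, p.2.2))
    (f' := fun x => dx u (p.1, x, p.2.2)) (K := 4 * (C₀ + 1))
    (fun x => hP.hasDerivAt_u_x (hmem x))
    (fun x => (hD.abs_dx_le hN hC₀ hP.continuousOn_dx (hmem x)).trans (by
      have h1 : Real.exp (-(2 * c) * p.2.2) ≤ 1 := Real.exp_le_one_iff.2 (by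
        have : 0 < p.2.2 := hp.2.2
        nlinarith)
      simp only
      nlinarith)) p.2.1 s
  have e : p + (0, s, 0) = (p.1, p.2.1 + s, p.2.2) := by ext <;> simp
  rw [e]
  exact this

/-- No classical ∂_x∂_y u is available. Difference quotients of u in y are differentiated in x
instead, and the y-Lipschitz bound for ∂_x u controls them uniformly. -/
lemma IsPrandtlSolution.uy_lip (hP : IsPrandtlSolution T u v) (hD : HasDecay T c C₀ N u)
    (hN : 3 ≤ N) (hC₀ : 0 < C₀) (hc : 0 < c) {p : R3} (hp : p ∈ slab T) (s : ℝ) :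
    |dy u (p + (0, s, 0)) - dy u p| ≤
      |s| * ((1 + 2 * c) * (4 * (C₀ + 1)) * Real.exp (-(2 * c) * p.2.2)) := by
  have hy : 0 < p.2.2 := hp.2.2
  have hlim : ∀ q ∈ slab T, Tendsto (fun r : ℝ => r⁻¹ * (u (q + (0, 0, r)) - u q)) (𝓝[>] 0)
      (𝓝 (dy u q)) := by
    intro q hq
    have h3 := (hasDerivAt_iff_tendsto_slope_zero.1 (hP.hasDerivAt_u_y hq)).mono_left
      (nhdsWithin_mono 0 (fun s hs => ne_of_gt hs : Ioi (0 : ℝ) ⊆ {0}ᶜ))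
    refine h3.congr fun r => ?_
    have e : q + (0, 0, r) = (q.1, q.2.1, q.2.2 + r) := by ext <;> simp
    rw [e]; rfl
  have h1 := ((hlim _ ((mem_slab_add_x s p).2 hp)).sub (hlim p hp)).abs
  refine le_of_tendsto h1 ?_
  filter_upwards [self_mem_nhdsWithin] with r hr
  have hr : (0 : ℝ) < r := hr
  set κ := (1 + 2 * c) * (4 * (C₀ + 1)) * Real.exp (-(2 * c) * p.2.2) with hκ
  have hmem : ∀ x, ((p.1, x, p.2.2) : R3) ∈ slab T := fun x => ⟨hp.1, mem_univ _, hy⟩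
  have hmem' : ∀ x, ((p.1, x, p.2.2 + r) : R3) ∈ slab T := fun x =>
    ⟨hp.1, mem_univ _, by simp only [mem_Ioi]; linarith⟩
  have := abs_sub_le_mul_abs (f := fun x => u (p.1, x, p.2.2 + r) - u (p.1, x, p.2.2))
    (f' := fun x => dx u (p.1, x, p.2.2 + r) - dx u (p.1, x, p.2.2)) (K := r * κ)
    (fun x => (hP.hasDerivAt_u_x (hmem' x)).sub (hP.hasDerivAt_u_x (hmem x)))
    (fun x => by
      have h := hD.abs_dx_sub_y_le hN hC₀ hc hP.continuousOn_dx (hmem x) hr.le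
      have e : ((p.1, x, p.2.2) : R3) + (0, 0, r) = (p.1, x, p.2.2 + r) := by ext <;> simp
      rw [e] at h
      refine h.trans (le_of_eq ?_)
      simp only [hκ]; ring) p.2.1 s
  have e1 : p + (0, s, 0) + (0, 0, r) = (p.1, p.2.1 + s, p.2.2 + r) := by ext <;> simp
  have e2 : p + (0, s, 0) = (p.1, p.2.1 + s, p.2.2) := by ext <;> simp
  have e3 : p + (0, 0, r) = (p.1, p.2.1, p.2.2 + r) := by ext <;> simp
  rw [e1, e2, e3, ← mul_sub, abs_mul, abs_of_pos (inv_pos.2 hr), inv_mul_le_iff₀ hr]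
  have e4 : u (p.1, p.2.1 + s, p.2.2 + r) - u (p.1, p.2.1 + s, p.2.2) -
      (u (p.1, p.2.1, p.2.2 + r) - u p) =
      (u (p.1, p.2.1 + s, p.2.2 + r) - u (p.1, p.2.1 + s, p.2.2)) -
      (u (p.1, p.2.1, p.2.2 + r) - u (p.1, p.2.1, p.2.2)) := rfl
  rw [e4]
  refine this.trans (le_of_eq ?_)
  ring

/-- The primitive of `e^{-2cy}`. -/
lemma hasDerivAt_exp_primitive (hc : 0 < c) (K y : ℝ) :
    HasDerivAt (fun y => -(K / (2 * c)) * Real.exp (-(2 * c) * y)) (K * Real.exp (-(2 * c) * y)) y := by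
  have := (((hasDerivAt_id y).const_mul (-(2 * c))).exp).const_mul (-(K / (2 * c)))
  refine this.congr_deriv ?_
  simp only [id]
  field_simp

lemma abs_le_of_exp_deriv (hc : 0 < c) {V V' : ℝ → ℝ} {K y : ℝ} (hK : 0 ≤ K) (hy : 0 < y)
    (hV : ContinuousOn V (Ici 0)) (h0 : V 0 = 0) (hd : ∀ y, 0 < y → HasDerivAt V (V' y) y)
    (h : ∀ y, 0 < y → |V' y| ≤ K * Real.exp (-(2 * c) * y)) : |V y| ≤ K / (2 * c) := by
  have h1 := abs_sub_le_of_deriv (f := V) (f' := V')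
    (G := fun y => -(K / (2 * c)) * Real.exp (-(2 * c) * y))
    (G' := fun y => K * Real.exp (-(2 * c) * y)) hy.le
    (hV.mono Icc_subset_Ici_self) (by fun_prop) (fun y hy => hd y hy.1)
    (fun y _ => hasDerivAt_exp_primitive hc K y) (fun y hy => h y hy.1)
  rw [h0, sub_zero] at h1
  simp only [mul_zero, Real.exp_zero, mul_one] at h1
  have : 0 ≤ K / (2 * c) * Real.exp (-(2 * c) * y) := by positivity
  linarith

/-- Here v is minus the primitive of ∂_x u from y = 0; exponential decay makes it, and its
increments in x, bounded uniformly up to y = ∞. -/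
lemma IsPrandtlSolution.v_bounds (hP : IsPrandtlSolution T u v) (hD : HasDecay T c C₀ N u)
    (hN : 3 ≤ N) (hC₀ : 0 < C₀) (hc : 0 < c) {p : R3} (hp : p ∈ slab T) :
    |v p| ≤ 4 * (C₀ + 1) / (2 * c) ∧ |v p| ≤ 4 * (C₀ + 1) * p.2.2 ∧
    ∀ s : ℝ, |v (p + (0, s, 0)) - v p| ≤ 4 * (C₀ + 1) * |s| / (2 * c) := by
  have hy : 0 < p.2.2 := hp.2.2
  have hmem : ∀ y, 0 < y → ((p.1, p.2.1, y) : R3) ∈ slab T := fun y hy => ⟨hp.1, mem_univ _, hy⟩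
  have hd : ∀ y, 0 < y → HasDerivAt (fun y => v (p.1, p.2.1, y)) (-dx u (p.1, p.2.1, y)) y :=
    fun y hy => hP.hasDerivAt_v_y (hmem y hy)
  have hcv := hP.continuousOn_y_v hp.1
  have h0 : v (p.1, p.2.1, 0) = 0 := (hP.boundary p.1 hp.1 p.2.1).2
  have hb : ∀ y, 0 < y → |-dx u (p.1, p.2.1, y)| ≤ 4 * (C₀ + 1) * Real.exp (-(2 * c) * y) :=
    fun y hy => by
      rw [abs_neg]; exact hD.abs_dx_le hN hC₀ hP.continuousOn_dx (hmem y hy)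
  refine ⟨?_, ?_, fun s => ?_⟩
  · exact abs_le_of_exp_deriv hc (by positivity) hy hcv h0 hd hb
  · have := abs_sub_le_mul (f := fun y => v (p.1, p.2.1, y)) (K := 4 * (C₀ + 1)) hy.le
      (hcv.mono Icc_subset_Ici_self) (fun y hy => hd y hy.1) (fun y hy => (hb y hy.1).trans (by
        have h1 : Real.exp (-(2 * c) * y) ≤ 1 := Real.exp_le_one_iff.2 (by
          have : 0 < y := hy.1
          nlinarith)
        nlinarith))
    simpa [h0] using this
  · have hmem' : ∀ y, 0 < y → ((p.1, p.2.1 + s, y) : R3) ∈ slab T := fun y hy =>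
      ⟨hp.1, mem_univ _, hy⟩
    have e : p + (0, s, 0) = (p.1, p.2.1 + s, p.2.2) := by ext <;> simp
    rw [e]
    refine abs_le_of_exp_deriv (V := fun y => v (p.1, p.2.1 + s, y) - v (p.1, p.2.1, y))
      (V' := fun y => -dx u (p.1, p.2.1 + s, y) - -dx u (p.1, p.2.1, y))
      hc (by positivity) hy ((hP.continuousOn_y_v (p := (p.1, p.2.1 + s, 0)) hp.1).sub hcv)
      ?_ (fun y hy => (hP.hasDerivAt_v_y (hmem' y hy)).sub (hd y hy)) fun y hy => ?_
    · have := (hP.boundary p.1 hp.1 (p.2.1 + s)).2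
      simp only [h0, this, sub_self]
    · have h := hD.abs_dx_sub_x_le hN hC₀ hP.continuousOn_dx (hmem y hy) s
      have e : ((p.1, p.2.1, y) : R3) + (0, s, 0) = (p.1, p.2.1 + s, y) := by ext <;> simp
      rw [e] at h
      rw [← abs_neg]
      refine le_trans (le_of_eq ?_) h
      congr 1; ring

end Flow

theorem exists_flowBound (σ Cs c C₀ : ℝ) (hσ : 1 / 2 < σ) (hCs : 1 < Cs) (hc : 0 < c)
    (hC₀ : 0 < C₀) : ∃ K : ℝ, 0 < K ∧ ∀ (N : ℕ) (T : ℝ) (u v : R3 → ℝ), 7 ≤ N →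
      IsPrandtlSolution T u v → IsMonotoneFlow T σ Cs u → HasDecay T c C₀ N u →
      FlowBound T σ K ((slab T).indicator u) ((slab T).indicator (dy u)) ((slab T).indicator v)
        ((slab T).indicator (fun p => -dx u p)) := by
  have hσ0 : 0 < σ := by linarith
  have hCs0 : 0 < Cs := by linarith
  set A := 4 * (C₀ + 1) with hA
  have hA0 : 0 < A := by positivity
  set M := (1 + σ / (4 * c)) ^ (σ / 2) with hM
  have hM0 : 0 < M := by positivity
  -- One constant dominating all pointwise bounds: A is the Sobolev constant for e^{2cy}∂_x u,
  -- A/(2c) comes from integrating the exponential, and M trades the exponential for ⟨y⟩^{-σ/2}.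
  set K := 1 + Cs + A + A / (2 * c) + (1 + 2 * c) * A * M with hK
  have h5 : 0 < A / (2 * c) := by positivity
  have h6 : 0 < (1 + 2 * c) * A * M := by positivity
  have hK0 : 0 < K := by positivity
  have k1 : 1 ≤ K := by linarith
  have k2 : Cs ≤ K := by linarith
  have k3 : A ≤ K := by linarith
  have k4 : A / (2 * c) ≤ K := by linarith
  have k5 : (1 + 2 * c) * A * M ≤ K := by linarith
  refine ⟨K, hK0, fun N T u v hN hP hMF hD => ?_⟩
  have hN3 : 3 ≤ N := by omega
  have hbp : ∀ (p : R3) (r : ℝ), 0 < bracket p.2.2 ^ r := fun p r =>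
    Real.rpow_pos_of_pos (bracket_pos _) _
  have hcu : ContinuousOn u (slab T) := hP.continuousOn_u.mono fun p hp =>
    ⟨Ioo_subset_Icc_self hp.1, hp.2.1, Ioi_subset_Ici_self hp.2.2⟩
  have hcv : ContinuousOn v (slab T) := hP.continuousOn_v.mono fun p hp =>
    ⟨hp.1, hp.2.1, Ioi_subset_Ici_self hp.2.2⟩
  have hu : ∀ p ∈ slab T, |u p| ≤ K := fun p hp => by
    have := hP.u_bounds hMF hσ0 hCs0 hp
    rw [abs_of_nonneg this.1]; linarith
  have huy : ∀ p ∈ slab T, |dy u p| ≤ K := fun p hp => by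
    have := hMF.dy_bounds hσ0 hCs0 hp
    rw [abs_of_pos this.1]; linarith
  have hv : ∀ p ∈ slab T, |v p| ≤ K := fun p hp =>
    (hP.v_bounds hD hN3 hC₀ hc hp).1.trans k4
  have hvy : ∀ p ∈ slab T, |-dx u p| ≤ K := fun p hp => by
    rw [abs_neg]
    refine (hD.abs_dx_le hN3 hC₀ hP.continuousOn_dx hp).trans ?_
    have h1 : Real.exp (-(2 * c) * p.2.2) ≤ 1 := Real.exp_le_one_iff.2 (by
      have : 0 < p.2.2 := hp.2.2
      nlinarith)
    nlinarith
  have hu_mul : ∀ p ∈ slab T, |u p| ≤ K * p.2.2 := fun p hp => by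
    have := hP.u_bounds hMF hσ0 hCs0 hp
    have hy : 0 < p.2.2 := hp.2.2
    rw [abs_of_nonneg this.1]; nlinarith
  have hu_lip : ∀ p ∈ slab T, ∀ s : ℝ, |u (p + (0, s, 0)) - u p| ≤ |s| * K := fun p hp s => by
    have := hP.u_lip hD hN3 hC₀ hc hp s
    nlinarith [abs_nonneg s]
  have hv_lip : ∀ p ∈ slab T, ∀ s : ℝ, |v (p + (0, s, 0)) - v p| ≤ |s| * K := fun p hp s => by
    have := (hP.v_bounds hD hN3 hC₀ hc hp).2.2 s
    have e : 4 * (C₀ + 1) * |s| / (2 * c) = |s| * (A / (2 * c)) := by rw [hA]; ring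
    rw [e] at this
    exact this.trans (mul_le_mul_of_nonneg_left k4 (abs_nonneg s))
  have huy_lip : ∀ p ∈ slab T, ∀ s : ℝ, |dy u (p + (0, s, 0)) - dy u p| ≤
      |s| * (K * bracket p.2.2 ^ (-σ / 2)) := fun p hp s => by
    refine (hP.uy_lip hD hN3 hC₀ hc hp s).trans (mul_le_mul_of_nonneg_left ?_ (abs_nonneg s))
    have h1 := exp_le_bracket_rpow hc hσ0 (y := p.2.2) (le_of_lt hp.2.2)
    have h2 : 0 ≤ (1 + 2 * c) * (4 * (C₀ + 1)) := by positivity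
    refine (mul_le_mul_of_nonneg_left h1 h2).trans ?_
    rw [← mul_assoc]
    exact mul_le_mul_of_nonneg_right k5 (hbp p _).le
  refine ⟨isCoef_indicator_slab hcu hu hK0.le,
    isCoef_indicator_slab hP.continuousOn_dy huy hK0.le, isCoef_indicator_slab hcv hv hK0.le,
    isCoef_indicator_slab hP.continuousOn_dx.neg hvy hK0.le, fun p => ?_,
    indicator_slab_abs_le' (fun _ => hK0.le) hu, indicator_slab_abs_le' (fun _ => hK0.le) huy,
    indicator_slab_abs_le' (fun _ => hK0.le) hv, indicator_slab_abs_le' (fun _ => hK0.le) hvy,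
    yDiff_indicator_slab hcu hP.continuousOn_dy hu huy hK0.le (fun p hp => hP.hasDerivAt_u_y hp),
    yDiff_indicator_slab hcv hP.continuousOn_dx.neg hv hvy hK0.le
      (fun p hp => hP.hasDerivAt_v_y hp),
    indicator_slab_abs_le (fun p hp => by positivity) hu_mul, fun s p => ?_, fun s p => ?_,
    indicator_slab_lip (fun p => (mul_pos hK0 (hbp p _)).le) huy_lip,
    indicator_slab_abs_le' (fun p => (mul_pos hK0 (hbp p _)).le) fun p hp => ?_, fun p hp => ?_⟩
  · exact indicator_nonneg (fun p hp => (hP.u_bounds hMF hσ0 hCs0 hp).1) p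
  · rw [mul_comm]
    exact indicator_slab_lip (L := fun _ => K) (fun _ => hK0.le) hu_lip s p
  · rw [mul_comm]
    exact indicator_slab_lip (L := fun _ => K) (fun _ => hK0.le) hv_lip s p
  · have := hMF.dy_bounds hσ0 hCs0 hp
    rw [abs_of_pos this.1]
    exact this.2.1.trans (mul_le_mul_of_nonneg_right k2 (hbp p _).le)
  · rw [indicator_of_mem hp]
    refine le_trans ?_ (hMF p hp).2.1
    exact mul_le_mul_of_nonneg_right (inv_anti₀ hCs0 k2) (hbp p _).le

/-! ### The linearized equation in `L²(ℝ³)` -/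

lemma re_inner_comm (w q : HH) : (inner ℂ w q : ℂ).re = (inner ℂ q w : ℂ).re := by
  rw [← inner_conj_symm, Complex.conj_re]

lemma abs_re_inner_le (w q : HH) : |(inner ℂ w q : ℂ).re| ≤ ‖w‖ * ‖q‖ :=
  (Complex.abs_re_le_norm _).trans (norm_inner_le_norm _ _)

lemma re_inner_self (w : HH) : (inner ℂ w w : ℂ).re = ‖w‖ ^ 2 := by
  have := inner_self_eq_norm_sq (𝕜 := ℂ) w
  exact this

/-- The linearized equation, its boundary conditions and the regularity of its solution, for
functions extended by zero to `ℝ³`. -/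
structure LinSol (T : ℝ) (u uy v vy : R3 → ℝ) (f ft fx w wt wx wy wyy h hy g gy : HH) : Prop where
  in_fx : mulOp (ind (slab T)) fx = fx
  up_f : IsUp f
  up_fx : IsUp fx
  up_w : IsUp w
  up_wy : IsUp wy
  dX_f : HasD trX f fx
  dX_w : HasD trX w wx
  dT_f : HasD trT f ft
  dT_w : HasD trT w wt
  dY_f : HasD shY f w
  dY_fx : HasD shY fx wx
  dY_ft : HasD shY ft wt
  dY_w : HasD trY w wy
  dY_wy : HasD shY wy wyy
  dY_h : HasD shY h hy
  dY_g : HasD shY g gy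
  up_q : IsUp (ft - wy - g)
  up_qy : IsUp (wt - wyy - gy)
  dY_q : HasD trY (ft - wy - g) (wt - wyy - gy)
  eq : ft + mulOp (fun p => (u p : ℂ)) fx + mulOp (fun p => (v p : ℂ)) w - wy = h

lemma trY_add (s : ℝ) (w q : HH) : trY s (w + q) = trY s w + trY s q := map_add _ _ _

lemma shY_add (s : ℝ) (w q : HH) : shY s (w + q) = shY s w + shY s q := by
  simp only [shY, map_add]

lemma shY_sub (s : ℝ) (w q : HH) : shY s (w - q) = shY s w - shY s q := by
  simp only [shY, map_sub]

/-! ### Energy inequalities for the time derivative and for transport. -/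

section Energy

variable {z zt zx zy zyy : HH}

/-- Formally this is −½∫ d/dt‖z_y‖² dt, but z_y need not be differentiable in t. With backward
quotients, Green's formula in y leaves ‖z_y‖² − Re⟨z_y(t − s), z_y⟩, which is nonnegative since
translations are isometric; only the sign is needed. -/
lemma re_inner_dt_dyy_nonpos (ht : HasD trT z zt) (hz : IsUp z) (hzy : IsUp zy)
    (h1 : HasD trY z zy) (h2 : HasD shY zy zyy) : (inner ℂ zt zyy : ℂ).re ≤ 0 := by
  have h3 := (Complex.continuous_re.tendsto _).comp (Filter.Tendsto.inner (𝕜 := ℂ) ht.neg_dirT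
    (tendsto_const_nhds (x := zyy)))
  rw [inner_neg_left, Complex.neg_re] at h3
  suffices 0 ≤ -(inner ℂ zt zyy : ℂ).re by linarith
  refine ge_of_tendsto h3 ?_
  filter_upwards [self_mem_nhdsWithin] with s hs
  have hs : (0 : ℝ) < s := hs
  have hup : ∀ {w : HH}, IsUp w → IsUp (trT (-s) w) := by
    intro w hw
    unfold IsUp at *
    conv_rhs => rw [← hw]
    rw [trT, trT, tr_mulOp isCoef_up]
    congr 2; funext p; simp [up]
  have h4 : HasD trY (trT (-s) z) (trT (-s) zy) := h1.map (tr (-s, 0, 0)) fun r => tr_comm _ _ _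
  have h5 := (h4.sub h1 fun r w q => map_sub _ _ _).ibpY h2 ((hup hz).sub hz) ((hup hzy).sub hzy)
  have h6 : (inner ℂ (trT (-s) z - z) zyy : ℂ).re = -(inner ℂ (trT (-s) zy - zy) zy : ℂ).re := by
    have := congrArg Complex.re h5
    rw [Complex.add_re, Complex.zero_re] at this
    linarith
  rw [Function.comp_apply, inner_smul_left, Complex.conj_ofReal, Complex.re_ofReal_mul, h6,
    inner_sub_left, Complex.sub_re, re_inner_self]
  have h7 := (le_abs_self _).trans (abs_re_inner_le (trT (-s) zy) zy)
  rw [trT, norm_tr] at h7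
  have : 0 ≤ s⁻¹ := by positivity
  refine mul_nonneg this ?_
  rw [trT]
  nlinarith

/-- After Green's formula in y the term Re⟨u z_xy, z_y⟩ would be −½⟨u_x z_y, z_y⟩. As z_xy need not
exist, backward quotients in x and `re_inner_sub_trX` replace it, and this is where u ≥ 0 enters. -/
lemma re_inner_dx_dyy_le {u uy : R3 → ℝ} {K : ℝ}
    (hu : YDiff (fun p => (u p : ℂ)) (fun p => (uy p : ℂ))) (hu0 : ∀ p, 0 ≤ u p)
    (hlip : ∀ (s : ℝ) (p : R3), |u (p + (0, s, 0)) - u p| ≤ K * |s|)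
    (hx : HasD trX z zx) (hz : IsUp z) (hzy : IsUp zy)
    (h1 : HasD trY z zy) (h2 : HasD shY zy zyy) :
    (inner ℂ (mulOp (fun p => (u p : ℂ)) zx) zyy : ℂ).re ≤
      -(inner ℂ (mulOp (fun p => (uy p : ℂ)) zx) zy : ℂ).re + K / 2 * ‖zy‖ ^ 2 := by
  set U := mulOp (fun p => (u p : ℂ)) with hU
  set Uy := mulOp (fun p => (uy p : ℂ)) with hUy
  have h3 : Tendsto (fun s : ℝ => (inner ℂ (U (((s⁻¹ : ℝ) : ℂ) • (trX (-s) z - z))) zyy +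
      inner ℂ (Uy (((s⁻¹ : ℝ) : ℂ) • (trX (-s) z - z))) zy : ℂ).re) (𝓝[>] 0)
      (𝓝 (inner ℂ (U (-zx)) zyy + inner ℂ (Uy (-zx)) zy : ℂ).re) :=
    (Complex.continuous_re.tendsto _).comp ((Filter.Tendsto.inner (𝕜 := ℂ)
      ((U.continuous.tendsto _).comp hx.neg_dirX) (tendsto_const_nhds (x := zyy))).add
      (Filter.Tendsto.inner (𝕜 := ℂ)
      ((Uy.continuous.tendsto _).comp hx.neg_dirX) (tendsto_const_nhds (x := zy))))
  rw [map_neg, map_neg, inner_neg_left, inner_neg_left, Complex.add_re, Complex.neg_re,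
    Complex.neg_re] at h3
  suffices -(K / 2 * ‖zy‖ ^ 2) ≤ -(inner ℂ (U zx) zyy : ℂ).re + -(inner ℂ (Uy zx) zy : ℂ).re by
    linarith
  refine ge_of_tendsto h3 ?_
  filter_upwards [self_mem_nhdsWithin] with s hs
  have hs : (0 : ℝ) < s := hs
  have hup : ∀ {w : HH}, IsUp w → IsUp (trX (-s) w) := by
    intro w hw
    unfold IsUp at *
    conv_rhs => rw [← hw]
    rw [trX, trX, tr_mulOp isCoef_up]
    congr 2; funext p; simp [up]
  have h4 : HasD trY (trX (-s) z) (trX (-s) zy) := h1.map (tr (0, -s, 0)) fun r => tr_comm _ _ _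
  have hd := (hup hz).sub hz
  have hdy := (hup hzy).sub hzy
  have h5 := (hu.mul_trY (h4.sub h1 fun r w q => map_sub _ _ _) hd hdy).ibpY h2
    (hd.mulOp hu.coef) ((hd.mulOp hu.coef').add (hdy.mulOp hu.coef))
  have h6 := congrArg Complex.re h5
  rw [inner_add_left, Complex.add_re, Complex.add_re, Complex.zero_re] at h6
  have h7 := re_inner_sub_trX hu.coef hu0 (K := K) (s := s) (fun p => by
    simpa [abs_of_pos hs] using hlip s p) zy
  rw [map_smul, map_smul, inner_smul_left, inner_smul_left, Complex.conj_ofReal, ← mul_add,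
    Complex.re_ofReal_mul, Complex.add_re]
  have h8 : (inner ℂ (U (trX (-s) zy - zy)) zy : ℂ).re = -(inner ℂ (U (zy - trX (-s) zy)) zy : ℂ).re := by
    rw [← neg_sub zy, map_neg, inner_neg_left, Complex.neg_re]
  rw [le_inv_mul_iff₀ hs]
  linarith

end Energy

/-! ### Traces at y = 0: cutoff and Hardy weight. -/

/-- `θ = e^{-|y|}`. -/
def cutoff (p : R3) : ℝ := Real.exp (-|p.2.2|)

lemma cutoff_pos (p : R3) : 0 < cutoff p := Real.exp_pos _

lemma cutoff_le_one (p : R3) : cutoff p ≤ 1 := Real.exp_le_one_iff.2 (by simp)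

lemma isCoef_cutoff : IsCoef (fun p => (cutoff p : ℂ)) :=
  IsCoef.of_real (K := 1) (by unfold cutoff; fun_prop) fun p => by
    rw [abs_of_pos (cutoff_pos p)]; exact cutoff_le_one p

lemma yDiff_of_deriv {a a' : ℝ → ℝ} {K : ℝ} (ha : Measurable a) (ha' : Measurable a')
    (hK : ∀ y, |a y| ≤ K) (hK' : ∀ y, |a' y| ≤ K) (hd : ∀ y, 0 < y → HasDerivAt a (a' y) y) :
    YDiff (fun p => (a p.2.2 : ℂ)) (fun p => (a' p.2.2 : ℂ)) := by
  refine ⟨IsCoef.of_real (ha.comp (by fun_prop)) fun p => hK _,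
    IsCoef.of_real (ha'.comp (by fun_prop)) fun p => hK' _, ⟨K, fun p hp s hs => ?_⟩,
    fun p hp => ?_⟩
  · have hs : (0 : ℝ) < s := hs
    rw [← Complex.ofReal_sub, Complex.norm_real, Real.norm_eq_abs]
    have := abs_sub_le_mul (f := a) (a := p.2.2) (b := p.2.2 + s) (K := K)
      (by linarith) (fun y hy => (hd y (by linarith [hy.1])).continuousAt.continuousWithinAt)
      (fun y hy => hd y (by linarith [hy.1])) (fun y hy => hK' _)
    simpa using this
  · have h3 := (hasDerivAt_iff_tendsto_slope_zero.1 (hd p.2.2 hp)).mono_left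
      (nhdsWithin_mono 0 (fun s hs => ne_of_gt hs : Ioi (0 : ℝ) ⊆ {0}ᶜ))
    refine ((Complex.continuous_ofReal.tendsto _).comp h3).congr fun s => ?_
    simp

lemma yDiff_cutoff : YDiff (fun p => (cutoff p : ℂ)) (fun p => ((-cutoff p : ℝ) : ℂ)) := by
  refine yDiff_of_deriv (a := fun y => Real.exp (-|y|)) (a' := fun y => -Real.exp (-|y|)) (K := 1)
    (by fun_prop) (by fun_prop) (fun y => ?_) (fun y => ?_) (fun y hy => ?_)
  · rw [abs_of_pos (Real.exp_pos _)]; exact Real.exp_le_one_iff.2 (by simp)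
  · rw [abs_neg, abs_of_pos (Real.exp_pos _)]; exact Real.exp_le_one_iff.2 (by simp)
  · have h1 : HasDerivAt (fun y : ℝ => Real.exp (-y)) (-Real.exp (-y)) y := by
      simpa using (hasDerivAt_id y).neg.exp
    rw [abs_of_pos hy]
    refine h1.congr_of_eventuallyEq ?_
    filter_upwards [lt_mem_nhds hy] with x hx
    rw [abs_of_pos hx]

lemma yDiff_one_sub_cutoff :
    YDiff (fun p => ((1 - cutoff p : ℝ) : ℂ)) (fun p => (cutoff p : ℂ)) := by
  refine yDiff_of_deriv (a := fun y => 1 - Real.exp (-|y|)) (a' := fun y => Real.exp (-|y|)) (K := 1)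
    (by fun_prop) (by fun_prop) (fun y => ?_) (fun y => ?_) (fun y hy => ?_)
  · have h1 : Real.exp (-|y|) ≤ 1 := Real.exp_le_one_iff.2 (by simp)
    rw [abs_of_nonneg (by linarith)]
    linarith [Real.exp_pos (-|y|)]
  · rw [abs_of_pos (Real.exp_pos _)]; exact Real.exp_le_one_iff.2 (by simp)
  · have h1 : HasDerivAt (fun y : ℝ => 1 - Real.exp (-y)) (Real.exp (-y)) y := by
      simpa using ((hasDerivAt_id y).neg.exp).const_sub 1
    rw [abs_of_pos hy]
    refine h1.congr_of_eventuallyEq ?_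
    filter_upwards [lt_mem_nhds hy] with x hx
    rw [abs_of_pos hx]

/-- The boundary form depends on the trace only. -/
lemma boundary_cutoff {p p' q q' : HH} (hp : HasD shY p p') (hq : HasD shY q q') (hqu : IsUp q)
    (hqu' : IsUp q') : inner ℂ p' q + inner ℂ p q' =
      (inner ℂ p' (mulOp (fun z => (cutoff z : ℂ)) q) + inner ℂ p
        (mulOp (fun z => ((-cutoff z : ℝ) : ℂ)) q + mulOp (fun z => (cutoff z : ℂ)) q') : ℂ) := by
  -- The difference (1 − θ)q has zero trace because 1 − e^{-y} ≤ y, so Green's formula removes it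
  -- from the boundary form.
  have hr := yDiff_one_sub_cutoff.mul_trY_of_le (K := 1) (fun z hz => by
    rw [Complex.norm_real, Real.norm_of_nonneg (by linarith [cutoff_le_one z]), one_mul, cutoff,
      abs_of_pos hz]
    linarith [Real.add_one_le_exp (-z.2.2)]) hq hqu
  have h1 := hr.ibpY hp (hqu.mulOp yDiff_one_sub_cutoff.coef)
    ((hqu.mulOp yDiff_one_sub_cutoff.coef').add (hqu'.mulOp yDiff_one_sub_cutoff.coef))
  have h2 := congrArg (starRingEnd ℂ) h1
  rw [map_add, inner_conj_symm, inner_conj_symm, map_zero] at h2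
  have e1 : ∀ w : HH, mulOp (fun z => ((1 - cutoff z : ℝ) : ℂ)) w =
      w - mulOp (fun z => (cutoff z : ℂ)) w := by
    intro w
    have := mulOp_sub (isCoef_const 1) isCoef_cutoff w
    rw [mulOp_one] at this
    rw [← this]; congr 2; funext z; push_cast; rfl
  have e2 : mulOp (fun z => ((-cutoff z : ℝ) : ℂ)) q = -mulOp (fun z => (cutoff z : ℂ)) q := by
    have := mulOp_const_mul isCoef_cutoff (-1) q
    rw [neg_one_smul] at this
    rw [← this]; congr 2; funext z; push_cast; ring
  rw [e1, e1, inner_add_right, inner_sub_right, inner_sub_right] at h2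
  rw [e2, inner_add_right, inner_neg_right]
  linear_combination h2

/-- `ω = ψ'` for `ψ = 1 - (1 + |y|)^{1 - 2σ}`. -/
def hardyWeight (σ y : ℝ) : ℝ := (2 * σ - 1) * (1 + |y|) ^ (-(2 * σ))

/-- `ψ = 1 - (1 + |y|)^{1 - 2σ}`. -/
def hardyPrimitive (σ y : ℝ) : ℝ := 1 - (1 + |y|) ^ (1 - 2 * σ)

section Hardy

variable {σ : ℝ} (hσ : 1 / 2 < σ)
include hσ

lemma hardyWeight_pos (y : ℝ) : 0 < hardyWeight σ y :=
  mul_pos (by linarith) (Real.rpow_pos_of_pos (by positivity) _)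

lemma hardyWeight_le (y : ℝ) : hardyWeight σ y ≤ 2 * σ - 1 := by
  have : (1 + |y|) ^ (-(2 * σ)) ≤ 1 :=
    Real.rpow_le_one_of_one_le_of_nonpos (by linarith [abs_nonneg y]) (by linarith)
  unfold hardyWeight
  nlinarith

lemma abs_hardyPrimitive_le (y : ℝ) : |hardyPrimitive σ y| ≤ 1 := by
  have h1 : (1 + |y|) ^ (1 - 2 * σ) ≤ 1 :=
    Real.rpow_le_one_of_one_le_of_nonpos (by linarith [abs_nonneg y]) (by linarith)
  have h2 : 0 < (1 + |y|) ^ (1 - 2 * σ) := Real.rpow_pos_of_pos (by positivity) _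
  unfold hardyPrimitive
  rw [abs_of_nonneg (by linarith)]; linarith

omit hσ in
lemma measurable_hardyWeight : Measurable (hardyWeight σ) := by
  unfold hardyWeight; fun_prop

omit hσ in
lemma hasDerivAt_hardyPrimitive {y : ℝ} (hy : 0 < y) :
    HasDerivAt (hardyPrimitive σ) (hardyWeight σ y) y := by
  have h1 : HasDerivAt (fun y : ℝ => 1 - (1 + y) ^ (1 - 2 * σ))
      ((2 * σ - 1) * (1 + y) ^ (-(2 * σ))) y := by
    have := (((hasDerivAt_id y).const_add 1).rpow_const (p := 1 - 2 * σ)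
      (Or.inl (by simp; positivity))).const_sub 1
    refine this.congr_deriv ?_
    simp only [id]
    rw [show 1 - 2 * σ - 1 = -(2 * σ) by ring]
    ring
  unfold hardyPrimitive hardyWeight
  rw [abs_of_pos hy]
  refine h1.congr_of_eventuallyEq ?_
  filter_upwards [lt_mem_nhds hy] with x hx
  rw [abs_of_pos hx]

lemma yDiff_hardy : YDiff (fun p => (hardyPrimitive σ p.2.2 : ℂ))
    (fun p => (hardyWeight σ p.2.2 : ℂ)) := by
  refine yDiff_of_deriv (K := 1 + (2 * σ - 1)) (by unfold hardyPrimitive; fun_prop)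
    measurable_hardyWeight (fun y => ?_) (fun y => ?_) (fun y hy => hasDerivAt_hardyPrimitive hy)
  · exact (abs_hardyPrimitive_le hσ y).trans (by linarith)
  · rw [abs_of_pos (hardyWeight_pos hσ y)]
    exact (hardyWeight_le hσ y).trans (by linarith)

lemma isCoef_sqrt_hardyWeight : IsCoef (fun p => (√(hardyWeight σ p.2.2) : ℂ)) :=
  IsCoef.of_real (K := √(2 * σ - 1))
    (measurable_hardyWeight.sqrt.comp (by fun_prop)) fun p => by
    rw [abs_of_nonneg (Real.sqrt_nonneg _)]
    exact Real.sqrt_le_sqrt (hardyWeight_le hσ _)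

/-- A bound of the trace by a weighted norm of the normal derivative. -/
lemma boundary_self_le {p p' r : HH} (hp : HasD shY p p') (hpu : IsUp p)
    (hr : p' = mulOp (fun z => (√(hardyWeight σ z.2.2) : ℂ)) r) :
    -2 * (inner ℂ p' p : ℂ).re ≤ 4 * ‖r‖ ^ 2 := by
  set S := mulOp (fun z => (√(hardyWeight σ z.2.2) : ℂ)) with hS
  have hp' : IsUp p' := hp.isUp hpu
  have hY := yDiff_hardy hσ
  have h0 : ∀ p : R3, 0 < p.2.2 → ‖(hardyPrimitive σ p.2.2 : ℂ)‖ ≤ (2 * σ - 1) * p.2.2 := by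
    intro p hp
    have := abs_sub_le_mul (f := hardyPrimitive σ) (f' := hardyWeight σ) (a := 0) (b := p.2.2)
      (K := 2 * σ - 1) hp.le (by
        unfold hardyPrimitive
        refine ContinuousOn.sub continuousOn_const (ContinuousOn.rpow_const (by fun_prop) ?_)
        intro x _; left; positivity)
      (fun y hy => hasDerivAt_hardyPrimitive hy.1)
      (fun y hy => by
        rw [abs_of_pos (hardyWeight_pos hσ y)]; exact hardyWeight_le hσ y)
    have e : hardyPrimitive σ 0 = 0 := by simp [hardyPrimitive]
    rw [e, sub_zero, sub_zero] at this
    simpa using this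
  have h1 := (hY.mul_trY_of_le h0 hp hpu).ibpY hp (hpu.mulOp hY.coef)
    ((hpu.mulOp hY.coef').add (hp'.mulOp hY.coef))
  have hsym : inner ℂ (mulOp (fun z => (hardyPrimitive σ z.2.2 : ℂ)) p) p' =
      inner ℂ p (mulOp (fun z => (hardyPrimitive σ z.2.2 : ℂ)) p') := inner_mulOp_real hY.coef _ _
  have hSS : mulOp (fun z => (hardyWeight σ z.2.2 : ℂ)) p = S (S p) := by
    rw [hS, mulOp_mulOp (isCoef_sqrt_hardyWeight hσ) (isCoef_sqrt_hardyWeight hσ)]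
    congr 2; funext z
    rw [← Complex.ofReal_mul, Real.mul_self_sqrt (hardyWeight_pos hσ _).le]
  have hin : (inner ℂ (S (S p)) p : ℂ).re = ‖S p‖ ^ 2 := by
    rw [hS, inner_mulOp_real (isCoef_sqrt_hardyWeight hσ), re_inner_self]
  have hψ : |(inner ℂ (mulOp (fun z => (hardyPrimitive σ z.2.2 : ℂ)) p') p : ℂ).re| ≤
      ‖r‖ * ‖S p‖ := by
    rw [hr, mulOp_comm hY.coef (isCoef_sqrt_hardyWeight hσ),
      inner_mulOp_real (isCoef_sqrt_hardyWeight hσ)]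
    refine (abs_re_inner_le _ _).trans (mul_le_mul_of_nonneg_right ?_ (norm_nonneg _))
    simpa using norm_mulOp_le hY.coef r (K := 1) (fun z => by
      rw [Complex.norm_real]; exact abs_hardyPrimitive_le hσ _)
  have h2 := congrArg Complex.re h1
  rw [inner_add_left, hSS, hsym, Complex.add_re, Complex.add_re, Complex.zero_re, hin,
    re_inner_comm p] at h2
  -- Hardy inequality: with ω = ψ', ψ(0) = 0 and |ψ| ≤ 1, Green's formula gives ‖√ω p‖² = −2Re⟨ψp',
  -- p⟩ ≤ 2‖r‖‖√ω p‖.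
  have h3 : ‖S p‖ ≤ 2 * ‖r‖ := by
    have := neg_abs_le (inner ℂ (mulOp (fun z => (hardyPrimitive σ z.2.2 : ℂ)) p') p : ℂ).re
    by_contra hcon
    push Not at hcon
    have h5 : 0 ≤ ‖r‖ := norm_nonneg _
    nlinarith
  have h4 : |(inner ℂ p' p : ℂ).re| ≤ ‖r‖ * ‖S p‖ := by
    rw [hr, inner_mulOp_real (isCoef_sqrt_hardyWeight hσ)]
    exact abs_re_inner_le _ _
  have := neg_abs_le (inner ℂ p' p : ℂ).re
  nlinarith [norm_nonneg r, mul_le_mul_of_nonneg_left h3 (norm_nonneg r)]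

end Hardy

/-! ### The estimates -/

/-- The weight `⟨y⟩^{-σ/2}`. -/
def wtY (σ : ℝ) (p : R3) : ℝ := bracket p.2.2 ^ (-σ / 2)

lemma wtY_pos (σ : ℝ) (p : R3) : 0 < wtY σ p := Real.rpow_pos_of_pos (bracket_pos _) _

lemma wtY_le_one {σ : ℝ} (hσ : 0 ≤ σ) (p : R3) : wtY σ p ≤ 1 := by
  have := bracket_rpow_neg_le_one (σ := σ / 2) (by linarith) p.2.2
  rwa [← neg_div] at this

lemma measurable_wtY (σ : ℝ) : Measurable (wtY σ) :=
  (continuous_bracket.measurable.comp (by fun_prop : Measurable fun p : R3 => p.2.2)).pow_const _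

lemma isCoef_wtY {σ : ℝ} (hσ : 0 ≤ σ) : IsCoef (fun p => (wtY σ p : ℂ)) :=
  IsCoef.of_real (K := 1) (measurable_wtY σ) fun p => by
    rw [abs_of_pos (wtY_pos σ p)]; exact wtY_le_one hσ p

lemma wtY_mul_self (σ : ℝ) (p : R3) : wtY σ p * wtY σ p = bracket p.2.2 ^ (-σ) := by
  rw [wtY, ← Real.rpow_add (bracket_pos _)]; congr 1; ring

lemma norm_mulOp_real_le {a : R3 → ℝ} {K : ℝ} (ha : IsCoef (fun p => (a p : ℂ)))
    (h : ∀ p, |a p| ≤ K) (w : HH) : ‖mulOp (fun p => (a p : ℂ)) w‖ ≤ K * ‖w‖ :=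
  norm_mulOp_le ha w fun p => by rw [Complex.norm_real]; exact h p

lemma norm_mulOp_real_le_norm {a b : R3 → ℝ} {K : ℝ} (ha : IsCoef (fun p => (a p : ℂ)))
    (hb : IsCoef (fun p => (b p : ℂ))) (h : ∀ p, |a p| ≤ K * |b p|) (w : HH) :
    ‖mulOp (fun p => (a p : ℂ)) w‖ ≤ K * ‖mulOp (fun p => (b p : ℂ)) w‖ :=
  norm_mulOp_le_norm ha hb w fun p => by rw [Complex.norm_real, Complex.norm_real]; exact h p

section FlowBound

variable {T σ K : ℝ} {u uy v vy : R3 → ℝ} (F : FlowBound T σ K u uy v vy)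

include F

lemma FlowBound.u_lip' : ∀ s > 0, ∀ p : R3, |u (p - (0, s, 0)) - u p| ≤ s * K := by
  intro s hs p
  have := F.u_lip (-s) p
  rw [abs_neg, abs_of_pos hs, mul_comm] at this
  simpa [sub_eq_add_neg] using this

lemma FlowBound.v_lip' : ∀ s > 0, ∀ p : R3, |v (p - (0, s, 0)) - v p| ≤ s * K := by
  intro s hs p
  have := F.v_lip (-s) p
  rw [abs_neg, abs_of_pos hs, mul_comm] at this
  simpa [sub_eq_add_neg] using this

lemma FlowBound.uy_lip' : ∀ s > 0, ∀ p : R3, |uy (p - (0, s, 0)) - uy p| ≤ s * (K * wtY σ p) := by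
  intro s hs p
  have := F.uy_lip (-s) p
  rw [abs_neg, abs_of_pos hs] at this
  simpa [sub_eq_add_neg, wtY] using this

lemma FlowBound.nonneg : 0 ≤ K := (abs_nonneg _).trans (F.u_le 0)

lemma FlowBound.uy_lip'' (hσ : 0 ≤ σ) :
    ∀ s > 0, ∀ p : R3, |uy (p - (0, s, 0)) - uy p| ≤ s * K := by
  intro s hs p
  refine (F.uy_lip' s hs p).trans (mul_le_mul_of_nonneg_left ?_ (le_of_lt hs))
  exact mul_le_of_le_one_right F.nonneg (wtY_le_one hσ p)

end FlowBound

section Estimates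

variable {T σ K : ℝ} {u uy v vy : R3 → ℝ} {f ft fx w wt wx wy wyy h hy g gy : HH}
  (F : FlowBound T σ K u uy v vy) (S : LinSol T u uy v vy f ft fx w wt wx wy wyy h hy g gy)

include S

lemma LinSol.up_wx : IsUp wx := S.dY_fx.isUp S.up_fx

/-- Interpolation: one integration by parts in y, with no boundary term because of the Neumann
condition. -/
lemma LinSol.norm_J_wy_sq : ‖J (1 / 3) wy‖ ^ 2 ≤ ‖w‖ * ‖J (2 / 3) wyy‖ := by
  have h0 : (0 : ℝ) ≤ 1 / 3 := by norm_num
  have h1 : (0 : ℝ) ≤ 2 / 3 := by norm_num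
  have h2 : inner ℂ wy (J (2 / 3) wy) + inner ℂ w (J (2 / 3) wyy) = (0 : ℂ) :=
    S.dY_w.ibpY (S.dY_wy.mult_shY (isSym_jsym h1)) S.up_w S.up_wy
  have h3 : inner ℂ (J (1 / 3) wy) (J (1 / 3) wy) = inner ℂ wy (J (2 / 3) wy) := by
    rw [inner_J h0, J_J h0 h0]; norm_num
  have h4 := congrArg Complex.re h2
  rw [Complex.add_re, Complex.zero_re] at h4
  have h5 := re_inner_self (J (1 / 3) wy)
  rw [h3] at h5
  have h6 := neg_abs_le (inner ℂ w (J (2 / 3) wyy) : ℂ).re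
  have h7 := abs_re_inner_le w (J (2 / 3) wyy)
  linarith

include F

/-- The equation differentiated in `y`. -/
lemma LinSol.eq_dy : hy = wt + (mulOp (fun p => (uy p : ℂ)) fx + mulOp (fun p => (u p : ℂ)) wx) +
    (mulOp (fun p => (vy p : ℂ)) w + mulOp (fun p => (v p : ℂ)) wy) - wyy := by
  have h1 := F.ydiff_u.mul_shY S.dY_fx S.up_fx
  have h2 := F.ydiff_v.mul_shY (S.dY_w.toShY S.up_w S.up_wy) S.up_w
  have h3 := ((S.dY_ft.add h1 shY_add).add h2 shY_add).sub S.dY_wy shY_sub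
  rw [S.eq] at h3
  exact S.dY_h.unique h3

/-- At y = 0 the equation reads f_t − f_yy = h, since u and f_y vanish there; comparison with the
boundary condition gives h = g in the sense of traces. -/
lemma LinSol.dY_h_sub_g : HasD trY (h - g) (hy - gy) ∧ IsUp (h - g) ∧ IsUp (hy - gy) := by
  have h1 := F.ydiff_u.mul_trY_of_le (K := K) (fun p hp => by
    rw [Complex.norm_real]; exact F.u_le_mul p hp) S.dY_fx S.up_fx
  have h2 := F.ydiff_v.mul_trY S.dY_w S.up_w S.up_wy
  have h3 := (S.dY_q.add h1 trY_add).add h2 trY_add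
  have e1 : ft - wy - g + mulOp (fun p => (u p : ℂ)) fx + mulOp (fun p => (v p : ℂ)) w = h - g := by
    rw [← S.eq]; abel
  have e2 : wt - wyy - gy + (mulOp (fun p => (uy p : ℂ)) fx + mulOp (fun p => (u p : ℂ)) wx) +
    (mulOp (fun p => (vy p : ℂ)) w + mulOp (fun p => (v p : ℂ)) wy) = hy - gy := by
    rw [S.eq_dy F]; abel
  have u1 := (S.up_q.add (S.up_fx.mulOp F.coef_u)).add (S.up_w.mulOp F.coef_v)
  have u2 := (S.up_qy.add ((S.up_fx.mulOp F.coef_uy).add (S.up_wx.mulOp F.coef_u))).add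
    ((S.up_w.mulOp F.coef_vy).add (S.up_wy.mulOp F.coef_v))
  rw [e1, e2] at h3
  rw [e1] at u1
  rw [e2] at u2
  exact ⟨h3, u1, u2⟩

/-- The differentiated equation tested with Λ^{-4/3}f_yyy. Each product is brought to Λ^{-2/3} on
both sides at the cost of one commutator, and the time derivative is discarded by its sign. -/
lemma LinSol.norm_J_wyy_sq (hσ : 0 ≤ σ) :
    ‖J (2 / 3) wyy‖ ^ 2 ≤
      (K * ‖mulOp (fun p => (wtY σ p : ℂ)) (J (2 / 3) fx)‖ + 2 * K * ‖f‖ + 3 * K * ‖w‖ +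
        4 * K * ‖J (1 / 3) wy‖ + ‖J (2 / 3) hy‖) * ‖J (2 / 3) wyy‖ +
      4 * K * ‖w‖ * ‖J (1 / 3) wy‖ + K / 2 * ‖J (1 / 3) wy‖ ^ 2 := by
  have h13 : (0 : ℝ) ≤ 1 / 3 := by norm_num
  have h23 : (0 : ℝ) ≤ 2 / 3 := by norm_num
  have hK := F.nonneg
  set Z := J (2 / 3) wyy with hZ
  set D := ‖J (1 / 3) wy‖ with hD
  set a := ‖mulOp (fun p => (wtY σ p : ℂ)) (J (2 / 3) fx)‖ with ha
  have hJZ : ‖J (2 / 3) Z‖ ≤ ‖Z‖ := norm_J_le h23 Z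
  have hzy : ‖J (2 / 3) wy‖ ≤ D := norm_J_anti h13 (by norm_num) wy
  have e0 : ‖Z‖ ^ 2 = (inner ℂ wyy (J (2 / 3) Z) : ℂ).re := by
    rw [← inner_J h23, re_inner_self]
  have e1 : wyy = wt + (mulOp (fun p => (uy p : ℂ)) fx + mulOp (fun p => (u p : ℂ)) wx) +
      (mulOp (fun p => (vy p : ℂ)) w + mulOp (fun p => (v p : ℂ)) wy) - hy := by
    rw [S.eq_dy F]; abel
  have t1 : (inner ℂ wt (J (2 / 3) Z) : ℂ).re ≤ 0 := by
    rw [← inner_J h23]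
    exact re_inner_dt_dyy_nonpos (S.dT_w.multT (isSym_jsym h23)) (mult_isUp (isSym_jsym h23) S.up_w)
      (mult_isUp (isSym_jsym h23) S.up_wy) (S.dY_w.multY (isSym_jsym h23))
      (S.dY_wy.mult_shY (isSym_jsym h23))
  have t2 : (inner ℂ (mulOp (fun p => (uy p : ℂ)) fx) (J (2 / 3) Z) : ℂ).re ≤
      K * a * ‖Z‖ + 2 * K * (‖f‖ * ‖Z‖) := by
    have c1 := commutator_J_const F.coef_uy (F.uy_lip'' hσ) (s := 2 / 3) (by norm_num) (by norm_num)
      S.dX_f Z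
    rw [inner_mulOp_real F.coef_uy]
    have c2 : |(inner ℂ (J (2 / 3) fx) (mulOp (fun p => (uy p : ℂ)) Z) : ℂ).re| ≤ K * a * ‖Z‖ := by
      rw [← inner_mulOp_real F.coef_uy]
      refine (abs_re_inner_le _ _).trans (mul_le_mul_of_nonneg_right ?_ (norm_nonneg _))
      refine norm_mulOp_real_le_norm F.coef_uy (isCoef_wtY hσ) (fun p => ?_) _
      refine (F.uy_weight p).trans ?_
      rw [← wtY_mul_self, abs_of_pos (wtY_pos σ p)]
      have := wtY_pos σ p
      have := wtY_le_one hσ p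
      refine mul_le_mul_of_nonneg_left ?_ hK
      nlinarith
    have c3 := (Complex.abs_re_le_norm _).trans c1
    rw [Complex.sub_re] at c3
    have c4 := (abs_le.1 c3).1
    have c5 := (abs_le.1 c2).2
    linarith
  have t3 : (inner ℂ (mulOp (fun p => (u p : ℂ)) wx) (J (2 / 3) Z) : ℂ).re ≤
      2 * K * (‖w‖ * ‖Z‖) + 4 * K * ‖w‖ * D + K / 2 * D ^ 2 := by
    have c1 := commutator_J_const F.coef_u F.u_lip' (s := 2 / 3) (by norm_num) (by norm_num)
      S.dX_w Z
    rw [inner_mulOp_real F.coef_u]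
    have c2 : (inner ℂ (mulOp (fun p => (u p : ℂ)) (J (2 / 3) wx)) Z : ℂ).re ≤
        -(inner ℂ (mulOp (fun p => (uy p : ℂ)) (J (2 / 3) wx)) (J (2 / 3) wy) : ℂ).re +
          K / 2 * ‖J (2 / 3) wy‖ ^ 2 :=
      re_inner_dx_dyy_le F.ydiff_u F.u_nonneg F.u_lip (S.dX_w.multX (isSym_jsym h23))
      (mult_isUp (isSym_jsym h23) S.up_w) (mult_isUp (isSym_jsym h23) S.up_wy)
      (S.dY_w.multY (isSym_jsym h23)) (S.dY_wy.mult_shY (isSym_jsym h23))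
    have c3 := (Complex.abs_re_le_norm _).trans c1
    rw [Complex.sub_re] at c3
    have c4 := (abs_le.1 c3).1
    rw [inner_mulOp_real F.coef_u] at c2
    have c5 : |(inner ℂ (mulOp (fun p => (uy p : ℂ)) (J (2 / 3) wx)) (J (2 / 3) wy) : ℂ).re| ≤
        4 * K * ‖w‖ * D := by
      -- One factor Λ^{-1/3} is moved across u_y onto Λ^{-2/3}w_x, which becomes the order-zero
      -- quantity ∂_xΛ^{-1}w.
      have e : J (2 / 3) wy = J (1 / 3) (J (1 / 3) wy) := by rw [J_J h13 h13]; norm_num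
      rw [e, ← inner_J h13]
      refine (abs_re_inner_le _ _).trans (mul_le_mul_of_nonneg_right ?_ (norm_nonneg _))
      refine (norm_J_mulOp_le F.coef_uy (F.uy_lip'' hσ) F.uy_le (by norm_num) (by norm_num) _).trans ?_
      rw [J_J h13 h23, show (1 / 3 + 2 / 3 : ℝ) = 1 by norm_num, S.dX_w.J_eq le_rfl]
      exact mul_le_mul_of_nonneg_left (norm_DJ_le le_rfl w) (by positivity)
    have c6 := neg_abs_le (inner ℂ (mulOp (fun p => (uy p : ℂ)) (J (2 / 3) wx)) (J (2 / 3) wy) : ℂ).re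
    have c7 : K / 2 * ‖J (2 / 3) wy‖ ^ 2 ≤ K / 2 * D ^ 2 := by gcongr
    linarith
  have t4 : (inner ℂ (mulOp (fun p => (vy p : ℂ)) w) (J (2 / 3) Z) : ℂ).re ≤ K * ‖w‖ * ‖Z‖ :=
    (le_abs_self _).trans ((abs_re_inner_le _ _).trans (mul_le_mul
      (norm_mulOp_real_le F.coef_vy F.vy_le w) hJZ (norm_nonneg _) (by positivity)))
  have t5 : (inner ℂ (mulOp (fun p => (v p : ℂ)) wy) (J (2 / 3) Z) : ℂ).re ≤ 4 * K * D * ‖Z‖ := by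
    have e : J (2 / 3) Z = J (1 / 3) (J (1 / 3) Z) := by rw [J_J h13 h13]; norm_num
    rw [e, ← inner_J h13]
    refine (le_abs_self _).trans ((abs_re_inner_le _ _).trans (mul_le_mul ?_
      (norm_J_le h13 Z) (norm_nonneg _) (by positivity)))
    exact norm_J_mulOp_le F.coef_v F.v_lip' F.v_le (by norm_num) (by norm_num) _
  have t6 : -(inner ℂ hy (J (2 / 3) Z) : ℂ).re ≤ ‖J (2 / 3) hy‖ * ‖Z‖ := by
    rw [← inner_J h23]
    exact (neg_le_abs _).trans (abs_re_inner_le _ _)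
  have e2 : ‖Z‖ ^ 2 = (inner ℂ wt (J (2 / 3) Z) : ℂ).re +
      ((inner ℂ (mulOp (fun p => (uy p : ℂ)) fx) (J (2 / 3) Z) : ℂ).re +
        (inner ℂ (mulOp (fun p => (u p : ℂ)) wx) (J (2 / 3) Z) : ℂ).re) +
      ((inner ℂ (mulOp (fun p => (vy p : ℂ)) w) (J (2 / 3) Z) : ℂ).re +
        (inner ℂ (mulOp (fun p => (v p : ℂ)) wy) (J (2 / 3) Z) : ℂ).re) -
      (inner ℂ hy (J (2 / 3) Z) : ℂ).re := by
    rw [e0]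
    nth_rewrite 1 [e1]
    simp only [inner_add_left, inner_sub_left, Complex.add_re, Complex.sub_re]
  rw [e2]
  linarith

omit F in
/-- The boundary term of `f_yy` in the subelliptic estimate. -/
lemma LinSol.boundary_wy_le (hσ : 0 < σ) :
    ‖(inner ℂ wyy (DJ (4 / 3) f) + inner ℂ wy (DJ (4 / 3) w) : ℂ)‖ ≤
      √(2 * (‖J (2 / 3) wyy‖ * ‖J (1 / 3) wy‖)) *
      √(2 * ((‖w‖ + ‖f‖) *
        ((1 + σ / (4 * 1)) ^ (σ / 2) * ‖mulOp (fun p => (wtY σ p : ℂ)) (J (2 / 3) fx)‖))) := by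
  have h13 : (0 : ℝ) ≤ 1 / 3 := by norm_num
  have h12 : (0 : ℝ) ≤ 1 / 2 := by norm_num
  have h16 : (0 : ℝ) ≤ 1 / 6 := by norm_num
  have h56 : (0 : ℝ) ≤ 5 / 6 := by norm_num
  have h23 : (0 : ℝ) ≤ 2 / 3 := by norm_num
  -- The split 4/3 = 1/2 + 5/6 fits the trace inequality: twice 1/2 is 2/3 + 1/3, the orders known
  -- for f_yyy and f_yy, and twice 5/6 is 1 + 2/3, the orders known for f_x, the latter only with a
  -- weight.
  have hwx : DJ (4 / 3) w = J (1 / 2) (J (5 / 6) wx) := by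
    rw [J_J h12 h56, ← S.dX_w.J_eq (by norm_num)]; norm_num
  have hfx : DJ (4 / 3) f = J (1 / 2) (J (5 / 6) fx) := by
    rw [J_J h12 h56, ← S.dX_f.J_eq (by norm_num)]; norm_num
  set Θ := mulOp (fun z => (cutoff z : ℂ)) with hΘ
  have hΘJ : ∀ {s : ℝ}, 0 ≤ s → ∀ q, J s (Θ q) = Θ (J s q) := fun hs q =>
    mult_mulOp isCoef_cutoff (α := fun z => (Real.exp (-|z.2|) : ℂ)) (fun p => rfl)
      (isSym_jsym hs) q
  have hneg : ∀ q, mulOp (fun z => ((-cutoff z : ℝ) : ℂ)) q = -Θ q := by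
    intro q
    have := mulOp_const_mul isCoef_cutoff (-1) q
    rw [neg_one_smul] at this
    rw [← this]; congr 2; funext z; push_cast; ring
  have hfw : HasD shY (DJ (4 / 3) f) (DJ (4 / 3) w) :=
    S.dY_f.mult_shY (isSym_dsym_jsym (by norm_num))
  -- Since Λ^{-2/3}f_x is controlled only with a weight decaying in y, the trace is computed after
  -- multiplication by e^{-y}, whose square is dominated by ⟨y⟩^{-σ/2}.
  rw [boundary_cutoff S.dY_wy hfw (mult_isUp (isSym_dsym_jsym (by norm_num)) S.up_f)
    (mult_isUp (isSym_dsym_jsym (by norm_num)) S.up_w), hneg]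
  have hm : HasD shY (J (5 / 6) fx) (J (5 / 6) wx) := S.dY_fx.mult_shY (isSym_jsym h56)
  have hq := yDiff_cutoff.mul_shY hm (mult_isUp (isSym_jsym h56) S.up_fx)
  rw [hneg] at hq
  have hp : HasD shY (J (1 / 2) wy) (J (1 / 2) wyy) := S.dY_wy.mult_shY (isSym_jsym h12)
  have key := hp.boundary_le hq
  have e1 : inner ℂ wyy (Θ (DJ (4 / 3) f)) + inner ℂ wy (-Θ (DJ (4 / 3) f) + Θ (DJ (4 / 3) w)) =
      (inner ℂ (J (1 / 2) wyy) (Θ (J (5 / 6) fx)) +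
        inner ℂ (J (1 / 2) wy) (-Θ (J (5 / 6) fx) + Θ (J (5 / 6) wx)) : ℂ) := by
    rw [inner_J h12, inner_J h12, map_add, map_neg, hΘJ h12, hΘJ h12, hwx, hfx]
  rw [e1]
  refine key.trans (mul_le_mul (Real.sqrt_le_sqrt ?_) (Real.sqrt_le_sqrt ?_) (Real.sqrt_nonneg _)
    (Real.sqrt_nonneg _))
  · have e2 : inner ℂ (J (1 / 2) wyy) (J (1 / 2) wy) = inner ℂ (J (2 / 3) wyy) (J (1 / 3) wy) := by
      rw [inner_J h12, inner_J h23, J_J h12 h12, J_J h23 h13]; norm_num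
    rw [e2]
    have := neg_abs_le (inner ℂ (J (2 / 3) wyy) (J (1 / 3) wy) : ℂ).re
    have := abs_re_inner_le (J (2 / 3) wyy) (J (1 / 3) wy)
    linarith
  · have e2 : inner ℂ (-Θ (J (5 / 6) fx) + Θ (J (5 / 6) wx)) (Θ (J (5 / 6) fx)) =
        inner ℂ (DJ 1 (w - f)) (Θ (Θ (J (2 / 3) fx))) := by
      have e3 : -Θ (J (5 / 6) fx) + Θ (J (5 / 6) wx) = Θ (J (5 / 6) (wx - fx)) := by
        rw [map_sub, map_sub]; abel
      have e4 : J (5 / 6) fx = J (1 / 6) (J (2 / 3) fx) := by rw [J_J h16 h23]; norm_num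
      have e5 : J (1 / 6) (J (5 / 6) (wx - fx)) = DJ 1 (w - f) := by
        rw [J_J h16 h56, show (1 / 6 + 5 / 6 : ℝ) = 1 by norm_num, map_sub, map_sub,
          S.dX_w.J_eq le_rfl, S.dX_f.J_eq le_rfl]
      rw [e3, hΘ, inner_mulOp_real isCoef_cutoff, ← hΘ, e4, ← hΘJ h16, ← hΘJ h16, ← inner_J h16, e5]
    rw [e2]
    have n1 : ‖DJ 1 (w - f)‖ ≤ ‖w‖ + ‖f‖ := (norm_DJ_le le_rfl _).trans (norm_sub_le _ _)
    have n2 : ‖Θ (Θ (J (2 / 3) fx))‖ ≤ (1 + σ / (4 * 1)) ^ (σ / 2) *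
        ‖mulOp (fun p => (wtY σ p : ℂ)) (J (2 / 3) fx)‖ := by
      rw [hΘ, mulOp_mulOp isCoef_cutoff isCoef_cutoff]
      refine norm_mulOp_le_norm (isCoef_cutoff.mul isCoef_cutoff) (isCoef_wtY hσ.le) _ fun p => ?_
      rw [← Complex.ofReal_mul, Complex.norm_real, Complex.norm_real,
        Real.norm_of_nonneg (mul_pos (cutoff_pos p) (cutoff_pos p)).le,
        Real.norm_of_nonneg (wtY_pos σ p).le]
      have e6 : cutoff p * cutoff p = Real.exp (-(2 * 1) * |p.2.2|) := by
        rw [cutoff, ← Real.exp_add]; congr 1; ring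
      have e7 : wtY σ p = bracket |p.2.2| ^ (-σ / 2) := by simp [wtY, bracket]
      rw [e6, e7]
      exact exp_le_bracket_rpow one_pos hσ (abs_nonneg _)
    have n3 := neg_abs_le (inner ℂ (DJ 1 (w - f)) (Θ (Θ (J (2 / 3) fx))) : ℂ).re
    have n4 := (abs_re_inner_le (DJ 1 (w - f)) (Θ (Θ (J (2 / 3) fx)))).trans
      (mul_le_mul n1 n2 (norm_nonneg _) (by positivity))
    linarith

omit F in
/-- The boundary term of `g` in the subelliptic estimate. -/
lemma LinSol.boundary_g_le (hσ : 1 / 2 < σ) (hgu : IsUp g) {r : HH}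
    (hr : J (1 / 3) gy = mulOp (fun z => (√(hardyWeight σ z.2.2) : ℂ)) r) :
    ‖(inner ℂ gy (DJ (4 / 3) f) + inner ℂ g (DJ (4 / 3) w) : ℂ)‖ ≤
      √(4 * ‖r‖ ^ 2) * √(2 * (‖w‖ * ‖f‖)) := by
  have h13 : (0 : ℝ) ≤ 1 / 3 := by norm_num
  have e1 : ∀ q, DJ (4 / 3) q = J (1 / 3) (DJ 1 q) := fun q => by
    rw [J_DJ h13 le_rfl]; norm_num
  -- All of Λ^{-1/3} goes to g; what remains on f and w is ∂_xΛ^{-1}, of order zero.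
  rw [e1, e1, ← inner_J h13, ← inner_J h13]
  have hp : HasD shY (J (1 / 3) g) (J (1 / 3) gy) := S.dY_g.mult_shY (isSym_jsym h13)
  have hq : HasD shY (DJ 1 f) (DJ 1 w) := S.dY_f.mult_shY (isSym_dsym_jsym le_rfl)
  refine (hp.boundary_le hq).trans (mul_le_mul (Real.sqrt_le_sqrt ?_) (Real.sqrt_le_sqrt ?_)
    (Real.sqrt_nonneg _) (Real.sqrt_nonneg _))
  · exact boundary_self_le hσ hp (mult_isUp (isSym_jsym h13) hgu) hr
  · have n3 := neg_abs_le (inner ℂ (DJ 1 w) (DJ 1 f) : ℂ).re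
    have n4 := (abs_re_inner_le (DJ 1 w) (DJ 1 f)).trans
      (mul_le_mul (norm_DJ_le le_rfl w) (norm_DJ_le le_rfl f) (norm_nonneg _) (norm_nonneg _))
    linarith

/-- Coercivity: moving half of Λ^{-4/3} across u_y leaves ⟨u_y Λ^{-2/3}f_x, Λ^{-2/3}f_x⟩, where the
lower bound for u_y applies. The commutator must keep its weight K⟨y⟩^{-σ/2}, since Λ^{-2/3}f_x is
controlled only with that weight. -/
lemma LinSol.norm_wtY_sq_le_inner (hσ : 0 ≤ σ) :
    K⁻¹ * ‖mulOp (fun p => (wtY σ p : ℂ)) (J (2 / 3) fx)‖ ^ 2 ≤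
      (inner ℂ (mulOp (fun p => (uy p : ℂ)) fx) (DJ (4 / 3) f) : ℂ).re +
        2 * K * (‖f‖ * ‖mulOp (fun p => (wtY σ p : ℂ)) (J (2 / 3) fx)‖) := by
  have h23 : (0 : ℝ) ≤ 2 / 3 := by norm_num
  have hK := F.nonneg
  set X := J (2 / 3) fx with hX
  have hw := isCoef_wtY hσ
  have hL : IsCoef (fun p => ((K * wtY σ p : ℝ) : ℂ)) := by
    simpa using (isCoef_const (K : ℂ)).mul hw
  have c1 := commutator_J F.coef_uy hL F.uy_lip'
    (ℓ := fun q => ((K * bracket q.2 ^ (-σ / 2) : ℝ) : ℂ)) (fun p => rfl) (s := 2 / 3)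
    (by norm_num) (by norm_num) S.dX_f X
  have e1 : J (2 / 3) X = DJ (4 / 3) f := by
    rw [hX, J_J h23 h23, ← S.dX_f.J_eq (by norm_num)]; norm_num
  have n1 : ‖mulOp (fun p => ((K * wtY σ p : ℝ) : ℂ)) X‖ ≤ K * ‖mulOp (fun p => (wtY σ p : ℂ)) X‖ :=
    norm_mulOp_real_le_norm hL hw (fun p => by rw [abs_mul, abs_of_nonneg hK]) X
  -- The lower bound for u_y holds on the slab only. Its indicator does not depend on x, so
  -- Λ^{-2/3}f_x vanishes outside the slab as f_x does.
  have hin : mulOp (ind (slab T)) X = X := by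
    have hi := isCoef_ind (measurableSet_slab T)
    have := mult_mulOp hi (α := fun q => ind (slab T) (q.1, 0, q.2)) (fun p => by
      simp [ind, slab, indicator]) (isSym_jsym h23) fx
    rw [S.in_fx] at this
    exact this.symm
  have hpos : K⁻¹ * ‖mulOp (fun p => (wtY σ p : ℂ)) X‖ ^ 2 ≤
      (inner ℂ (mulOp (fun p => (uy p : ℂ)) X) X : ℂ).re := by
    have hww : IsCoef (fun p => ((wtY σ p * wtY σ p : ℝ) : ℂ)) := by simpa using hw.mul hw
    have e2 : ‖mulOp (fun p => (wtY σ p : ℂ)) X‖ ^ 2 = ∫ p, (wtY σ p * wtY σ p) * ‖X p‖ ^ 2 := by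
      rw [← mulOp_pos_re hww, ← re_inner_self, inner_mulOp_real hw, mulOp_mulOp hw hw,
        inner_mulOp_real hww]
      simp only [Complex.ofReal_mul]
    rw [mulOp_pos_re F.coef_uy, e2, ← integral_const_mul]
    refine integral_mono_ae ((integrable_coef_mul_norm_sq hww X).const_mul _)
      (integrable_coef_mul_norm_sq F.coef_uy X) ?_
    have hi := mulOp_ae (isCoef_ind (measurableSet_slab T)) X
    rw [hin] at hi
    filter_upwards [hi] with p hp
    by_cases hs : p ∈ slab T
    · simp only [wtY_mul_self, ← mul_assoc]
      exact mul_le_mul_of_nonneg_right (F.uy_lower p hs) (by positivity)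
    · have : X p = 0 := by rw [hp, ind, indicator_of_notMem hs, zero_mul]
      simp [this]
  have c3 := (Complex.abs_re_le_norm _).trans c1
  rw [Complex.sub_re, e1, ← inner_mulOp_real F.coef_uy, ← inner_mulOp_real F.coef_uy] at c3
  have c4 := (abs_le.1 c3).2
  have c5 : ‖f‖ * ‖mulOp (fun p => ((K * wtY σ p : ℝ) : ℂ)) X‖ ≤
      ‖f‖ * (K * ‖mulOp (fun p => (wtY σ p : ℂ)) X‖) :=
    mul_le_mul_of_nonneg_left n1 (norm_nonneg _)
  linarith

/-- The differentiated equation tested with B = ∂_xΛ^{-4/3}f. The transport term returns at most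
half of the left side, up to an order-zero error; absorbing it doubles the other contributions,
hence the factors 2 and 8. -/
lemma LinSol.inner_le :
    (inner ℂ (mulOp (fun p => (uy p : ℂ)) fx) (DJ (4 / 3) f) : ℂ).re ≤
      ‖(inner ℂ gy (DJ (4 / 3) f) + inner ℂ g (DJ (4 / 3) w) : ℂ)‖ +
      ‖(inner ℂ wyy (DJ (4 / 3) f) + inner ℂ wy (DJ (4 / 3) w) : ℂ)‖ +
      2 * ‖J (1 / 3) h‖ * ‖w‖ + 2 * ‖J (1 / 3) wy‖ * ‖w‖ + 8 * K * ‖J (1 / 3) wy‖ * ‖f‖ +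
      ((∫ r in Ioi (0 : ℝ), Prandtl.wt (4 / 3) r * (1 + r) ^ (-(1 / 2) : ℝ)) * 2 + 3) * K *
        (‖w‖ * ‖f‖) := by
  have h13 : (0 : ℝ) ≤ 1 / 3 := by norm_num
  have h43 : (1 : ℝ) ≤ 4 / 3 := by norm_num
  have hK := F.nonneg
  have hs := isSym_dsym_jsym h43
  set c0 := ∫ r in Ioi (0 : ℝ), Prandtl.wt (4 / 3) r * (1 + r) ^ (-(1 / 2) : ℝ)
  set B := DJ (4 / 3) f with hB
  set Bw := DJ (4 / 3) w with hBw
  have e1 : ∀ q, DJ (4 / 3) q = J (1 / 3) (DJ 1 q) := fun q => by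
    rw [J_DJ h13 le_rfl]; norm_num
  have hfw : HasD shY B Bw := S.dY_f.mult_shY hs
  have hBX : HasD trX B (DJ (4 / 3) fx) := S.dX_f.multX hs
  have upB : IsUp B := mult_isUp hs S.up_f
  have upBw : IsUp Bw := mult_isUp hs S.up_w
  have nB : ‖B‖ ≤ ‖f‖ := norm_DJ_le h43 f
  have nf := norm_nonneg f
  have nw := norm_nonneg w
  -- the time derivative
  have t1 : 2 * (inner ℂ wt B : ℂ).re = (inner ℂ wyy B + inner ℂ wy Bw : ℂ).re +
      (inner ℂ gy B + inner ℂ g Bw : ℂ).re := by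
    -- Green's formula for f_t − f_yy − g, whose trace is zero, relates ⟨w_t, B⟩ + ⟨f_t, B_y⟩ to the
    -- boundary forms of f_yy and g. By integration by parts in t and skewness of ∂_xΛ^{-4/3}, both
    -- pairings have the same real part.
    have a1 := congrArg Complex.re (S.dY_q.ibpY hfw S.up_q S.up_qy)
    have a2 := congrArg Complex.re (S.dT_w.ibpT (S.dT_f.multT hs))
    have a3 : (inner ℂ w (DJ (4 / 3) ft) : ℂ).re = -(inner ℂ ft Bw : ℂ).re := by
      rw [re_inner_comm, inner_DJ h43, Complex.neg_re]
    simp only [inner_sub_left, Complex.add_re, Complex.sub_re, Complex.zero_re] at a1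
    rw [Complex.add_re, Complex.zero_re] at a2
    change (inner ℂ wt B : ℂ).re + (inner ℂ w (DJ (4 / 3) ft) : ℂ).re = 0 at a2
    rw [Complex.add_re, Complex.add_re]
    linarith
  -- the source
  have t2 : (inner ℂ hy B : ℂ).re ≤
      (inner ℂ gy B + inner ℂ g Bw : ℂ).re + ‖J (1 / 3) h‖ * ‖w‖ := by
    obtain ⟨a0, a1, a2⟩ := S.dY_h_sub_g F
    have a3 := congrArg Complex.re (a0.ibpY hfw a1 a2)
    simp only [inner_sub_left, Complex.add_re, Complex.sub_re, Complex.zero_re] at a3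
    have a4 : |(inner ℂ h Bw : ℂ).re| ≤ ‖J (1 / 3) h‖ * ‖w‖ := by
      rw [hBw, e1, ← inner_J h13]
      exact (abs_re_inner_le _ _).trans
        (mul_le_mul_of_nonneg_left (norm_DJ_le le_rfl w) (norm_nonneg _))
    rw [Complex.add_re]
    linarith [neg_abs_le (inner ℂ h Bw : ℂ).re]
  have t3 : (inner ℂ wyy B : ℂ).re ≤
      (inner ℂ wyy B + inner ℂ wy Bw : ℂ).re + ‖J (1 / 3) wy‖ * ‖w‖ := by
    have a4 : |(inner ℂ wy Bw : ℂ).re| ≤ ‖J (1 / 3) wy‖ * ‖w‖ := by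
      rw [hBw, e1, ← inner_J h13]
      exact (abs_re_inner_le _ _).trans
        (mul_le_mul_of_nonneg_left (norm_DJ_le le_rfl w) (norm_nonneg _))
    rw [Complex.add_re]
    linarith [neg_abs_le (inner ℂ wy Bw : ℂ).re]
  -- the transport terms
  have t4 : -(inner ℂ (mulOp (fun p => (u p : ℂ)) wx) B : ℂ).re ≤
      (inner ℂ (mulOp (fun p => (uy p : ℂ)) fx) B : ℂ).re / 2 + (c0 + 1 / 2) * K * (‖w‖ * ‖f‖) := by
    -- As uB vanishes at y = 0, Green's formula gives ⟨u w_x, B⟩ = −⟨u_y f_x, B⟩ − ⟨u f_x, B_y⟩ in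
    -- real part. Integration by parts in x and the commutator with ∂_xΛ^{-4/3} give ⟨u w_x, B⟩ ≈ ⟨u
    -- f_x, B_y⟩; adding the two yields twice the transport term.
    have a1 := congrArg Complex.re ((F.ydiff_u.mul_trY_of_le (K := K) (fun p hp => by
      rw [Complex.norm_real]; exact F.u_le_mul p hp) hfw upB).ibpY S.dY_fx (upB.mulOp F.coef_u)
      ((upB.mulOp F.coef_uy).add (upBw.mulOp F.coef_u)))
    rw [inner_add_left, Complex.add_re, Complex.add_re, Complex.zero_re,
      inner_mulOp_real F.coef_uy, inner_mulOp_real F.coef_u, inner_mulOp_real F.coef_u,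
      re_inner_comm B, re_inner_comm Bw, re_inner_comm B, inner_mulOp_real F.coef_u fx] at a1
    have a2 := (Complex.abs_re_le_norm _).trans
      (HasD.lipX_const F.coef_u F.u_lip' S.dX_w hBX)
    have a3 := (Complex.abs_re_le_norm _).trans
      (anticommutator_DJ F.coef_u F.u_lip' S.dX_f w)
    rw [Complex.add_re, ← inner_mulOp_real F.coef_u, re_inner_comm w,
      inner_mulOp_real F.coef_u (DJ (4 / 3) fx)] at a2
    rw [Complex.add_re] at a3
    have a4 := (abs_le.1 a2).1
    have a5 := (abs_le.1 a3).2
    have a6 : K * (‖w‖ * ‖B‖) ≤ K * (‖w‖ * ‖f‖) := by gcongr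
    linarith
  have t5 : -(inner ℂ (mulOp (fun p => (vy p : ℂ)) w) B : ℂ).re ≤ K * (‖w‖ * ‖f‖) := by
    refine (neg_le_abs _).trans ((abs_re_inner_le _ _).trans ?_)
    rw [← mul_assoc]
    exact mul_le_mul (norm_mulOp_real_le F.coef_vy F.vy_le w) nB (norm_nonneg _) (by positivity)
  have t6 : -(inner ℂ (mulOp (fun p => (v p : ℂ)) wy) B : ℂ).re ≤ 4 * K * ‖J (1 / 3) wy‖ * ‖f‖ := by
    rw [hB, e1, ← inner_J h13]
    exact (neg_le_abs _).trans ((abs_re_inner_le _ _).trans (mul_le_mul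
      (norm_J_mulOp_le F.coef_v F.v_lip' F.v_le (by norm_num) (by norm_num) _)
      (norm_DJ_le le_rfl f) (norm_nonneg _) (by positivity)))
  have e2 : (inner ℂ hy B : ℂ).re = (inner ℂ wt B : ℂ).re +
      ((inner ℂ (mulOp (fun p => (uy p : ℂ)) fx) B : ℂ).re +
        (inner ℂ (mulOp (fun p => (u p : ℂ)) wx) B : ℂ).re) +
      ((inner ℂ (mulOp (fun p => (vy p : ℂ)) w) B : ℂ).re +
        (inner ℂ (mulOp (fun p => (v p : ℂ)) wy) B : ℂ).re) - (inner ℂ wyy B : ℂ).re := by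
    nth_rewrite 1 [S.eq_dy F]
    simp only [inner_add_left, inner_sub_left, Complex.add_re, Complex.sub_re]
  have n1 := Complex.re_le_norm (inner ℂ gy B + inner ℂ g Bw : ℂ)
  have n2 := Complex.re_le_norm (inner ℂ wyy B + inner ℂ wy Bw : ℂ)
  linarith

end Estimates

/-! ### Closing the estimates -/

/-- If E exceeded m²(a + b + N) with m = 5C, then D ≤ E/m by the first inequality, and the second
would force m² ≤ C(3 + m), false for m = 5C. -/
lemma exists_le_of_sq_le {C : ℝ} (hC : 1 ≤ C) : ∃ M : ℝ, 1 ≤ M ∧ ∀ N D E a b : ℝ,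
    0 ≤ N → 0 ≤ D → 0 ≤ E → 0 ≤ a → 0 ≤ b → D ^ 2 ≤ N * E →
    E ^ 2 ≤ C * ((a + b + N + D) * E + N * D + D ^ 2) → E ≤ M * (a + b + N) := by
  refine ⟨(5 * C) ^ 2, by nlinarith, fun N D E a b hN hD hE ha hb h1 h2 => ?_⟩
  by_contra hcon
  push Not at hcon
  set m := 5 * C with hm
  have hm5 : 5 ≤ m := by linarith
  have hE0 : 0 < E := lt_of_le_of_lt (by positivity) hcon
  have hmN : m ^ 2 * N ≤ E := by nlinarith [mul_nonneg (sq_nonneg m) (add_nonneg ha hb)]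
  have hmD : m * D ≤ E := by
    refine abs_le_of_sq_le_sq' ?_ hE |>.2
    calc (m * D) ^ 2 = m ^ 2 * D ^ 2 := by ring
      _ ≤ m ^ 2 * (N * E) := by gcongr
      _ = m ^ 2 * N * E := by ring
      _ ≤ E * E := by gcongr
      _ = E ^ 2 := by ring
  have hDE : D ≤ E := by nlinarith
  have h3 : m ^ 2 * E ^ 2 ≤ C * ((3 + m) * E ^ 2) := by
    calc m ^ 2 * E ^ 2 ≤ m ^ 2 * (C * ((a + b + N + D) * E + N * D + D ^ 2)) := by gcongr
      _ = C * ((m ^ 2 * (a + b + N)) * E + m * (m * D) * E + (m ^ 2 * N) * D + (m * D) ^ 2) := by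
        ring
      _ ≤ C * (E * E + m * E * E + E * E + E ^ 2) := by gcongr
      _ = C * ((3 + m) * E ^ 2) := by ring
  have h4 : m ^ 2 ≤ C * (3 + m) := by
    rw [← mul_assoc] at h3
    exact le_of_mul_le_mul_right h3 (by positivity)
  nlinarith

/-- If S = a + D exceeded the right side, then b ≤ S/ε and hence E ≤ LS, while H, N, R and D are all
at most S/m. Every product bounding a² has such a small factor, so S² ≤ 2a² + 2D² gives m ≤ 2C(5 +
L) + 2, contrary to the choice of m. -/
lemma exists_le_of_sq_le' {C ε : ℝ} (hC : 1 ≤ C) (hε : 0 < ε) : ∃ M : ℝ, 0 < M ∧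
    ∀ N D E a b H R : ℝ, 0 ≤ N → 0 ≤ D → 0 ≤ E → 0 ≤ a → 0 ≤ b → 0 ≤ H → 0 ≤ R →
    D ^ 2 ≤ N * E → E ≤ C * (a + b + N) →
    a ^ 2 ≤ C * (N * a + R * N + E * D + H * N + D * N + N * N) →
    a + D ≤ ε * b + M * (H + N + R) := by
  set L := C * (2 + 1 / ε) with hL
  have hε' : 0 < 1 / ε := by positivity
  have hL1 : 1 ≤ L := by nlinarith
  set m := 2 * C * (5 + L) + 3 with hm
  have hm1 : 3 ≤ m := by nlinarith
  refine ⟨m ^ 2 * L, by positivity, fun N D E a b H R hN hD hE ha hb hH hR h1 h2 h3 => ?_⟩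
  by_contra hcon
  push Not at hcon
  set S := a + D with hS
  have hm0 : 0 < m := by linarith
  have hS0 : 0 < S := lt_of_le_of_lt (by positivity) hcon
  have hb' : b ≤ 1 / ε * S := by
    rw [div_mul_eq_mul_div, one_mul, le_div_iff₀ hε]
    nlinarith [mul_nonneg (by positivity : 0 ≤ m ^ 2 * L) (by positivity : 0 ≤ H + N + R)]
  have hQ : m ^ 2 * L * (H + N + R) ≤ S := by nlinarith [mul_nonneg hε.le hb]
  have hQm : m * (H + N + R) ≤ S := by
    refine le_trans ?_ hQ
    have : m ≤ m ^ 2 * L := by nlinarith [mul_le_mul_of_nonneg_left hL1 (sq_nonneg m)]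
    gcongr
  have hmN : m * N ≤ S := (mul_le_mul_of_nonneg_left (by linarith) hm0.le).trans hQm
  have hmH : m * H ≤ S := (mul_le_mul_of_nonneg_left (by linarith) hm0.le).trans hQm
  have hmR : m * R ≤ S := (mul_le_mul_of_nonneg_left (by linarith) hm0.le).trans hQm
  have hN1 : N ≤ S := (le_mul_of_one_le_left hN (by linarith)).trans hmN
  have hE' : E ≤ L * S := by
    refine h2.trans ?_
    rw [hL, mul_assoc]
    refine mul_le_mul_of_nonneg_left ?_ (by linarith)
    have : a ≤ S := by linarith
    linarith
  have hmD : m * D ≤ S := by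
    refine abs_le_of_sq_le_sq' ?_ hS0.le |>.2
    calc (m * D) ^ 2 = m ^ 2 * D ^ 2 := by ring
      _ ≤ m ^ 2 * (N * (L * S)) := by gcongr; exact h1.trans (by gcongr)
      _ = m ^ 2 * L * N * S := by ring
      _ ≤ S * S := by
        gcongr
        refine le_trans ?_ hQ
        gcongr
        linarith
      _ = S ^ 2 := by ring
  have haS : a ≤ S := by linarith
  have hDS : D ≤ S := by linarith
  have h4 : m * a ^ 2 ≤ C * ((5 + L) * S ^ 2) := by
    calc m * a ^ 2 ≤ m * (C * (N * a + R * N + E * D + H * N + D * N + N * N)) := by gcongr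
      _ = C * ((m * N) * a + (m * R) * N + E * (m * D) + (m * H) * N + (m * D) * N + (m * N) * N) := by
        ring
      _ ≤ C * (S * S + S * S + L * S * S + S * S + S * S + S * S) := by gcongr
      _ = C * ((5 + L) * S ^ 2) := by ring
  have h5 : m * D ^ 2 ≤ S ^ 2 := by
    calc m * D ^ 2 = (m * D) * D := by ring
      _ ≤ S * S := by gcongr
      _ = S ^ 2 := by ring
  have h6 : S ^ 2 ≤ 2 * a ^ 2 + 2 * D ^ 2 := by rw [hS]; linarith only [sq_nonneg (a - D)]
  have h7 : m * S ^ 2 ≤ (2 * C * (5 + L) + 2) * S ^ 2 := by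
    have := mul_le_mul_of_nonneg_left h6 hm0.le
    linarith only [this, h4, h5]
  have h8 : m ≤ 2 * C * (5 + L) + 2 := le_of_mul_le_mul_right h7 (by positivity)
  linarith

theorem exists_norm_J_wyy_le {σ K : ℝ} (hσ : 0 ≤ σ) (hK : 0 < K) : ∃ M : ℝ, 1 ≤ M ∧
    ∀ {T : ℝ} {u uy v vy : R3 → ℝ} {f ft fx w wt wx wy wyy h hy g gy : HH},
      FlowBound T σ K u uy v vy → LinSol T u uy v vy f ft fx w wt wx wy wyy h hy g gy →
      ‖J (2 / 3) wyy‖ ≤ M * (‖mulOp (fun p => (wtY σ p : ℂ)) (J (2 / 3) fx)‖ +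
        ‖J (2 / 3) hy‖ + (‖w‖ + ‖f‖)) := by
  obtain ⟨M, hM1, hM⟩ := exists_le_of_sq_le (C := 4 * K + 1) (by linarith)
  refine ⟨M, hM1, fun {T u uy v vy f ft fx w wt wx wy wyy h hy g gy} F S => ?_⟩
  have nf := norm_nonneg f
  have nw := norm_nonneg w
  have nD := norm_nonneg (J (1 / 3) wy)
  have nE := norm_nonneg (J (2 / 3) wyy)
  have na := norm_nonneg (mulOp (fun p => (wtY σ p : ℂ)) (J (2 / 3) fx))
  have nb := norm_nonneg (J (2 / 3) hy)
  refine hM _ (‖J (1 / 3) wy‖) _ _ _ (by positivity) nD nE na nb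
    (S.norm_J_wy_sq.trans (by gcongr; linarith)) ((S.norm_J_wyy_sq F hσ).trans ?_)
  generalize ‖J (1 / 3) wy‖ = D at *
  generalize ‖J (2 / 3) wyy‖ = E at *
  generalize ‖mulOp (fun p => (wtY σ p : ℂ)) (J (2 / 3) fx)‖ = a at *
  generalize ‖J (2 / 3) hy‖ = b at *
  generalize ‖f‖ = n at *
  generalize ‖w‖ = m at *
  have e1 : (K * a + 2 * K * n + 3 * K * m + 4 * K * D + b) * E ≤
      ((4 * K + 1) * (a + b + (m + n) + D)) * E := by
    refine mul_le_mul_of_nonneg_right ?_ nE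
    have := mul_nonneg hK.le na
    have := mul_nonneg hK.le nb
    have := mul_nonneg hK.le nf
    have := mul_nonneg hK.le nw
    nlinarith
  have e2 : 4 * K * m * D ≤ (4 * K + 1) * ((m + n) * D) := by
    rw [mul_assoc]
    exact mul_le_mul (by linarith) (mul_le_mul_of_nonneg_right (by linarith) nD) (by positivity)
      (by positivity)
  have e3 : K / 2 * D ^ 2 ≤ (4 * K + 1) * D ^ 2 :=
    mul_le_mul_of_nonneg_right (by linarith) (sq_nonneg _)
  linarith

theorem exists_norm_wtY_le {σ K ε : ℝ} (hσ : 1 / 2 < σ) (hK : 0 < K) (hε : 0 < ε) :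
    ∃ M : ℝ, 0 < M ∧
    ∀ {T : ℝ} {u uy v vy : R3 → ℝ} {f ft fx w wt wx wy wyy h hy g gy r : HH},
      FlowBound T σ K u uy v vy → LinSol T u uy v vy f ft fx w wt wx wy wyy h hy g gy → IsUp g →
      J (1 / 3) gy = mulOp (fun z => (√(hardyWeight σ z.2.2) : ℂ)) r →
      ‖mulOp (fun p => (wtY σ p : ℂ)) (J (2 / 3) fx)‖ + ‖J (1 / 3) wy‖ ≤
        ε * ‖J (2 / 3) hy‖ + M * (‖J (1 / 3) h‖ + (‖w‖ + ‖f‖) + ‖r‖) := by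
  obtain ⟨M₀, hM₀1, hM₀⟩ := exists_norm_J_wyy_le (σ := σ) (by linarith) hK
  set c₀ := ∫ r in Ioi (0 : ℝ), wt (4 / 3) r * (1 + r) ^ (-(1 / 2) : ℝ)
  set A := (1 + σ / (4 * 1)) ^ (σ / 2) with hA
  have hA0 : 0 < A := Real.rpow_pos_of_pos (by linarith) _
  set C := M₀ + K * (2 * K + A + 4 + 8 * K + |c₀ * 2 + 3| * K) with hC
  have hC' : K * (2 * K + A + 4 + 8 * K + |c₀ * 2 + 3| * K) ≤ C := by linarith
  have hpos : 0 ≤ K * (2 * K + A + 4 + 8 * K + |c₀ * 2 + 3| * K) := by positivity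
  obtain ⟨M, hM0, hM⟩ := exists_le_of_sq_le' (C := C) (by linarith) hε
  refine ⟨M, hM0, fun {T u uy v vy f ft fx w wt wx wy wyy h hy g gy r} F S hg hr => ?_⟩
  have nf := norm_nonneg f
  have nw := norm_nonneg w
  have nD := norm_nonneg (J (1 / 3) wy)
  have nE := norm_nonneg (J (2 / 3) wyy)
  have na := norm_nonneg (mulOp (fun p => (wtY σ p : ℂ)) (J (2 / 3) fx))
  have nb := norm_nonneg (J (2 / 3) hy)
  have nH := norm_nonneg (J (1 / 3) h)
  have nR := norm_nonneg r
  have h1 := S.norm_wtY_sq_le_inner F (by linarith : (0 : ℝ) ≤ σ)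
  have h2 := S.inner_le F
  have h3 := S.boundary_wy_le (by linarith : (0 : ℝ) < σ)
  rw [← hA] at h3
  have h4 := S.boundary_g_le hσ hg hr
  refine hM _ _ (‖J (2 / 3) wyy‖) _ _ _ _ (by positivity) nD nE na nb nH nR
    (S.norm_J_wy_sq.trans (by gcongr; linarith)) ((hM₀ F S).trans ?_) ?_
  · exact mul_le_mul_of_nonneg_right (by linarith) (by positivity)
  generalize ‖(inner ℂ wyy (DJ (4 / 3) f) + inner ℂ wy (DJ (4 / 3) w) : ℂ)‖ = βy at *
  generalize ‖(inner ℂ gy (DJ (4 / 3) f) + inner ℂ g (DJ (4 / 3) w) : ℂ)‖ = βg at *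
  generalize (inner ℂ (mulOp (fun p => (uy p : ℂ)) fx) (DJ (4 / 3) f) : ℂ).re = P at *
  generalize ‖J (1 / 3) wy‖ = D at *
  generalize ‖J (2 / 3) wyy‖ = E at *
  generalize ‖mulOp (fun p => (wtY σ p : ℂ)) (J (2 / 3) fx)‖ = a at *
  generalize ‖J (2 / 3) hy‖ = b at *
  generalize ‖J (1 / 3) h‖ = H at *
  generalize ‖r‖ = R at *
  generalize ‖f‖ = n at *
  generalize ‖w‖ = m at *
  set N := m + n with hN
  have hN0 : 0 ≤ N := by positivity
  have hmn : m * n ≤ N * N := mul_le_mul (by linarith) (by linarith) nf hN0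
  have g1 : βg ≤ 4 * (R * N) := by
    refine h4.trans ?_
    have a1 : √(4 * R ^ 2) = 2 * R := by
      rw [show 4 * R ^ 2 = (2 * R) ^ 2 by ring, Real.sqrt_sq (by positivity)]
    have a2 : √(2 * (m * n)) ≤ 2 * N := Real.sqrt_le_iff.2 ⟨by positivity, by nlinarith⟩
    rw [a1]
    linarith only [mul_le_mul_of_nonneg_left a2 (by positivity : 0 ≤ 2 * R)]
  -- Arithmetic–geometric mean for the two trace norms.
  have g2 : βy ≤ E * D + A * (N * a) := by
    refine h3.trans ?_
    have b1 : 0 ≤ 2 * (E * D) := by positivity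
    have b2 : 0 ≤ 2 * (N * (A * a)) := by positivity
    have := two_mul_le_add_sq (√(2 * (E * D))) (√(2 * (N * (A * a))))
    rw [Real.sq_sqrt b1, Real.sq_sqrt b2] at this
    linarith only [this]
  have h5 : a ^ 2 ≤ K * (P + 2 * K * (n * a)) := by
    rwa [inv_mul_le_iff₀ hK] at h1
  have hfin : P + 2 * K * (n * a) ≤ (2 * K + A + 4 + 8 * K + |c₀ * 2 + 3| * K) *
      (N * a + R * N + E * D + H * N + D * N + N * N) := by
    set X := 2 * K + A + 4 + 8 * K + |c₀ * 2 + 3| * K with hX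
    have p1 : 0 ≤ |c₀ * 2 + 3| * K := by positivity
    have s1 : 2 * K * (n * a) + A * (N * a) ≤ X * (N * a) := by
      have : n * a ≤ N * a := mul_le_mul_of_nonneg_right (by linarith) na
      have t : (2 * K + A) * (N * a) ≤ X * (N * a) :=
        mul_le_mul_of_nonneg_right (by linarith) (by positivity)
      linarith only [t, mul_le_mul_of_nonneg_left this (by positivity : 0 ≤ 2 * K)]
    have s2 : 4 * (R * N) ≤ X * (R * N) :=
      mul_le_mul_of_nonneg_right (by linarith) (by positivity)
    have s3 : E * D ≤ X * (E * D) := le_mul_of_one_le_left (by positivity) (by linarith)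
    have s4 : 2 * H * m ≤ X * (H * N) := by
      rw [mul_assoc]
      exact mul_le_mul (by linarith) (mul_le_mul_of_nonneg_left (by linarith) nH) (by positivity)
        (by linarith)
    have s5 : 2 * D * m + 8 * K * D * n ≤ X * (D * N) := by
      have t1 : D * m ≤ D * N := mul_le_mul_of_nonneg_left (by linarith) nD
      have t2 : D * n ≤ D * N := mul_le_mul_of_nonneg_left (by linarith) nD
      have t3 : (2 + 8 * K) * (D * N) ≤ X * (D * N) :=
        mul_le_mul_of_nonneg_right (by linarith) (by positivity)
      have t4 := mul_le_mul_of_nonneg_left t2 (by positivity : 0 ≤ 8 * K)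
      linarith only [t1, t3, t4]
    have s6 : (c₀ * 2 + 3) * K * (m * n) ≤ X * (N * N) := by
      refine (mul_le_mul_of_nonneg_right (mul_le_mul_of_nonneg_right (le_abs_self _) hK.le)
        (by positivity)).trans ?_
      exact mul_le_mul (by linarith) hmn (by positivity) (by linarith)
    calc P + 2 * K * (n * a) ≤ (2 * K * (n * a) + A * (N * a)) + 4 * (R * N) + E * D + 2 * H * m +
          (2 * D * m + 8 * K * D * n) + (c₀ * 2 + 3) * K * (m * n) := by linarith only [h2, g1, g2]
      _ ≤ X * (N * a) + X * (R * N) + X * (E * D) + X * (H * N) + X * (D * N) + X * (N * N) :=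
        add_le_add (add_le_add (add_le_add (add_le_add (add_le_add s1 s2) s3) s4) s5) s6
      _ = X * (N * a + R * N + E * D + H * N + D * N + N * N) := by ring
  refine h5.trans ((mul_le_mul_of_nonneg_left hfin hK.le).trans ?_)
  rw [← mul_assoc]
  exact mul_le_mul_of_nonneg_right hC' (by positivity)

/-! ### Solutions of the linearized equation, extended by zero -/

section Extension

variable {T : ℝ}

lemma HasI.hasD_trT {w w' : HH} (h : HasI trT w w') : HasD trT w w' := h.hasD (tr_zero w')

lemma HasI.hasD_trX {w w' : HH} (h : HasI trX w w') : HasD trX w w' := h.hasD (tr_zero w')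

lemma HasI.hasD_trY {w w' : HH} (h : HasI trY w w') : HasD trY w w' := h.hasD (tr_zero w')

lemma HasWeakDeriv.hasD_shY {w w' : R3 → ℂ}
    (hw : MemLp w 2 (volume.restrict (slab T))) (hw' : MemLp w' 2 (volume.restrict (slab T)))
    (h : HasWeakDeriv (slab T) (0, 0, 1) w w') : HasD shY (ez T w) (ez T w') := by
  refine (h.hasI_Y hw hw').hasD ?_
  have := isUp_ez hw'
  rw [shY, show ((0, 0, 0) : R3) = 0 from rfl, tr_zero]
  exact this

lemma ez_sub {w q : R3 → ℂ} (hw : MemLp w 2 (volume.restrict (slab T)))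
    (hq : MemLp q 2 (volume.restrict (slab T))) :
    ez T (fun p => w p - q p) = ez T w - ez T q := by
  apply Lp.ext
  filter_upwards [ez_ae hw, ez_ae hq, ez_ae (hw.sub hq), Lp.coeFn_sub (ez T w) (ez T q)]
    with p h1 h2 h3 h4
  rw [h4, Pi.sub_apply, h1, h2]
  refine h3.trans ?_
  by_cases hp : p ∈ slab T <;> simp [hp]

lemma mulOp_ind_ez {w : R3 → ℂ} (hw : MemLp w 2 (volume.restrict (slab T))) :
    mulOp (ind (slab T)) (ez T w) = ez T w := by
  conv_rhs => rw [← mulOp_one (ez T w)]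
  refine mulOp_congr (isCoef_ind (measurableSet_slab T)) (isCoef_const 1) ?_
  filter_upwards [ez_ae hw] with p h
  by_cases hp : p ∈ slab T
  · simp [ind, hp]
  · rw [h, indicator_of_notMem hp]; simp

theorem IsLinearizedSolution.exists_linSol {u uy v vy : R3 → ℝ}
    (hu : IsCoef (fun p => (((slab T).indicator u p : ℝ) : ℂ)))
    (hv : IsCoef (fun p => (((slab T).indicator v p : ℝ) : ℂ)))
    {f ft fx fy fxx fxy fyy fyyy h hy g gy : R3 → ℂ}
    (S : IsLinearizedSolution T u v f ft fx fy fxx fxy fyy fyyy h hy g gy) :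
    ∃ wt : HH, LinSol T ((slab T).indicator u) uy ((slab T).indicator v) vy
      (ez T f) (ez T ft) (ez T fx) (ez T fy) wt (ez T fxy) (ez T fyy) (ez T fyyy)
      (ez T h) (ez T hy) (ez T g) (ez T gy) := by
  -- Square integrability of f_t is not among the data: it is part of the zero trace condition in t,
  -- carried over by uniqueness of weak derivatives.
  obtain ⟨ft', hft', hwd, hI⟩ := S.initial_final.hasI_T
  have eft := weak_unique (isOpen_slab T) hwd S.deriv_t
  have hft : MemLp ft 2 (volume.restrict (slab T)) := (memLp_congr_ae eft).1 hft'
  rw [ez_congr hft' eft] at hI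
  obtain ⟨w', hw', hwd', hN⟩ := S.neumann.hasI_Y
  have ew := weak_unique (isOpen_slab T) hwd' S.deriv_yy
  rw [ez_congr hw' ew] at hN
  obtain ⟨q', hq', -, hQ⟩ := S.boundary.hasI_Y
  have eq : ez T (fun p => ft p - fyy p - g p) = ez T ft - ez T fyy - ez T g := by
    have := ez_sub (hft.sub S.memLp_fyy) S.memLp_g
    have h2 := ez_sub hft S.memLp_fyy
    rw [← h2]
    exact this
  have hQ' := hQ.hasD_trY
  rw [eq] at hQ'
  have upq : IsUp (ez T ft - ez T fyy - ez T g) :=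
    ((isUp_ez hft).sub (isUp_ez S.memLp_fyy)).sub (isUp_ez S.memLp_g)
  have hyy := S.deriv_yyy.hasD_shY S.memLp_fyy S.memLp_fyyy
  have hg := S.deriv_g.hasD_shY S.memLp_g S.memLp_gy
  -- The mixed derivative f_ty is produced by the boundary condition: f_t is the sum of f_t − f_yy −
  -- g, f_yy and g, each having an L² derivative in y.
  have dYft : HasD shY (ez T ft) (ez T q' + ez T fyyy + ez T gy) := by
    have := ((hQ'.toShY upq (isUp_ez hq')).add hyy shY_add).add hg shY_add
    rwa [show ez T ft - ez T fyy - ez T g + ez T fyy + ez T g = ez T ft by abel] at this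
  have dYf := S.deriv_y.hasD_shY S.memLp_f S.memLp_fy
  have dYfx := S.deriv_xy.hasD_shY S.memLp_fx S.memLp_fxy
  have hX := S.deriv_x.hasI_X S.memLp_f S.memLp_fx
  have eX : (fun r : ℝ => (tr (r • ((0, 1, 0) : R3)) : HH → HH)) = trX := by
    funext r w; simp [trX]
  have eT : (fun r : ℝ => (tr (r • ((1, 0, 0) : R3)) : HH → HH)) = trT := by
    funext r w; simp [trT]
  have wX : HasI trX (ez T fy) (ez T fxy) := by
    have := HasI.deriv_comm (e := (0, 1, 0)) (by rw [eX]; exact hX) dYf dYfx rfl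
    rwa [eX] at this
  have wT : HasI trT (ez T fy) (ez T q' + ez T fyyy + ez T gy) := by
    have := HasI.deriv_comm (e := (1, 0, 0)) (by rw [eT]; exact hI) dYf dYft rfl
    rwa [eT] at this
  have eqy : ez T q' + ez T fyyy + ez T gy - ez T fyyy - ez T gy = ez T q' := by abel
  refine ⟨ez T q' + ez T fyyy + ez T gy, ⟨mulOp_ind_ez S.memLp_fx, isUp_ez S.memLp_f,
    isUp_ez S.memLp_fx, isUp_ez S.memLp_fy, isUp_ez S.memLp_fyy, hX.hasD_trX, wX.hasD_trX,
    hI.hasD_trT, wT.hasD_trT, dYf, dYfx, dYft, hN.hasD_trY, hyy,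
    S.deriv_h.hasD_shY S.memLp_h S.memLp_hy, hg, upq, ?_, ?_, ?_⟩⟩
  · rw [eqy]; exact isUp_ez hq'
  · rw [eqy]; exact hQ'
  · apply Lp.ext
    filter_upwards [ez_ae hft, ez_ae S.memLp_fx, ez_ae S.memLp_fy, ez_ae S.memLp_fyy,
      ez_ae S.memLp_h, mulOp_ae hu (ez T fx), mulOp_ae hv (ez T fy),
      (ae_restrict_iff' (measurableSet_slab T)).1 S.equation,
      Lp.coeFn_sub (ez T ft + mulOp (fun p => (((slab T).indicator u p : ℝ) : ℂ)) (ez T fx) +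
        mulOp (fun p => (((slab T).indicator v p : ℝ) : ℂ)) (ez T fy)) (ez T fyy),
      Lp.coeFn_add (ez T ft + mulOp (fun p => (((slab T).indicator u p : ℝ) : ℂ)) (ez T fx))
        (mulOp (fun p => (((slab T).indicator v p : ℝ) : ℂ)) (ez T fy)),
      Lp.coeFn_add (ez T ft) (mulOp (fun p => (((slab T).indicator u p : ℝ) : ℂ)) (ez T fx))]
      with p h1 h2 h3 h4 h5 h6 h7 h8 h9 h10 h11
    rw [h9, Pi.sub_apply, h10, Pi.add_apply, h11, Pi.add_apply, h6, h7, h1, h2, h3, h4, h5]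
    by_cases hp : p ∈ slab T
    · simpa [hp] using h8 hp
    · simp [hp]

end Extension

/-! ### Norms -/

lemma enorm_eq_ofReal (w : HH) : ‖w‖ₑ = ENNReal.ofReal ‖w‖ := (ofReal_norm w).symm

lemma norm_eq_Fx (w : HH) : ‖w‖ₑ = eLpNorm (Fx w) 2 volume := by
  rw [← Lp.enorm_def, ← ofReal_norm, ← ofReal_norm, Fx.norm_map]

lemma HasD.Fx_trX_ae {f fx : HH} (h : HasD trX f fx) :
    Fx fx =ᵐ[volume] fun p => dsym p.2.1 * Fx f p := by
  have h1 := congrArg Fx (h.mult_eq (isSym_jsym zero_le_one) (isSym_dsym_jsym le_rfl))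
  rw [Fx_mult, Fx_mult] at h1
  have h2 := mulOp_ae (isSym_jsym zero_le_one).coef (Fx fx)
  rw [h1] at h2
  filter_upwards [h2, mulOp_ae (isSym_dsym_jsym le_rfl).coef (Fx f)] with p h3 h4
  rw [h4] at h3
  have h5 : jsym 1 p.2.1 ≠ 0 := by
    rw [← norm_pos_iff, norm_jsym]; exact Real.rpow_pos_of_pos (br_pos _) _
  exact mul_left_cancel₀ h5 (by rw [← h3]; ring)

lemma Fx_wtY_J_ae {σ : ℝ} (hσ : 0 ≤ σ) {f fx : HH} (h : HasD trX f fx) :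
    Fx (mulOp (fun p => (wtY σ p : ℂ)) (J (2 / 3) fx)) =ᵐ[volume] fun p =>
      (wtY σ p : ℂ) * (jsym (2 / 3) p.2.1 * (dsym p.2.1 * Fx f p)) := by
  have hs : IsSym (jsym (2 / 3)) := isSym_jsym (by norm_num)
  rw [Fx_mulOp (isCoef_wtY hσ) (α := fun q => ((bracket q.2 ^ (-σ / 2) : ℝ) : ℂ)) (fun p => rfl),
    J, Fx_mult]
  filter_upwards [mulOp_ae (isCoef_wtY hσ) (mulOp (fun p => jsym (2 / 3) p.2.1) (Fx fx)),
    mulOp_ae hs.coef (Fx fx), h.Fx_trX_ae] with p h1 h2 h3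
  rw [h1, h2, h3]

section Weighted

variable {T σ : ℝ} (hσ : 0 ≤ σ) {f : R3 → ℂ} (hf : MemLp f 2 (volume.restrict (slab T))) {fx : HH}
  (h : HasD trX (ez T f) fx)
include hσ hf h

/-- On the Fourier side this is |ξ|⟨ξ⟩^{-2/3} ≤ ⟨ξ⟩^{1/3}; the companion bound uses ⟨ξ⟩ ≤ 1 + |ξ|
and pays with ‖f‖. -/
lemma le_normLam_wtY :
    ‖mulOp (fun p => (wtY σ p : ℂ)) (J (2 / 3) fx)‖ₑ ≤ normLam T (-σ / 2) (1 / 3) f := by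
  rw [normLam_eq _ _ hf, norm_eq_Fx]
  refine eLpNorm_mono_ae ?_
  filter_upwards [Fx_wtY_J_ae hσ h] with p hp
  rw [hp, norm_mul, norm_mul, norm_mul, norm_mul, norm_jsym, Complex.norm_real, Complex.norm_real,
    Real.norm_of_nonneg (wtY_pos σ p).le, Real.norm_of_nonneg (by
      have := bracket_pos p.2.2; have := br_pos p.2.1; positivity), ← mul_assoc, ← mul_assoc]
  refine mul_le_mul_of_nonneg_right ?_ (norm_nonneg _)
  rw [mul_assoc]
  refine mul_le_mul_of_nonneg_left ?_ (wtY_pos σ p).le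
  calc br p.2.1 ^ (-(2 / 3) : ℝ) * ‖dsym p.2.1‖ ≤ br p.2.1 ^ (-(2 / 3) : ℝ) * br p.2.1 ^ (1 : ℝ) := by
        rw [Real.rpow_one]
        exact mul_le_mul_of_nonneg_left (norm_dsym_le _) (Real.rpow_nonneg (br_pos _).le _)
    _ = br p.2.1 ^ (1 / 3 : ℝ) := by rw [← Real.rpow_add (br_pos _)]; norm_num

lemma normLam_wtY_le : normLam T (-σ / 2) (1 / 3) f ≤
    ‖mulOp (fun p => (wtY σ p : ℂ)) (J (2 / 3) fx)‖ₑ + ‖ez T f‖ₑ := by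
  rw [normLam_eq _ _ hf, norm_eq_Fx, norm_eq_Fx (ez T f)]
  set Y := Fx (mulOp (fun p => (wtY σ p : ℂ)) (J (2 / 3) fx)) with hY
  set X := Fx (ez T f)
  rw [← eLpNorm_norm Y, ← eLpNorm_norm X]
  refine le_trans ?_ (eLpNorm_add_le (Lp.memLp Y).1.norm (Lp.memLp X).1.norm (by norm_num))
  refine eLpNorm_mono_ae ?_
  filter_upwards [Fx_wtY_J_ae hσ h] with p hp
  have hb := br_pos p.2.1
  have hw := wtY_pos σ p
  rw [Pi.add_apply, Real.norm_of_nonneg (by positivity), hY, hp, norm_mul, norm_mul, norm_mul,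
    norm_mul, norm_jsym, Complex.norm_real, Complex.norm_real,
    Real.norm_of_nonneg hw.le, Real.norm_of_nonneg (by
      have := bracket_pos p.2.2; positivity)]
  change wtY σ p * br p.2.1 ^ (1 / 3 : ℝ) * ‖X p‖ ≤
    wtY σ p * (br p.2.1 ^ (-(2 / 3) : ℝ) * (‖dsym p.2.1‖ * ‖X p‖)) + ‖X p‖
  have e1 : br p.2.1 ^ (1 / 3 : ℝ) = br p.2.1 ^ (-(2 / 3) : ℝ) * br p.2.1 := by
    nth_rewrite 3 [← Real.rpow_one (br p.2.1)]
    rw [← Real.rpow_add hb]; norm_num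
  have e2 : br p.2.1 ≤ 1 + ‖dsym p.2.1‖ := by
    have := br_sq p.2.1
    nlinarith [norm_nonneg (dsym p.2.1)]
  have e3 : br p.2.1 ^ (-(2 / 3) : ℝ) ≤ 1 :=
    Real.rpow_le_one_of_one_le_of_nonpos (one_le_br _) (by norm_num)
  have e4 := wtY_le_one hσ p
  have e5 : 0 < br p.2.1 ^ (-(2 / 3) : ℝ) := Real.rpow_pos_of_pos hb _
  have e6 : wtY σ p * br p.2.1 ^ (1 / 3 : ℝ) ≤
      wtY σ p * (br p.2.1 ^ (-(2 / 3) : ℝ) * ‖dsym p.2.1‖) + 1 := by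
    rw [e1]
    calc wtY σ p * (br p.2.1 ^ (-(2 / 3) : ℝ) * br p.2.1)
        ≤ wtY σ p * (br p.2.1 ^ (-(2 / 3) : ℝ) * (1 + ‖dsym p.2.1‖)) := by gcongr
      _ = wtY σ p * (br p.2.1 ^ (-(2 / 3) : ℝ) * ‖dsym p.2.1‖) +
          wtY σ p * br p.2.1 ^ (-(2 / 3) : ℝ) := by ring
      _ ≤ _ := by
        gcongr
        exact mul_le_one₀ e4 e5.le e3
  calc _ ≤ (wtY σ p * (br p.2.1 ^ (-(2 / 3) : ℝ) * ‖dsym p.2.1‖) + 1) * ‖X p‖ :=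
        mul_le_mul_of_nonneg_right e6 (norm_nonneg _)
    _ = _ := by ring

end Weighted

lemma inv_sqrt_hardyWeight_le {σ : ℝ} (hσ : 1 / 2 < σ) (y : ℝ) :
    (√(hardyWeight σ y))⁻¹ ≤ (√(2 * σ - 1))⁻¹ * 2 ^ σ * bracket y ^ σ := by
  have h0 : 0 < 1 + |y| := by positivity
  have e : √((1 + |y|) ^ (-(2 * σ))) = (1 + |y|) ^ (-σ) := by
    rw [Real.sqrt_eq_rpow, ← Real.rpow_mul h0.le]; congr 1; ring
  rw [hardyWeight, Real.sqrt_mul (by linarith), e, mul_inv, ← Real.rpow_neg h0.le, neg_neg, mul_assoc,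
    ← Real.mul_rpow zero_le_two (bracket_pos _).le]
  refine mul_le_mul_of_nonneg_left (Real.rpow_le_rpow h0.le ?_ (by linarith)) (by positivity)
  linarith [one_le_bracket y, abs_le_bracket y]

/-- Division by √ω, which is comparable to ⟨y⟩^{-σ}, turns the weighted norm of Λ^{-1/3}q into a
plain L² norm; finiteness of that norm is what makes r exist. -/
lemma exists_hardy_factor {T σ : ℝ} (hσ : 1 / 2 < σ) {q : R3 → ℂ}
    (hq : MemLp q 2 (volume.restrict (slab T))) (hfin : normLam T σ (-1 / 3) q ≠ ⊤) :
    ∃ r : HH, J (1 / 3) (ez T q) = mulOp (fun z => (√(hardyWeight σ z.2.2) : ℂ)) r ∧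
      ‖r‖ ≤ (√(2 * σ - 1))⁻¹ * 2 ^ σ * (normLam T σ (-1 / 3) q).toReal := by
  set A := (√(2 * σ - 1))⁻¹ * 2 ^ σ with hA
  have hA0 : 0 ≤ A := by positivity
  have hs : IsSym (jsym (1 / 3)) := isSym_jsym (by norm_num)
  have hc := isCoef_sqrt_hardyWeight hσ
  rw [normLam_eq _ _ hq] at *
  set X := Fx (ez T q) with hX
  set G : R3 → ℂ := fun p => ((bracket p.2.2 ^ σ * br p.2.1 ^ (-1 / 3 : ℝ) : ℝ) : ℂ) * X p with hG
  set R : R3 → ℂ := fun p => ((√(hardyWeight σ p.2.2))⁻¹ : ℂ) * (jsym (1 / 3) p.2.1 * X p) with hR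
  have hRm : AEStronglyMeasurable R volume :=
    hc.1.inv.aestronglyMeasurable.mul (hs.coef.1.aestronglyMeasurable.mul (Lp.memLp X).1)
  have hle : ∀ p, ‖R p‖ ≤ A * ‖G p‖ := by
    intro p
    have hb := br_pos p.2.1
    have hy := bracket_pos p.2.2
    simp only [hR, hG]
    rw [norm_mul, norm_mul, norm_mul, norm_inv, Complex.norm_real, Complex.norm_real, norm_jsym,
      Real.norm_of_nonneg (Real.sqrt_nonneg _), Real.norm_of_nonneg (by positivity),
      show (-1 / 3 : ℝ) = -(1 / 3) by norm_num, ← mul_assoc, ← mul_assoc, ← mul_assoc]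
    gcongr
    exact inv_sqrt_hardyWeight_le hσ _
  have hnorm : eLpNorm R 2 volume ≤ ENNReal.ofReal A * eLpNorm G 2 volume :=
    eLpNorm_le_mul_eLpNorm_of_ae_le_mul (Eventually.of_forall hle) 2
  have hRmem : MemLp R 2 volume :=
    ⟨hRm, hnorm.trans_lt (ENNReal.mul_lt_top ENNReal.ofReal_lt_top (lt_top_iff_ne_top.2 hfin))⟩
  refine ⟨Fx.symm (hRmem.toLp R), ?_, ?_⟩
  · apply Fx.injective
    rw [Fx_mulOp hc (α := fun q => (√(hardyWeight σ q.2) : ℂ)) (fun p => rfl),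
      LinearIsometryEquiv.apply_symm_apply, J, Fx_mult]
    apply Lp.ext
    filter_upwards [mulOp_ae hs.coef X, mulOp_ae hc (hRmem.toLp R), hRmem.coeFn_toLp] with p h1 h2 h3
    rw [h1, h2, h3]
    have : ((√(hardyWeight σ p.2.2) : ℝ) : ℂ) ≠ 0 := by
      rw [Complex.ofReal_ne_zero]; exact (Real.sqrt_pos.2 (hardyWeight_pos hσ _)).ne'
    simp only [hR]
    rw [mul_inv_cancel_left₀ this]
  · rw [LinearIsometryEquiv.norm_map, Lp.norm_toLp]
    refine (ENNReal.toReal_mono (ENNReal.mul_ne_top ENNReal.ofReal_ne_top hfin) hnorm).trans ?_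
    rw [ENNReal.toReal_mul, ENNReal.toReal_ofReal hA0]

end Prandtl

end

/-! ### Assembly of the two estimates. -/

theorem proposition2p4 (σ Cs c C₀ : ℝ) (hσ : 1 / 2 < σ) (hCs : 1 < Cs) (hc : 0 < c)
    (hC₀ : 0 < C₀) :
    (∀ ε : ℝ, 0 < ε → ∃ C : ℝ, 0 < C ∧
      ∀ (N₀ : ℕ) (T : ℝ) (u v : ℝ × ℝ × ℝ → ℝ), 7 ≤ N₀ → 0 < T →
      Prandtl.IsPrandtlSolution T u v → Prandtl.IsMonotoneFlow T σ Cs u →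
      Prandtl.HasDecay T c C₀ N₀ u →
      ∀ f ft fx fy fxx fxy fyy fyyy h hy g gy : ℝ × ℝ × ℝ → ℂ,
      Prandtl.IsLinearizedSolution T u v f ft fx fy fxx fxy fyy fyyy h hy g gy →
      Prandtl.normLam T (-σ / 2) (1 / 3) f + Prandtl.normLam T 0 (-1 / 3) fyy ≤
        ENNReal.ofReal ε * Prandtl.normLam T 0 (-2 / 3) hy +
        ENNReal.ofReal C *
          (Prandtl.normLam T 0 (-1 / 3) h + Prandtl.normL2 T fy + Prandtl.normL2 T f) +
        ENNReal.ofReal C *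
          (Prandtl.normLam T (-σ / 2) (1 / 6) fy + Prandtl.normLam T σ (-1 / 3) gy)) ∧
    (∃ C : ℝ, 0 < C ∧
      ∀ (N₀ : ℕ) (T : ℝ) (u v : ℝ × ℝ × ℝ → ℝ), 7 ≤ N₀ → 0 < T →
      Prandtl.IsPrandtlSolution T u v → Prandtl.IsMonotoneFlow T σ Cs u →
      Prandtl.HasDecay T c C₀ N₀ u →
      ∀ f ft fx fy fxx fxy fyy fyyy h hy g gy : ℝ × ℝ × ℝ → ℂ,
      Prandtl.IsLinearizedSolution T u v f ft fx fy fxx fxy fyy fyyy h hy g gy →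
      Prandtl.normLam T 0 (-2 / 3) fyyy ≤
        ENNReal.ofReal C *
          (Prandtl.normLam T (-σ / 2) (1 / 3) f + Prandtl.normLam T 0 (-2 / 3) hy +
            Prandtl.normL2 T fy + Prandtl.normL2 T f)) := by
  obtain ⟨K, hK, hF⟩ := Prandtl.exists_flowBound σ Cs c C₀ hσ hCs hc hC₀
  have hσ0 : 0 ≤ σ := by linarith
  have e13 : (-1 / 3 : ℝ) = -(1 / 3) := by norm_num
  have e23 : (-2 / 3 : ℝ) = -(2 / 3) := by norm_num
  have h13 : (0 : ℝ) ≤ 1 / 3 := by norm_num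
  have h23 : (0 : ℝ) ≤ 2 / 3 := by norm_num
  refine ⟨fun ε hε => ?_, ?_⟩
  · obtain ⟨M, hM, hmain⟩ := Prandtl.exists_norm_wtY_le hσ hK hε
    set A := (√(2 * σ - 1))⁻¹ * 2 ^ σ with hA
    have hA0 : 0 ≤ A := by positivity
    -- The +1 pays for ‖f‖ in passing from Λ^{-2/3}f_x to Λ^{1/3}f, and A is the constant between
    -- the Hardy weight and ⟨y⟩^σ.
    refine ⟨(M + 1) * (1 + A), by positivity, ?_⟩
    intro N₀ T u v hN hT hP hmon hdec f ft fx fy fxx fxy fyy fyyy h hy g gy S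
    have F := hF N₀ T u v hN hP hmon hdec
    obtain ⟨wt, L⟩ := S.exists_linSol (uy := (Prandtl.slab T).indicator (Prandtl.dy u))
      (vy := (Prandtl.slab T).indicator fun p => -Prandtl.dx u p) F.coef_u F.coef_v
    have hC : 0 < (M + 1) * (1 + A) := by positivity
    by_cases hfin : Prandtl.normLam T σ (-1 / 3) gy = ⊤
    · rw [hfin, add_top, ENNReal.mul_top (ENNReal.ofReal_pos.2 hC).ne', add_top]
      exact le_top
    obtain ⟨r, hr, hrle⟩ := Prandtl.exists_hardy_factor hσ S.memLp_gy hfin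
    have key := hmain F L (Prandtl.isUp_ez S.memLp_g) hr
    have hleft := add_le_add_left (Prandtl.normLam_wtY_le hσ0 S.memLp_f L.dX_f)
      (Prandtl.normLam T 0 (-1 / 3) fyy)
    -- The term with Λ^{1/6} is dropped from the right side, so it need not even be finite.
    refine hleft.trans (le_trans ?_ (add_le_add_right (mul_le_mul_right
      (le_add_left le_rfl : Prandtl.normLam T σ (-1 / 3) gy ≤ _) _) _))
    rw [← ENNReal.ofReal_toReal hfin]
    set G := (Prandtl.normLam T σ (-1 / 3) gy).toReal
    have hG : 0 ≤ G := ENNReal.toReal_nonneg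
    rw [e13, e23, Prandtl.normLam_neg h13 S.memLp_fyy, Prandtl.normLam_neg h23 S.memLp_hy,
      Prandtl.normLam_neg h13 S.memLp_h, Prandtl.normL2_eq S.memLp_fy, Prandtl.normL2_eq S.memLp_f]
    simp only [Prandtl.enorm_eq_ofReal]
    rw [← ENNReal.ofReal_add (by positivity) (by positivity),
      ← ENNReal.ofReal_add (by positivity) (by positivity), ← ENNReal.ofReal_mul hε.le,
      ← ENNReal.ofReal_add (by positivity) (by positivity),
      ← ENNReal.ofReal_add (by positivity) (by positivity), ← ENNReal.ofReal_mul hC.le,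
      ← ENNReal.ofReal_mul hC.le, ← ENNReal.ofReal_add (by positivity) (by positivity),
      ← ENNReal.ofReal_add (by positivity) (by positivity)]
    refine ENNReal.ofReal_le_ofReal ?_
    have n1 := norm_nonneg (Prandtl.J (1 / 3) (Prandtl.ez T h))
    have n2 := norm_nonneg (Prandtl.ez T fy)
    have n3 := norm_nonneg (Prandtl.ez T f)
    have b1 : M + 1 ≤ (M + 1) * (1 + A) := le_mul_of_one_le_right (by linarith) (by linarith)
    have b2 : M * ‖r‖ ≤ (M + 1) * (1 + A) * G := by
      rw [mul_assoc]
      refine mul_le_mul (by linarith) (hrle.trans ?_) (norm_nonneg _) (by linarith)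
      exact mul_le_mul_of_nonneg_right (by linarith) hG
    have b3 := mul_le_mul_of_nonneg_right b1 (by positivity :
      0 ≤ ‖Prandtl.J (1 / 3) (Prandtl.ez T h)‖ + ‖Prandtl.ez T fy‖ + ‖Prandtl.ez T f‖)
    linarith only [key, n1, n2, b2, b3]
  · obtain ⟨M, hM, hmain⟩ := Prandtl.exists_norm_J_wyy_le hσ0 hK
    have hM0 : 0 ≤ M := by linarith
    refine ⟨M, by linarith, ?_⟩
    intro N₀ T u v hN hT hP hmon hdec f ft fx fy fxx fxy fyy fyyy h hy g gy S
    have F := hF N₀ T u v hN hP hmon hdec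
    obtain ⟨wt, L⟩ := S.exists_linSol (uy := (Prandtl.slab T).indicator (Prandtl.dy u))
      (vy := (Prandtl.slab T).indicator fun p => -Prandtl.dx u p) F.coef_u F.coef_v
    have key := hmain F L
    have hle := Prandtl.le_normLam_wtY hσ0 S.memLp_f L.dX_f
    refine le_trans ?_ (mul_le_mul_right (add_le_add_left (add_le_add_left
      (add_le_add_left hle _) _) _) _)
    rw [e23, Prandtl.normLam_neg h23 S.memLp_fyyy, Prandtl.normLam_neg h23 S.memLp_hy,
      Prandtl.normL2_eq S.memLp_fy, Prandtl.normL2_eq S.memLp_f]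
    simp only [Prandtl.enorm_eq_ofReal]
    rw [← ENNReal.ofReal_add (by positivity) (by positivity),
      ← ENNReal.ofReal_add (by positivity) (by positivity),
      ← ENNReal.ofReal_add (by positivity) (by positivity), ← ENNReal.ofReal_mul hM0]
    exact ENNReal.ofReal_le_ofReal (key.trans (le_of_eq (by ring)))
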